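/- Let $(Z_i)_{i\ge 1}$ be iid real random variables with $Z_1\in RV_{-\alpha}$, $\alpha>1$. This means: for some regularly varying sequence $a_n>0$, the measures $a_n P(Z_1/n\in\cdot)$ converge in $\mathbb M(\mathbb R\setminus\{0\})$ to a non-zero measure $\mu$ with $\mu(sA)=s^{-\alpha}\mu(A)$ for all $s>0$ and all Borel sets $A\subset\mathbb R\setminus\{0\}$, and, for some $p\in[0,1]$ and $q=1-p$, $P(Z_1>n)/P(|Z_1|>n)\to p$ and $P(Z_1<-n)/P(|Z_1|>n)\to q$. Let $\nu_\alpha$ be the measure on $\mathbb R\setminus\{0\}$ with $\nu_\alpha((-\infty,-y)\cup(x,\infty))=q\,y^{-\alpha}+p\,x^{-\alpha}$ for $x,y>0$. Here, for a closed subset $C$ of a metric space $S$, $\mathbb M(S\setminus C)$ is the set of Borel measures on $S\setminus C$ that are finite on Borel sets bounded away from $C$ (sets $A$ with $\inf\{d(x,y):x\in A,\,y\in C\}>0$), and $\mu_n\to\mu_0$ in $\mathbb M(S\setminus C)$ means that $\limsup_n\mu_n(F)\le\mu_0(F)$ for all closed sets $F$ and $\liminf_n\mu_n(G)\ge\mu_0(G)$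 for all open sets $G$ that are bounded away from $C$. Let $M>0$ (for instance $M=1$) and let $\mathbb D=\mathbb D([0,M],\mathbb R)$ be the space of real c\`adl\`ag functions on $[0,M]$ with the Skorohod metric $d_{J_1}(f,g)=\inf_\lambda\max\{\sup_t|f(t)-g(\lambda(t))|,\ \sup_t|\lambda(t)-t|\}$, the infimum being over all strictly increasing continuous bijections $\lambda$ of $[0,M]$. Let $\boldsymbol X^{(n)}(t)=\sum_{k=1}^{\lfloor nt\rfloor}Z_k$ for $t\in[0,M]$. For $j\ge 0$ let $U_j^\uparrow=\{\boldsymbol u\in[0,M]^j: 0\le u_1<\dots<u_j\le M\}$. Then $m=E[Z_1]$ exists. For $j\ge 0$ define $$h_j^m:(\mathbb R\setminus\{0\})^j\times U_j^\uparrow\to\mathbb D,\qquad h_j^m(\boldsymbol z,\boldsymbol u)(t)=\sum_{i=1}^j z_i\mathbf 1\{u_i\le t\}+mt,$$ let $\mathbb D^m_{=j}$ be the image of $h_j^m$ (so $\mathbb D^m_{=0}=\{t\mapsto mt\}$), and put $\mathbb D^m_{\le j}=\bigcup_{i=0}^j\mathbb D^m_{=i}$, which is closed in $\mathbb D$. Then,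 for every $j\ge 1$, with $\gamma_n^{(j)}=[\,n\,P(|Z_1|>n)\,]^{-j}$, $$\gamma_n^{(j)}\,P(\boldsymbol X^{(n)}/n\in\cdot\,)\ \longrightarrow\ (\nu_\alpha^j\times\mathrm{Leb}_j)\circ(h_j^m)^{-1}(\cdot)\qquad(n\to\infty)$$ in $\mathbb M(\mathbb D\setminus\mathbb D^m_{\le j-1})$. -/

import Mathlib

open MeasureTheory ProbabilityTheory Filter Topology Set
open scoped ENNReal

noncomputable section

namespace HiddenLD

/-! ### Convergence in `𝕄(S \ C)` -/

section MO

variable {S : Type*} [PseudoEMetricSpace S] [MeasurableSpace S]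

/-- `μ ∈ 𝕄(S \ C)`: finite on every Borel set bounded away from `C`. A measure on `S \ C` is
represented by a measure on `S`; only its values on sets bounded away from `C` are ever used. -/
def FiniteAwayFrom (C : Set S) (μ : Measure S) : Prop :=
  ∀ A : Set S, MeasurableSet A → Metric.AreSeparated A C → μ A < ∞

/-- `μ n → μ₀` in `𝕄(S \ C)` as `n → ∞`, for a closed set `C`. -/
structure TendstoMO (C : Set S) (μ : ℕ → Measure S) (μ₀ : Measure S) : Prop where
  isClosed : IsClosed C
  finite_seq : ∀ n, FiniteAwayFrom C (μ n)
  finite_lim : FiniteAwayFrom C μ₀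
  limsup_le : ∀ F : Set S, IsClosed F → Metric.AreSeparated F C →
    limsup (fun n => μ n F) atTop ≤ μ₀ F
  le_liminf : ∀ G : Set S, IsOpen G → Metric.AreSeparated G C →
    μ₀ G ≤ liminf (fun n => μ n G) atTop

end MO

/-! ### Regular variation -/

/-- A sequence of positive numbers `(a n)`, `n ≥ 1`, is regularly varying with index `ρ`. -/
def RegVarSeq (a : ℕ → ℝ) (ρ : ℝ) : Prop :=
  (∀ n, 1 ≤ n → 0 < a n) ∧
    ∀ c : ℝ, 0 < c → Tendsto (fun n : ℕ => a ⌊c * n⌋₊ / a n) atTop (𝓝 (c ^ ρ))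

/-- `X ∈ RV_{-α}`, with the tail balance condition with constants `p` and `q = 1 - p`. -/
structure IsRegVar {Ω : Type*} [MeasurableSpace Ω] (P : Measure Ω) (X : Ω → ℝ) (α p : ℝ) :
    Prop where
  /-- `γ n • P(X / n ∈ ·)` converges in `𝕄(ℝ \ {0})` to a nonzero measure that is homogeneous
  of order `-α`, for some regularly varying sequence `γ`. -/
  exists_limit : ∃ (γ : ℕ → ℝ) (ρ : ℝ) (μ : Measure ℝ), RegVarSeq γ ρ ∧ μ {0} = 0 ∧ μ ≠ 0 ∧
    TendstoMO {0} (fun n => ENNReal.ofReal (γ n) • P.map (fun ω => X ω / n)) μ ∧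
    ∀ s : ℝ, 0 < s → ∀ A : Set ℝ, MeasurableSet A → A ⊆ {0}ᶜ →
      μ ((fun x => s * x) '' A) = ENNReal.ofReal (s ^ (-α)) * μ A
  p_nonneg : 0 ≤ p
  p_le_one : p ≤ 1
  tail_pos : Tendsto (fun n : ℕ => P.real {ω | (n : ℝ) < X ω} / P.real {ω | (n : ℝ) < |X ω|})
    atTop (𝓝 p)
  tail_neg : Tendsto (fun n : ℕ => P.real {ω | X ω < -(n : ℝ)} / P.real {ω | (n : ℝ) < |X ω|})
    atTop (𝓝 (1 - p))

/-- The measure `ν_α`, extended by `ν_α {0} = 0`, through its density `p α x ^ (-α - 1)` on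
`(0, ∞)` and `q α |x| ^ (-α - 1)` on `(-∞, 0)`, `q = 1 - p`; see `nuAlpha_tails`. -/
def nuAlpha (α p : ℝ) : Measure ℝ :=
  volume.withDensity fun x =>
    ENNReal.ofReal (if 0 < x then p * (α * x ^ (-α - 1))
      else if x < 0 then (1 - p) * (α * (-x) ^ (-α - 1)) else 0)

theorem nuAlpha_tails {α p : ℝ} (hα : 0 < α) (hp₀ : 0 ≤ p) (hp₁ : p ≤ 1) {x y : ℝ}
    (hx : 0 < x) (hy : 0 < y) :
    nuAlpha α p (Iio (-y) ∪ Ioi x) =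
      ENNReal.ofReal ((1 - p) * y ^ (-α) + p * x ^ (-α)) := by
  have key : ∀ k c : ℝ, 0 ≤ k → 0 < c →
      ∫⁻ t in Ioi c, ENNReal.ofReal (k * (α * t ^ (-α - 1))) =
        ENNReal.ofReal (k * c ^ (-α)) := by
    intro k c hk hc
    have hi : IntegrableOn (fun t : ℝ => k * (α * t ^ (-α - 1))) (Ioi c) :=
      ((integrableOn_Ioi_rpow_of_lt (by linarith) hc).const_mul α).const_mul k
    rw [← ofReal_integral_eq_lintegral_ofReal hi]
    · rw [integral_const_mul, integral_const_mul, integral_Ioi_rpow_of_lt (by linarith) hc]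
      congr 2
      rw [sub_add_cancel]
      field_simp
    · filter_upwards [ae_restrict_mem measurableSet_Ioi] with t ht
      have : 0 < t := hc.trans ht
      positivity
  have hdisj : Disjoint (Iio (-y)) (Ioi x) :=
    Set.disjoint_left.2 fun t h1 h2 => by
      have h1' : t < -y := h1
      have h2' : x < t := h2
      linarith
  rw [measure_union hdisj measurableSet_Ioi, nuAlpha, withDensity_apply _ measurableSet_Iio,
    withDensity_apply _ measurableSet_Ioi,
    ENNReal.ofReal_add (mul_nonneg (by linarith) (Real.rpow_nonneg hy.le _))
      (mul_nonneg hp₀ (Real.rpow_nonneg hx.le _)),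
    ← key (1 - p) y (by linarith) hy, ← key p x hp₀ hx]
  congr 1
  · have hpre : Neg.neg ⁻¹' Iio (-y) = Ioi y := by
      ext t; simp
    rw [← (Measure.measurePreserving_neg (volume : Measure ℝ)).setLIntegral_comp_preimage_emb
      (MeasurableEquiv.neg ℝ).measurableEmbedding, hpre]
    refine setLIntegral_congr_fun measurableSet_Ioi fun t ht => ?_
    have ht' : 0 < t := hy.trans ht
    simp only [if_neg (show ¬ 0 < -t by linarith), if_pos (show -t < 0 by linarith), neg_neg]
  · refine setLIntegral_congr_fun measurableSet_Ioi fun t ht => ?_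
    simp only [if_pos (hx.trans ht)]

/-! ### The space `𝔻` of càdlàg functions on `[0, M]` with the Skorohod `J₁` metric -/

/-- Right continuous with left limits. -/
def IsCadlag {T : Type*} [TopologicalSpace T] [Preorder T] (f : T → ℝ) : Prop :=
  ∀ t, ContinuousWithinAt f (Ici t) t ∧ ∃ l, Tendsto f (𝓝[<] t) (𝓝 l)

/-- The space `𝔻([0, M], ℝ)`. -/
structure SkorohodSpace (M : ℝ) where
  toFun : Icc (0 : ℝ) M → ℝ
  cadlag : IsCadlag toFun

namespace SkorohodSpace

variable {M : ℝ}

/-- The `J₁` distance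
`inf_λ max (sup_t |f t - g (λ t)|, sup_t |λ t - t|)`, where `λ` ranges over the strictly
increasing continuous functions of `[0, M]` onto itself, that is, its order automorphisms. -/
def dJ1 (f g : SkorohodSpace M) : ℝ≥0∞ :=
  ⨅ l : Icc (0 : ℝ) M ≃o Icc (0 : ℝ) M,
    max (⨆ t, edist (f.toFun t) (g.toFun (l t))) (⨆ t, edist (l t) t)

theorem dJ1_self (f : SkorohodSpace M) : dJ1 f f = 0 := by
  refine le_antisymm ((iInf_le _ (OrderIso.refl _)).trans ?_) zero_le
  simp

theorem dJ1_comm_le (f g : SkorohodSpace M) : dJ1 f g ≤ dJ1 g f := by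
  refine le_iInf fun l => (iInf_le _ l.symm).trans ?_
  refine max_le_max (iSup_le fun t => ?_) (iSup_le fun t => ?_)
  · refine le_trans (le_of_eq ?_) (le_iSup _ (l.symm t))
    rw [l.apply_symm_apply, edist_comm]
  · refine le_trans (le_of_eq ?_) (le_iSup _ (l.symm t))
    rw [l.apply_symm_apply, edist_comm]

theorem dJ1_triangle (f g h : SkorohodSpace M) : dJ1 f h ≤ dJ1 f g + dJ1 g h := by
  unfold dJ1
  rw [ENNReal.iInf_add]
  refine le_iInf fun l => ?_
  rw [ENNReal.add_iInf]
  refine le_iInf fun k => (iInf_le _ (l.trans k)).trans ?_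
  refine max_le (iSup_le fun t => ?_) (iSup_le fun t => ?_)
  · refine (edist_triangle _ (g.toFun (l t)) _).trans (add_le_add ?_ ?_)
    · exact le_max_of_le_left (le_iSup (fun t => edist (f.toFun t) (g.toFun (l t))) t)
    · exact le_max_of_le_left (le_iSup (fun t => edist (g.toFun t) (h.toFun (k t))) (l t))
  · refine (edist_triangle _ (l t) _).trans ?_
    rw [add_comm]
    refine add_le_add ?_ ?_
    · exact le_max_of_le_right (le_iSup (fun t => edist (l t) t) t)
    · exact le_max_of_le_right (le_iSup (fun t => edist (k t) t) (l t))

instance : PseudoEMetricSpace (SkorohodSpace M) where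
  edist := dJ1
  edist_self := dJ1_self
  edist_comm f g := le_antisymm (dJ1_comm_le f g) (dJ1_comm_le g f)
  edist_triangle := dJ1_triangle

instance : MeasurableSpace (SkorohodSpace M) := borel _

instance : BorelSpace (SkorohodSpace M) := ⟨rfl⟩

end SkorohodSpace

/-! ### Càdlàg building blocks -/

theorem IsCadlag.add {T : Type*} [TopologicalSpace T] [Preorder T] {f g : T → ℝ}
    (hf : IsCadlag f) (hg : IsCadlag g) : IsCadlag fun t => f t + g t := fun t =>
  ⟨(hf t).1.add (hg t).1, by
    obtain ⟨a, ha⟩ := (hf t).2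
    obtain ⟨b, hb⟩ := (hg t).2
    exact ⟨a + b, ha.add hb⟩⟩

theorem isCadlag_of_continuous {T : Type*} [TopologicalSpace T] [Preorder T] {f : T → ℝ}
    (hf : Continuous f) : IsCadlag f := fun t =>
  ⟨hf.continuousWithinAt, f t, hf.continuousWithinAt⟩

theorem IsCadlag.sum {T ι : Type*} [TopologicalSpace T] [Preorder T] (s : Finset ι)
    {f : ι → T → ℝ} (hf : ∀ i, IsCadlag (f i)) : IsCadlag fun t => ∑ i ∈ s, f i t := by
  classical
  induction s using Finset.induction_on with
  | empty => simpa using isCadlag_of_continuous (T := T) (f := fun _ => (0 : ℝ)) continuous_const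
  | insert a s ha ih => simpa only [Finset.sum_insert ha] using (hf a).add ih

theorem isCadlag_jump {M : ℝ} (z u : ℝ) :
    IsCadlag fun t : Icc (0 : ℝ) M => if u ≤ (t : ℝ) then z else 0 := by
  intro t
  have hc : Continuous fun s : Icc (0 : ℝ) M => (s : ℝ) := continuous_subtype_val
  constructor
  · by_cases h : u ≤ (t : ℝ)
    · refine (continuousWithinAt_const (b := z)).congr (fun s hs => ?_) (if_pos h)
      exact if_pos (h.trans hs)
    · refine ((continuousAt_const (y := (0 : ℝ))).congr ?_).continuousWithinAt
      filter_upwards [hc.continuousAt.eventually_lt_const (not_le.1 h)] with s hs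
      exact (if_neg (not_le.2 hs)).symm
  · by_cases h : u < (t : ℝ)
    · refine ⟨z, tendsto_const_nhds.congr' ?_⟩
      filter_upwards [nhdsWithin_le_nhds (hc.continuousAt.eventually_const_lt h)] with s hs
      exact (if_pos hs.le).symm
    · refine ⟨0, tendsto_const_nhds.congr' ?_⟩
      filter_upwards [self_mem_nhdsWithin] with s hs
      have hs' : (s : ℝ) < t := hs
      exact (if_neg (not_le.2 (hs'.trans_le (not_lt.1 h)))).symm

theorem isCadlag_floor {M : ℝ} (n : ℕ) (g : ℕ → ℝ) :
    IsCadlag fun t : Icc (0 : ℝ) M => g ⌊(n : ℝ) * t⌋₊ := by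
  rcases Nat.eq_zero_or_pos n with rfl | hn
  · simpa using isCadlag_of_continuous (T := Icc (0 : ℝ) M) (f := fun _ => g 0) continuous_const
  have hn' : (0 : ℝ) < n := by exact_mod_cast hn
  have hc : Continuous fun s : Icc (0 : ℝ) M => (n : ℝ) * (s : ℝ) := by fun_prop
  intro t
  constructor
  · have h1 : Tendsto (fun s : Icc (0 : ℝ) M => (n : ℝ) * (s : ℝ)) (𝓝[≥] t)
        (𝓝[≥] ((n : ℝ) * (t : ℝ))) :=
      tendsto_nhdsWithin_iff.2 ⟨hc.continuousWithinAt, by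
        filter_upwards [self_mem_nhdsWithin] with s hs
        exact mul_le_mul_of_nonneg_left hs hn'.le⟩
    have h2 := tendsto_pure.1 ((tendsto_floor_right_pure_floor ((n : ℝ) * (t : ℝ))).comp h1)
    refine (tendsto_const_nhds (x := g ⌊(n : ℝ) * t⌋₊)).congr' ?_
    filter_upwards [h2] with s hs
    simp only [Function.comp_apply] at hs
    rw [← Int.floor_toNat, ← Int.floor_toNat, hs]
  · have h1 : Tendsto (fun s : Icc (0 : ℝ) M => (n : ℝ) * (s : ℝ)) (𝓝[<] t)
        (𝓝[<] ((n : ℝ) * (t : ℝ))) :=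
      tendsto_nhdsWithin_iff.2 ⟨hc.continuousWithinAt, by
        filter_upwards [self_mem_nhdsWithin] with s hs
        exact mul_lt_mul_of_pos_left hs hn'⟩
    have h2 := tendsto_pure.1 ((tendsto_floor_left_pure_ceil_sub_one ((n : ℝ) * (t : ℝ))).comp h1)
    refine ⟨g (⌈(n : ℝ) * t⌉ - 1).toNat, tendsto_const_nhds.congr' ?_⟩
    filter_upwards [h2] with s hs
    simp only [Function.comp_apply] at hs
    rw [← Int.floor_toNat, hs]

/-! ### Random walk paths, step functions with drift, and the limit measure -/

/-- The path `t ↦ S_⌊nt⌋ / n`, `t ∈ [0, M]`, where `S_k` is the sum of the first `k` terms of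
`z`. -/
def walkPath (M : ℝ) (n : ℕ) (z : ℕ → ℝ) : SkorohodSpace M where
  toFun t := (∑ k ∈ Finset.range ⌊(n : ℝ) * t⌋₊, z k) / n
  cadlag := isCadlag_floor n fun N => (∑ k ∈ Finset.range N, z k) / n

/-- The set `U_j^↑` of jump times `0 ≤ u_1 < ⋯ < u_j ≤ M`. -/
def jumpTimes (M : ℝ) (j : ℕ) : Set (Fin j → ℝ) :=
  {u | StrictMono u ∧ ∀ i, u i ∈ Icc 0 M}

/-- The domain `(ℝ \ {0})^j × U_j^↑` of `h_j^m`. -/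
def jumpDomain (M : ℝ) (j : ℕ) : Set ((Fin j → ℝ) × (Fin j → ℝ)) :=
  {z | ∀ i, z i ≠ 0} ×ˢ jumpTimes M j

/-- The map `h_j^m`, given on its domain `jumpDomain M j` and beyond by one formula. -/
def stepDrift (M m : ℝ) (j : ℕ) (q : (Fin j → ℝ) × (Fin j → ℝ)) : SkorohodSpace M where
  toFun t := (∑ i, if q.2 i ≤ (t : ℝ) then q.1 i else 0) + m * t
  cadlag := (IsCadlag.sum Finset.univ fun i => isCadlag_jump (q.1 i) (q.2 i)).add
    (isCadlag_of_continuous (by fun_prop))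

/-- `𝔻_{=j}^m`. -/
def stepEq (M m : ℝ) (j : ℕ) : Set (SkorohodSpace M) :=
  stepDrift M m j '' jumpDomain M j

/-- `𝔻_{≤j}^m`. -/
def stepLE (M m : ℝ) (j : ℕ) : Set (SkorohodSpace M) :=
  ⋃ i ∈ Finset.range (j + 1), stepEq M m i

/-- The measure `(ν_α^j × Leb_j) ∘ (h_j^m)⁻¹` on `𝔻`. -/
def limitMeasure (M m α p : ℝ) (j : ℕ) : Measure (SkorohodSpace M) :=
  (((Measure.pi fun _ : Fin j => nuAlpha α p).prod volume).restrict (jumpDomain M j)).map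
    (stepDrift M m j)

/-- The rate `γ_n^{(j)} = (n P(|X| > n))^{-j}`. -/
def rate {Ω : Type*} [MeasurableSpace Ω] (P : Measure Ω) (X : Ω → ℝ) (j n : ℕ) : ℝ :=
  ((n * P.real {ω | (n : ℝ) < |X ω|}) ^ j)⁻¹

end HiddenLD

end

namespace HiddenLD

/-! ### The Skorohod space -/

section Skorohod

variable {M m : ℝ} {j : ℕ}

/-! The limit is produced by finitely many big jumps. Call an increment large when its absolute
value exceeds `n * δ`. By an exponential Chebyshev bound, the walk of the truncated increments stays
within `n * ε` of its drift up to time `n * M`, except with probability `o(n ^ (-r))`, where `r` is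
arbitrary provided `δ` is small enough in terms of `ε` and `r` (`tendsto_rpow_mul_truncDeviation`).
The rate grows at most polynomially, so this exceptional event is negligible. Off it, the path is
within `2 * ε` of the step function with drift whose jumps are the large increments
(`edist_walkPath_le`).

Consider paths in a set at distance `r > 0` from `stepLE M m j`. At most `j` large increments are
then impossible for small `ε`, and `j + 2` or more have probability of the order of the `(j + 2)`-th
power of `n * P(|Z 0| > n)`, which is negligible at rate `j + 1`. So exactly `j + 1` large
increments remain (`measure_walkPath_le`, `gridSum_le_measure_walkPath`). Their sizes and times are
governed by `gridSum`, which is an explicit factor times a product of probability measures: the law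
of `Z 0 / n` conditioned on being large, and the uniform law on the grid of multiples of `1 / n`.
Regular variation gives the limit of the factor and the weak limit of the conditioned law, and the
grid becomes uniform on `[0, M]` (`TailData.gridSum_limits`).

The map from jump data to paths is continuous where the times are distinct and interior
(`continuousAt_stepDrift`); the other times form a Lebesgue null set. The cutoff `δ` leaves no trace
in the limit, because paths at distance `r` from `stepLE M m j` only have jumps of size at least `r`
(`le_abs_of_separated`). Letting `ε` tend to `0` removes the thickening of closed and open sets
(`TailData.tendstoMO`).

Closedness of `stepLE M m j` is a separate argument: a bound on the number of changes of value
survives `J₁` limits, and right continuity turns it back into a bound on the number of jumps. -/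

theorem edist_skorohod_le_of_orderIso {f g : SkorohodSpace M}
    (l : Icc (0 : ℝ) M ≃o Icc (0 : ℝ) M) {c : ℝ}
    (h : ∀ t, |f.toFun t - g.toFun (l t)| ≤ c) (hl : ∀ t, |(l t : ℝ) - t| ≤ c) :
    edist f g ≤ ENNReal.ofReal c := by
  refine (iInf_le _ l).trans (max_le (iSup_le fun t => ?_) (iSup_le fun t => ?_))
  · rw [edist_dist, Real.dist_eq]
    exact ENNReal.ofReal_le_ofReal (h t)
  · rw [edist_dist, Subtype.dist_eq, Real.dist_eq]
    exact ENNReal.ofReal_le_ofReal (hl t)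

theorem edist_skorohod_le {f g : SkorohodSpace M} {c : ℝ} (hc : 0 ≤ c)
    (h : ∀ t, |f.toFun t - g.toFun t| ≤ c) : edist f g ≤ ENNReal.ofReal c :=
  edist_skorohod_le_of_orderIso (OrderIso.refl _) (by simpa using h)
    (fun t => by simpa using hc)

theorem exists_orderIso_of_edist_lt {f g : SkorohodSpace M} {c : ℝ}
    (h : edist f g < ENNReal.ofReal c) :
    ∃ l : Icc (0 : ℝ) M ≃o Icc (0 : ℝ) M,
      (∀ t, |f.toFun t - g.toFun (l t)| ≤ c) ∧ ∀ t, |(l t : ℝ) - t| ≤ c := by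
  obtain ⟨l, hl⟩ := iInf_lt_iff.1 (show (⨅ l : Icc (0 : ℝ) M ≃o Icc (0 : ℝ) M,
    max (⨆ t, edist (f.toFun t) (g.toFun (l t))) (⨆ t, edist (l t) t)) < _ from h)
  have hc : 0 < c := by
    by_contra hc
    rw [ENNReal.ofReal_eq_zero.2 (not_lt.1 hc)] at hl
    exact not_lt_zero hl
  rw [max_lt_iff] at hl
  refine ⟨l, fun t => ?_, fun t => ?_⟩
  · have := (le_iSup (fun t => edist (f.toFun t) (g.toFun (l t))) t).trans_lt hl.1
    rw [edist_dist, ENNReal.ofReal_lt_ofReal_iff hc, Real.dist_eq] at this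
    exact this.le
  · have := (le_iSup (fun t => edist (l t) t) t).trans_lt hl.2
    rw [edist_dist, ENNReal.ofReal_lt_ofReal_iff hc, Subtype.dist_eq, Real.dist_eq] at this
    exact this.le

/-- Strictly increasing tuples of times in the open interval `(0, M)`. -/
def interiorTimes (M : ℝ) (j : ℕ) : Set (Fin j → ℝ) :=
  {u | StrictMono u ∧ ∀ i, u i ∈ Ioo 0 M}

theorem isOpen_interiorTimes : IsOpen (interiorTimes M j) := by
  have : interiorTimes M j =
      (⋂ i, ⋂ l, ⋂ _ : i < l, {u : Fin j → ℝ | u i < u l}) ∩ ⋂ i, {u | u i ∈ Ioo 0 M} := by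
    ext u
    simp [interiorTimes, StrictMono]
  rw [this]
  refine IsOpen.inter (isOpen_iInter_of_finite fun i => isOpen_iInter_of_finite fun l =>
    isOpen_iInter_of_finite fun _ => isOpen_lt (continuous_apply i) (continuous_apply l))
    (isOpen_iInter_of_finite fun i => isOpen_Ioo.preimage (continuous_apply i))

theorem measurableSet_jumpDomain : MeasurableSet (jumpDomain M j) := by
  have h2 : jumpTimes M j =
      (⋂ i, ⋂ l, ⋂ _ : i < l, {u : Fin j → ℝ | u i < u l}) ∩ ⋂ i, {u | u i ∈ Icc 0 M} := by
    ext u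
    simp [jumpTimes, StrictMono]
  have h1 : {z : Fin j → ℝ | ∀ i, z i ≠ 0} = ⋂ i, {z | z i ≠ 0} := by
    ext z
    simp
  rw [jumpDomain, h2, h1]
  refine MeasurableSet.prod (MeasurableSet.iInter fun i => ?_)
    (MeasurableSet.inter (MeasurableSet.iInter fun i => MeasurableSet.iInter fun l =>
      MeasurableSet.iInter fun _ => ?_) (MeasurableSet.iInter fun i => ?_))
  · exact (isOpen_ne.preimage (continuous_apply i)).measurableSet
  · exact (isOpen_lt (continuous_apply i) (continuous_apply l)).measurableSet
  · exact (isClosed_Icc.preimage (continuous_apply i)).measurableSet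

theorem interiorTimes_subset_jumpTimes : interiorTimes M j ⊆ jumpTimes M j :=
  fun _ hu => ⟨hu.1, fun i => Ioo_subset_Icc_self (hu.2 i)⟩

/-- The identity is perturbed by tent functions of half-width `η` centred at the `u i`. Since `η` is
at most every gap between the `u i` and at most their distances to `0` and `M`, the perturbed map
fixes both endpoints and sends each `u i` to `v i`. The slope of the perturbation is below `1`, so
monotonicity is kept. Interior times are essential, as every time change fixes `0` and `M`. -/
theorem exists_timeChange (hM : 0 < M) {u : Fin j → ℝ} (hu : u ∈ interiorTimes M j) :
    ∃ η > 0, ∀ v : Fin j → ℝ, ∑ i, |v i - u i| < η →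
      ∃ l : Icc (0 : ℝ) M ≃o Icc (0 : ℝ) M,
        (∀ i (t : Icc (0 : ℝ) M), u i ≤ (t : ℝ) ↔ v i ≤ (l t : ℝ)) ∧
        ∀ t, |(l t : ℝ) - t| ≤ ∑ i, |v i - u i| := by
  have hev : ∀ᶠ η : ℝ in 𝓝[>] 0, 0 < η ∧ (∀ i, η ≤ u i) ∧ (∀ i, η ≤ M - u i) ∧
      ∀ i l, i ≠ l → η ≤ |u i - u l| := by
    have key : ∀ c : ℝ, 0 < c → ∀ᶠ η : ℝ in 𝓝[>] 0, η ≤ c := fun c hc =>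
      nhdsWithin_le_nhds (Iic_mem_nhds hc)
    refine eventually_mem_nhdsWithin.and ((eventually_all.2 fun i => key _ (hu.2 i).1).and
      ((eventually_all.2 fun i => key _ (sub_pos.2 (hu.2 i).2)).and
      (eventually_all.2 fun i => eventually_all.2 fun l => ?_)))
    by_cases hil : i = l
    · simp [hil]
    · filter_upwards [key |u i - u l| (abs_pos.2 (sub_ne_zero.2 (hu.1.injective.ne hil)))]
        with η hη _ using hη
  obtain ⟨η, hη, h0, h1, h2⟩ := hev.exists
  refine ⟨η, hη, fun v hv => ?_⟩
  set φ : Fin j → ℝ → ℝ := fun i t => max 0 (1 - |t - u i| / η) with hφ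
  have φ_le : ∀ i t, φ i t ≤ 1 := fun i t =>
    max_le zero_le_one (by have : 0 ≤ |t - u i| / η := by positivity
                           linarith)
  have φ_nonneg : ∀ i t, 0 ≤ φ i t := fun i t => le_max_left _ _
  have φ_zero : ∀ i t, η ≤ |t - u i| → φ i t = 0 := fun i t h =>
    max_eq_left (by rw [sub_nonpos, le_div_iff₀ hη, one_mul]; exact h)
  have φ_lip : ∀ i s t, |φ i t - φ i s| ≤ |t - s| / η := fun i s t => by
    refine (abs_max_sub_max_le_max _ _ _ _).trans (max_le (by simp; positivity) ?_)
    have : 1 - |t - u i| / η - (1 - |s - u i| / η) = (|s - u i| - |t - u i|) / η := by ring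
    rw [this, abs_div, abs_of_pos hη]
    refine div_le_div_of_nonneg_right ((abs_abs_sub_abs_le _ _).trans ?_) hη.le
    rw [sub_sub_sub_cancel_right, abs_sub_comm]
  set L : ℝ → ℝ := fun t => t + ∑ i, (v i - u i) * φ i t with hL
  have L_mono : StrictMono L := fun s t hst => by
    have hb : |∑ i, (v i - u i) * (φ i t - φ i s)| ≤ (∑ i, |v i - u i|) * ((t - s) / η) := by
      refine (Finset.abs_sum_le_sum_abs _ _).trans ?_
      rw [Finset.sum_mul]
      refine Finset.sum_le_sum fun i _ => ?_
      rw [abs_mul]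
      have := φ_lip i s t
      rw [abs_of_pos (sub_pos.2 hst)] at this
      gcongr
    have hlt : (∑ i, |v i - u i|) * ((t - s) / η) < t - s := by
      rw [← mul_div_assoc, div_lt_iff₀ hη, mul_comm]
      exact mul_lt_mul_of_pos_left hv (sub_pos.2 hst)
    have e : L t - L s = (t - s) + ∑ i, (v i - u i) * (φ i t - φ i s) := by
      simp only [hL, mul_sub, Finset.sum_sub_distrib]
      ring
    have := (abs_le.1 hb).1
    linarith
  have L_cont : Continuous L := by
    simp only [hL, hφ]
    fun_prop
  have L_zero : L 0 = 0 := by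
    simp only [hL, zero_add]
    refine Finset.sum_eq_zero fun i _ => ?_
    rw [φ_zero i 0, mul_zero]
    rw [zero_sub, abs_neg, abs_of_pos (hu.2 i).1]
    exact h0 i
  have L_M : L M = M := by
    simp only [hL, add_eq_left]
    refine Finset.sum_eq_zero fun i _ => ?_
    rw [φ_zero i M, mul_zero]
    rw [abs_of_pos (sub_pos.2 (hu.2 i).2)]
    exact h1 i
  have L_u : ∀ i, L (u i) = v i := fun i => by
    simp only [hL]
    rw [Finset.sum_eq_single i]
    · simp [hφ]
    · intro l _ hl
      rw [φ_zero l (u i) (h2 i l hl.symm), mul_zero]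
    · simp
  let l₀ : Icc (0 : ℝ) M → Icc (0 : ℝ) M := fun t =>
    ⟨L t, L_zero.symm.le.trans (L_mono.monotone t.2.1), (L_mono.monotone t.2.2).trans L_M.le⟩
  have hmono : StrictMono l₀ := fun s t hst => L_mono hst
  have hsurj : Function.Surjective l₀ := fun y => by
    have hy : (y : ℝ) ∈ Icc (L 0) (L M) := by rw [L_zero, L_M]; exact y.2
    obtain ⟨x, hx, hxy⟩ := intermediate_value_Icc hM.le L_cont.continuousOn hy
    exact ⟨⟨x, hx⟩, Subtype.ext hxy⟩
  refine ⟨hmono.orderIsoOfSurjective _ hsurj, fun i t => ?_, fun t => ?_⟩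
  · change _ ↔ v i ≤ L t
    rw [← L_u, L_mono.le_iff_le]
  · change |L t - t| ≤ _
    simp only [hL, add_sub_cancel_left]
    refine (Finset.abs_sum_le_sum_abs _ _).trans (Finset.sum_le_sum fun i _ => ?_)
    rw [abs_mul, abs_of_nonneg (φ_nonneg _ _)]
    exact mul_le_of_le_one_right (abs_nonneg _) (φ_le _ _)

theorem continuousAt_stepDrift (hM : 0 < M) {q : (Fin j → ℝ) × (Fin j → ℝ)}
    (hq : q.2 ∈ interiorTimes M j) : ContinuousAt (stepDrift M m j) q := by
  rw [ContinuousAt, tendsto_iff_edist_tendsto_0]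
  obtain ⟨η, hη, h⟩ := exists_timeChange hM hq
  -- The time change aligns the jumps exactly, leaving the differences of their sizes; the term with
  -- `|m|` is the drift read at the displaced time.
  set b : (Fin j → ℝ) × (Fin j → ℝ) → ℝ := fun r =>
    ∑ i, |q.1 i - r.1 i| + (1 + |m|) * ∑ i, |r.2 i - q.2 i| with hb
  have hbc : Continuous b := by
    simp only [hb]
    fun_prop
  have hb0 : Tendsto (fun r => ENNReal.ofReal (b r)) (𝓝 q) (𝓝 0) := by
    have := (ENNReal.continuous_ofReal.comp hbc).tendsto q
    simpa [hb, Function.comp_def] using this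
  have hsmall : ∀ᶠ r : (Fin j → ℝ) × (Fin j → ℝ) in 𝓝 q, ∑ i, |r.2 i - q.2 i| < η := by
    have hc : Continuous fun r : (Fin j → ℝ) × (Fin j → ℝ) => ∑ i, |r.2 i - q.2 i| := by fun_prop
    exact hc.continuousAt.eventually_lt_const (by simpa using hη)
  refine tendsto_of_tendsto_of_tendsto_of_le_of_le' tendsto_const_nhds hb0
    (Eventually.of_forall fun _ => zero_le) ?_
  filter_upwards [hsmall] with r hr
  obtain ⟨l, hl1, hl2⟩ := h r.2 hr
  have hs0 : 0 ≤ ∑ i, |q.1 i - r.1 i| := Finset.sum_nonneg fun _ _ => abs_nonneg _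
  have hs1 : 0 ≤ ∑ i, |r.2 i - q.2 i| := Finset.sum_nonneg fun _ _ => abs_nonneg _
  rw [edist_comm]
  refine edist_skorohod_le_of_orderIso l (fun t => ?_) fun t => (hl2 t).trans ?_
  · have e : (stepDrift M m j q).toFun t - (stepDrift M m j r).toFun (l t) =
        (∑ i, if q.2 i ≤ (t : ℝ) then q.1 i - r.1 i else 0) + m * (t - l t) := by
      simp only [stepDrift, ← hl1]
      rw [add_sub_add_comm, ← Finset.sum_sub_distrib, mul_sub]
      congr 1
      refine Finset.sum_congr rfl fun i _ => ?_
      split_ifs <;> simp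
    rw [e]
    refine (abs_add_le _ _).trans (add_le_add ?_ ?_)
    · refine (Finset.abs_sum_le_sum_abs _ _).trans (Finset.sum_le_sum fun i _ => ?_)
      split_ifs <;> simp
    · rw [abs_mul, abs_sub_comm]
      exact mul_le_mul (by linarith) (hl2 t) (abs_nonneg _) (by positivity)
  · have := mul_nonneg (abs_nonneg m) hs1
    simp only [hb]
    linarith

/-- Dropping one jump moves a step function by at most the size of this jump. -/
theorem exists_stepEq_edist_le {q : (Fin (j + 1) → ℝ) × (Fin (j + 1) → ℝ)}
    (hq : q ∈ jumpDomain M (j + 1)) (i : Fin (j + 1)) :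
    ∃ g ∈ stepEq M m j, edist (stepDrift M m (j + 1) q) g ≤ ENNReal.ofReal |q.1 i| := by
  refine ⟨_, ⟨(fun l => q.1 (i.succAbove l), fun l => q.2 (i.succAbove l)),
    ⟨fun l => hq.1 _, hq.2.1.comp (Fin.strictMono_succAbove i), fun l => hq.2.2 _⟩, rfl⟩,
    edist_skorohod_le (abs_nonneg _) fun t => ?_⟩
  simp only [stepDrift]
  rw [Fin.sum_univ_succAbove _ i, add_assoc, add_sub_cancel_right]
  split_ifs <;> simp

theorem stepEq_subset_stepLE {i : ℕ} (h : i ≤ j) : stepEq M m i ⊆ stepLE M m j := fun f hf => by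
  simp only [stepLE, mem_iUnion]
  exact ⟨i, Finset.mem_range.2 (Nat.lt_succ_of_le h), hf⟩

/-- Dropping a jump lands in `stepLE M m j`, at a distance of at most the size of the jump. This
makes the limit measure finite away from `stepLE M m j` and makes the cutoff `δ` harmless. -/
theorem le_abs_of_separated {r : ℝ} {A : Set (SkorohodSpace M)}
    (hA : ∀ x ∈ A, ∀ y ∈ stepLE M m j, ENNReal.ofReal r ≤ edist x y)
    {q : (Fin (j + 1) → ℝ) × (Fin (j + 1) → ℝ)} (hq : q ∈ jumpDomain M (j + 1))
    (hqA : stepDrift M m (j + 1) q ∈ A) (i : Fin (j + 1)) : r ≤ |q.1 i| := by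
  obtain ⟨g, hg, hle⟩ := exists_stepEq_edist_le (m := m) hq i
  exact (ENNReal.ofReal_le_ofReal_iff (abs_nonneg _)).1
    ((hA _ hqA g (stepEq_subset_stepLE le_rfl hg)).trans hle)

/-! ### Closedness of the set of step functions -/

/-- Starting from the value `c` just before time `a`, the function `g` changes its value by more
than `ε` at most `k` times. -/
def ChangesLE {T : Type*} [LE T] (g : T → ℝ) (ε : ℝ) : ℕ → ℝ → T → Prop
  | 0, c, a => ∀ t, a ≤ t → |g t - c| ≤ ε
  | k + 1, c, a => ∀ t, a ≤ t → ε < |g t - c| → ChangesLE g ε k (g t) t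

/-- Here `s` is a step function close to `g` and `J` counts the jumps of `s` already passed. While
`J` does not move, neither does `s`, and `g` stays within `ε` of its reference value; so each change
of `g` by more than `ε` uses up at least one unit of `J`. The invariant is that count `n` and value
`v` of `s` belong to the reference value `c`, with at most `k` units left. -/
theorem ChangesLE.of_counting {T : Type*} [Preorder T] {g s : T → ℝ} {J : T → ℕ} {ε : ℝ}
    {N : ℕ} (hJ : Monotone J) (hN : ∀ t, J t ≤ N) (hs : ∀ t t', J t = J t' → s t = s t')
    (hg : ∀ t, |g t - s t| ≤ ε / 2) (k : ℕ) :
    ∀ (c : ℝ) (a : T) (n : ℕ) (v : ℝ), |c - v| ≤ ε / 2 → N ≤ n + k →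
      (∀ t, a ≤ t → n ≤ J t ∧ (J t = n → s t = v)) → ChangesLE g ε k c a := by
  have hclose : ∀ {c v : ℝ} {t : T}, |c - v| ≤ ε / 2 → s t = v → |g t - c| ≤ ε := by
    intro c v t hc hv
    have h1 := abs_le.1 (hg t)
    have h2 := abs_le.1 hc
    rw [hv] at h1
    exact abs_le.2 ⟨by linarith, by linarith⟩
  induction k with
  | zero =>
    intro c a n v hc hn h t ht
    exact hclose hc ((h t ht).2 (le_antisymm ((hN t).trans hn) (h t ht).1))
  | succ k ih =>
    intro c a n v hc hn h t ht hlt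
    have hne : J t ≠ n := fun he => (hclose hc ((h t ht).2 he)).not_gt hlt
    have hlt' : n < J t := lt_of_le_of_ne (h t ht).1 hne.symm
    exact ih (g t) t (J t) (s t) (hg t) (by lia)
      fun t' ht' => ⟨hJ ht', fun he => hs _ _ he⟩

/-- A nonzero change `|g t - c|` exceeds all sufficiently small `ε`, so it is counted for each of
them. -/
theorem ChangesLE.of_forall_pos {T : Type*} [Preorder T] {g : T → ℝ} (k : ℕ) :
    ∀ (c : ℝ) (a : T), (∀ ε₀ > 0, ∃ ε, 0 < ε ∧ ε < ε₀ ∧ ChangesLE g ε k c a) →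
      ChangesLE g 0 k c a := by
  have hmono : ∀ (k : ℕ) {ε ε' : ℝ}, ε ≤ ε' → ∀ (c : ℝ) (a : T),
      ChangesLE g ε k c a → ChangesLE g ε' k c a := by
    intro k
    induction k with
    | zero => exact fun h c a H t ht => (H t ht).trans h
    | succ k ih => exact fun h c a H t ht hlt => ih h _ _ (H t ht (h.trans_lt hlt))
  induction k with
  | zero =>
    intro c a H t ht
    refine le_of_forall_gt_imp_ge_of_dense fun ε₀ h0 => ?_
    obtain ⟨ε, -, h2, h3⟩ := H ε₀ h0
    exact (h3 t ht).trans h2.le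
  | succ k ih =>
    intro c a H t ht hlt
    refine ih _ _ fun ε₀ h0 => ?_
    obtain ⟨ε, h1, h2, h3⟩ := H (min ε₀ |g t - c|) (lt_min h0 hlt)
    exact ⟨ε, h1, h2.trans_le (min_le_left _ _),
      h3 t ht (h2.trans_le (min_le_right _ _))⟩

/-- Induction on `k`: the first jump is at the first time where `g` leaves `c`, and right continuity
ensures that this time is attained. The value `c` is the one before `a`, so a jump at `a` itself is
allowed unless `g a = c`; this last clause keeps the jump times strictly increasing in the
recursion. -/
theorem ChangesLE.exists_step {g : Icc (0 : ℝ) M → ℝ}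
    (hg : ∀ t, ContinuousWithinAt g (Ici t) t) (k : ℕ) :
    ∀ (c : ℝ) (a : Icc (0 : ℝ) M), ChangesLE g 0 k c a →
      ∃ l ≤ k, ∃ (z : Fin l → ℝ) (u : Fin l → Icc (0 : ℝ) M), (∀ i, z i ≠ 0) ∧ StrictMono u ∧
        (∀ i, a ≤ u i) ∧ (g a = c → ∀ i, a < u i) ∧
        ∀ t, a ≤ t → g t = c + ∑ i, if u i ≤ t then z i else 0 := by
  have hconst : ∀ (c : ℝ) (a : Icc (0 : ℝ) M), (∀ t, a ≤ t → g t = c) → ∀ k : ℕ,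
      ∃ l ≤ k, ∃ (z : Fin l → ℝ) (u : Fin l → Icc (0 : ℝ) M), (∀ i, z i ≠ 0) ∧ StrictMono u ∧
        (∀ i, a ≤ u i) ∧ (g a = c → ∀ i, a < u i) ∧
        ∀ t, a ≤ t → g t = c + ∑ i, if u i ≤ t then z i else 0 := fun c a h k =>
    ⟨0, Nat.zero_le _, Fin.elim0, Fin.elim0, fun i => i.elim0, fun i => i.elim0,
      fun i => i.elim0, fun _ i => i.elim0, fun t ht => by simpa using h t ht⟩
  induction k with
  | zero =>
    intro c a H
    exact hconst c a (fun t ht => by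
      have := H t ht
      rwa [abs_nonpos_iff, sub_eq_zero] at this) 0
  | succ k ih =>
    intro c a H
    by_cases hall : ∀ t, a ≤ t → g t = c
    · exact hconst c a hall _
    push Not at hall
    set T : Set (Icc (0 : ℝ) M) := {t | a ≤ t ∧ g t ≠ c} with hT
    have hTne : T.Nonempty := hall
    have hM' : 0 ≤ M := a.2.1.trans a.2.2
    -- the first time `s` at which the value differs from `c`
    set s' : ℝ := sInf (Subtype.val '' T) with hs'
    have hbdd : BddBelow (Subtype.val '' T) := ⟨0, by rintro _ ⟨t, -, rfl⟩; exact t.2.1⟩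
    have has' : (a : ℝ) ≤ s' := le_csInf (hTne.image _) (by rintro _ ⟨t, ht, rfl⟩; exact ht.1)
    have hs'le : ∀ t ∈ T, s' ≤ t := fun t ht => csInf_le hbdd ⟨t, ht, rfl⟩
    let s : Icc (0 : ℝ) M := ⟨s', a.2.1.trans has', by
      obtain ⟨t, ht⟩ := hTne
      exact (hs'le t ht).trans t.2.2⟩
    have has : a ≤ s := has'
    have hsT : s ∈ T := by
      by_contra hns
      have hgs : g s = c := by
        by_contra hne
        exact hns ⟨has, hne⟩
      -- If the infimum were not attained, `T` would accumulate at `s` from the right, with `g`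
      -- tending to `c` there by right continuity. Points of `T` close to `s` then have values
      -- different from `g t`.
      have hsmall : ∀ t ∈ T, ∃ t' ∈ T, t' ≤ t ∧ g t' ≠ g t := by
        intro t ht
        have hst : s < t := lt_of_le_of_ne (hs'le t ht) (fun h => hns (h ▸ ht))
        have h1 : ∀ᶠ y in 𝓝[≥] s, g y ≠ g t :=
          (hg s).eventually_ne (by rw [hgs]; exact ht.2.symm)
        obtain ⟨b, hb, hsub⟩ := (mem_nhdsGE_iff_exists_Ico_subset' hst).1 h1
        have hb' : s' < min b t := lt_min hb hst
        obtain ⟨_, ⟨y, hy, rfl⟩, hyb⟩ := exists_lt_of_csInf_lt (hTne.image _) hb'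
        exact ⟨y, hy, (hyb.trans_le (min_le_right _ _)).le,
          hsub ⟨hs'le y hy, hyb.trans_le (min_le_left _ _)⟩⟩
      -- Every point of `T` is preceded by `i` further changes, found by descending towards `s`,
      -- hence has only `k - i` left. At `i = k` no change is left, contradicting `hsmall`.
      have hdown : ∀ i, ∀ i' , i + i' = k → ∀ t ∈ T, ChangesLE g 0 i' (g t) t := by
        intro i
        induction i with
        | zero =>
          intro i' hi' t ht
          rw [zero_add] at hi'
          subst hi'
          exact H t ht.1 (abs_pos.2 (sub_ne_zero.2 ht.2))
        | succ i ihi =>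
          intro i' hi' t ht
          obtain ⟨t', ht', hle, hne⟩ := hsmall t ht
          exact ihi (i' + 1) (by lia) t' ht' t hle (abs_pos.2 (sub_ne_zero.2 hne.symm))
      obtain ⟨t, ht⟩ := hTne
      obtain ⟨t', ht', hle, hne⟩ := hsmall t ht
      have := hdown k 0 (by lia) t' ht' t hle
      rw [abs_nonpos_iff, sub_eq_zero] at this
      exact hne this.symm
    obtain ⟨l, hl, z, u, hz, hu, hsu, hsu', hrep⟩ :=
      ih (g s) s (H s has (abs_pos.2 (sub_ne_zero.2 hsT.2)))
    refine ⟨l + 1, by lia, Fin.cons (g s - c) z, Fin.cons s u, ?_, ?_, ?_, ?_, ?_⟩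
    · exact Fin.cases (sub_ne_zero.2 hsT.2) hz
    · refine Fin.strictMono_iff_lt_succ.2 fun i => ?_
      cases l with
      | zero => exact i.elim0
      | succ l =>
        refine Fin.cases ?_ (fun i => ?_) i
        · simpa using hsu' rfl 0
        · rw [← Fin.succ_castSucc, Fin.cons_succ, Fin.cons_succ]
          exact hu i.castSucc_lt_succ
    · exact Fin.cases has fun i => has.trans (hsu i)
    · intro hac
      have : a < s := lt_of_le_of_ne has (fun h => hsT.2 (h ▸ hac))
      exact Fin.cases this fun i => this.trans_le (hsu i)
    · intro t hat
      rw [Fin.sum_univ_succ]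
      simp only [Fin.cons_zero, Fin.cons_succ]
      by_cases hst : s ≤ t
      · rw [hrep t hst, if_pos hst]
        ring
      · rw [if_neg hst, Finset.sum_eq_zero fun i _ => if_neg fun h => hst ((hsu i).trans h)]
        by_contra hne
        exact hst (hs'le t ⟨hat, by simpa using hne⟩)

theorem isClosed_stepLE (hM : 0 < M) : IsClosed (stepLE M m j) := by
  refine isClosed_of_closure_subset fun f hf => ?_
  set g : Icc (0 : ℝ) M → ℝ := fun t => f.toFun t - m * t with hg
  have hgc : ∀ t, ContinuousWithinAt g (Ici t) t := fun t =>
    (f.cadlag t).1.sub (by fun_prop)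
  let o : Icc (0 : ℝ) M := ⟨0, le_rfl, hM.le⟩
  have hch : ChangesLE g 0 j 0 o := by
    refine ChangesLE.of_forall_pos j 0 o fun ε₀ h0 => ?_
    refine ⟨ε₀ / 2, by linarith, by linarith, ?_⟩
    -- The approximation costs `c`, and evaluating the drift at `l t` instead of `t` costs `|m| *
    -- c`; together this is `ε₀ / 4`, half of the tolerance `ε₀ / 2`.
    set c : ℝ := ε₀ / 4 / (1 + |m|) with hc
    have hm1 : 0 < 1 + |m| := by positivity
    have hc0 : 0 < c := by positivity
    obtain ⟨f', hf', hd⟩ := EMetric.mem_closure_iff.1 hf (ENNReal.ofReal c)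
      (ENNReal.ofReal_pos.2 hc0)
    simp only [stepLE, mem_iUnion] at hf'
    obtain ⟨k, hk, ⟨z, u⟩, hzu, rfl⟩ := hf'
    obtain ⟨l, hl1, hl2⟩ := exists_orderIso_of_edist_lt hd
    let J : Icc (0 : ℝ) M → ℕ := fun t => (Finset.univ.filter fun i => u i ≤ (l t : ℝ)).card
    let s : Icc (0 : ℝ) M → ℝ := fun t => ∑ i, if u i ≤ (l t : ℝ) then z i else 0
    have hsub : ∀ t t', t ≤ t' → (Finset.univ.filter fun i => u i ≤ (l t : ℝ)) ⊆
        Finset.univ.filter fun i => u i ≤ (l t' : ℝ) := fun t t' h i hi => by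
      simp only [Finset.mem_filter, Finset.mem_univ, true_and] at hi ⊢
      exact hi.trans (l.monotone h)
    have hseq : ∀ t, s t = ∑ i ∈ Finset.univ.filter fun i => u i ≤ (l t : ℝ), z i := fun t => by
      rw [Finset.sum_filter]
    refine ChangesLE.of_counting (J := J) (s := s) (N := j)
      (fun t t' h => Finset.card_le_card (hsub t t' h)) ?_ ?_ ?_ j 0 o 0 0 ?_ (by simp) ?_
    · intro t
      refine (Finset.card_le_univ _).trans ?_
      simpa using Nat.lt_succ_iff.1 (Finset.mem_range.1 hk)
    -- The sets of passed jumps are nested, so equal cardinality makes them equal.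
    · intro t t' hJ
      rw [hseq, hseq]
      rcases le_total t t' with h | h
      · rw [Finset.eq_of_subset_of_card_le (hsub t t' h) hJ.symm.le]
      · rw [Finset.eq_of_subset_of_card_le (hsub t' t h) hJ.le]
    · intro t
      have e : g t - s t = (f.toFun t - (stepDrift M m k (z, u)).toFun (l t)) +
          m * ((l t : ℝ) - t) := by
        simp only [hg, s, stepDrift]
        ring
      rw [e]
      refine (abs_add_le _ _).trans ?_
      rw [abs_mul]
      have h3 : |m| * |(l t : ℝ) - t| ≤ |m| * c := by gcongr; exact hl2 t
      have h4 : (1 + |m|) * c = ε₀ / 4 := by rw [hc]; field_simp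
      have := hl1 t
      linarith
    · simp only [sub_zero, abs_zero]
      linarith
    · intro t _
      refine ⟨Nat.zero_le _, fun h0 => ?_⟩
      rw [hseq, Finset.card_eq_zero.1 h0, Finset.sum_empty]
  obtain ⟨l, hl, z, u, hz, hu, -, -, hrep⟩ := hch.exists_step hgc j 0 o
  refine stepEq_subset_stepLE hl ⟨(z, fun i => u i), ⟨hz, fun i i' h => hu h, fun i => (u i).2⟩, ?_⟩
  have : f.toFun = (stepDrift M m l (z, fun i => (u i : ℝ))).toFun := by
    funext t
    have := hrep t t.2.1
    simp only [hg, zero_add] at this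
    simp only [stepDrift, Subtype.coe_le_coe]
    rw [← this]
    ring
  cases f
  simp only at this
  subst this
  rfl

/-- The path depends continuously, even for the uniform distance, on its first `⌊n * M⌋₊`
increments, so the Borel structure of the Skorohod space needs no further analysis. -/
theorem measurable_walkPath {Ω : Type*} [MeasurableSpace Ω] {Z : ℕ → Ω → ℝ}
    (hZ : ∀ i, Measurable (Z i)) (n : ℕ) :
    Measurable fun ω => walkPath M n fun k => Z k ω := by
  rcases Nat.eq_zero_or_pos n with rfl | hn
  · have : (fun ω => walkPath M 0 fun k => Z k ω) = fun _ => walkPath M 0 fun _ => 0 := by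
      funext ω
      simp [walkPath]
    rw [this]
    exact measurable_const
  let N := ⌊(n : ℝ) * M⌋₊
  let Φ : (Fin N → ℝ) → SkorohodSpace M := fun z =>
    walkPath M n fun k => if h : k < N then z ⟨k, h⟩ else 0
  have hΦ : Continuous Φ := by
    refine continuous_iff_continuousAt.2 fun z => ?_
    rw [ContinuousAt, tendsto_iff_edist_tendsto_0]
    have hb : Tendsto (fun y : Fin N → ℝ => ENNReal.ofReal ((∑ i, |y i - z i|) / n)) (𝓝 z)
        (𝓝 0) := by
      have hc : Continuous fun y : Fin N → ℝ => ENNReal.ofReal ((∑ i, |y i - z i|) / n) :=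
        ENNReal.continuous_ofReal.comp (by fun_prop)
      simpa using hc.tendsto z
    refine tendsto_of_tendsto_of_tendsto_of_le_of_le tendsto_const_nhds hb
      (fun _ => zero_le) fun y => ?_
    refine edist_skorohod_le (by positivity) fun t => ?_
    simp only [Φ, walkPath]
    rw [← sub_div, abs_div, Nat.abs_cast]
    gcongr
    rw [← Finset.sum_sub_distrib]
    refine (Finset.abs_sum_le_sum_abs _ _).trans ?_
    have hle : ⌊(n : ℝ) * t⌋₊ ≤ N := Nat.floor_mono (by gcongr; exact t.2.2)
    refine (Finset.sum_le_sum_of_subset_of_nonneg (Finset.range_mono hle)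
      fun _ _ _ => abs_nonneg _).trans ?_
    rw [Finset.sum_range]
    simp
  have : (fun ω => walkPath M n fun k => Z k ω) = Φ ∘ fun ω (i : Fin N) => Z i ω := by
    funext ω
    simp only [Φ, walkPath, Function.comp_apply]
    congr 1
    funext t
    congr 1
    refine Finset.sum_congr rfl fun k hk => ?_
    have hle : ⌊(n : ℝ) * t⌋₊ ≤ N := Nat.floor_mono (by gcongr; exact t.2.2)
    rw [dif_pos ((Finset.mem_range.1 hk).trans_le hle)]
  rw [this]
  exact hΦ.measurable.comp (measurable_pi_lambda _ fun i => hZ i)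

end Skorohod

/-! ### Homogeneous measures on the punctured line -/

/-- The points of the line at distance more than `δ` from `0`. -/
def away (δ : ℝ) : Set ℝ := {z | δ < |z|}

theorem away_eq_union (δ : ℝ) : away δ = Iio (-δ) ∪ Ioi δ := by
  ext z
  simp only [away, mem_ofPred_eq, mem_union, mem_Iio, mem_Ioi, lt_abs]
  constructor
  · rintro (h | h)
    · exact Or.inr h
    · exact Or.inl (by linarith)
  · rintro (h | h)
    · exact Or.inr (by linarith)
    · exact Or.inl h

theorem isOpen_away (δ : ℝ) : IsOpen (away δ) := isOpen_lt continuous_const continuous_abs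

theorem measurableSet_away (δ : ℝ) : MeasurableSet (away δ) := (isOpen_away δ).measurableSet

theorem areSeparated_zero {A : Set ℝ} {δ : ℝ} (hδ : 0 < δ) (hA : ∀ z ∈ A, δ ≤ |z|) :
    Metric.AreSeparated A {0} := by
  refine ⟨ENNReal.ofReal δ, (ENNReal.ofReal_pos.2 hδ).ne', fun z hz y hy => ?_⟩
  rw [mem_singleton_iff] at hy
  rw [hy, edist_dist, Real.dist_eq, sub_zero]
  exact ENNReal.ofReal_le_ofReal (hA z hz)

/-- Used to show that a homogeneous measure has no mass on the boundary of half-lines: a closed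
half-line sits in all slightly larger open ones. -/
theorem le_ofReal_rpow_mul_of_forall_lt {α x : ℝ} (hx : 0 < x) {a c : ℝ≥0∞} (hc : c ≠ ∞)
    (h : ∀ y, 0 < y → y < x → a ≤ ENNReal.ofReal (y ^ (-α)) * c) :
    a ≤ ENNReal.ofReal (x ^ (-α)) * c := by
  have ht : Tendsto (fun y : ℝ => ENNReal.ofReal (y ^ (-α)) * c) (𝓝[<] x)
      (𝓝 (ENNReal.ofReal (x ^ (-α)) * c)) := by
    refine ENNReal.Tendsto.mul_const (ENNReal.tendsto_ofReal ?_) (Or.inr hc)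
    exact ((Real.continuousAt_rpow_const x (-α) (Or.inl hx.ne')).tendsto).mono_left
      nhdsWithin_le_nhds
  refine ge_of_tendsto ht ?_
  filter_upwards [self_mem_nhdsWithin, nhdsWithin_le_nhds (lt_mem_nhds hx)] with y hy hy0
    using h y hy0 hy

section Homogeneous

variable {α : ℝ} {μ : Measure ℝ}

/-- `μ (s A) = s ^ (-α) μ A` for Borel sets `A` that do not contain `0`. -/
def IsHomogeneous (α : ℝ) (μ : Measure ℝ) : Prop :=
  ∀ s : ℝ, 0 < s → ∀ A : Set ℝ, MeasurableSet A → A ⊆ {0}ᶜ →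
      μ ((fun x => s * x) '' A) = ENNReal.ofReal (s ^ (-α)) * μ A

theorem IsHomogeneous.Ioi (h : IsHomogeneous α μ) {x : ℝ} (hx : 0 < x) :
    μ (Ioi x) = ENNReal.ofReal (x ^ (-α)) * μ (Ioi 1) := by
  rw [← h x hx _ measurableSet_Ioi (fun y hy => ne_of_gt (zero_lt_one.trans hy)),
    image_mul_left_Ioi hx, mul_one]

theorem IsHomogeneous.Iio (h : IsHomogeneous α μ) {x : ℝ} (hx : 0 < x) :
    μ (Iio (-x)) = ENNReal.ofReal (x ^ (-α)) * μ (Iio (-1)) := by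
  rw [← h x hx _ measurableSet_Iio (fun y hy => ne_of_lt (hy.trans (by norm_num))),
    image_mul_left_Iio hx, mul_neg, mul_one]

theorem measure_Ioi_ne_top (hfin : FiniteAwayFrom {0} μ) {x : ℝ} (hx : 0 < x) :
    μ (Ioi x) ≠ ∞ :=
  (hfin _ measurableSet_Ioi (areSeparated_zero hx fun _ hz =>
    (le_of_lt hz).trans (le_abs_self _))).ne

theorem measure_Iio_ne_top (hfin : FiniteAwayFrom {0} μ) {x : ℝ} (hx : 0 < x) :
    μ (Iio (-x)) ≠ ∞ :=
  (hfin _ measurableSet_Iio (areSeparated_zero hx fun z hz => by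
    have : z < -x := hz
    exact le_trans (by linarith) (neg_le_abs z))).ne

theorem IsHomogeneous.Ici (h : IsHomogeneous α μ) (hfin : FiniteAwayFrom {0} μ) {x : ℝ}
    (hx : 0 < x) : μ (Ici x) = ENNReal.ofReal (x ^ (-α)) * μ (Set.Ioi 1) := by
  refine le_antisymm ?_ (h.Ioi hx ▸ measure_mono Ioi_subset_Ici_self)
  refine le_ofReal_rpow_mul_of_forall_lt hx (measure_Ioi_ne_top hfin one_pos) fun y hy hyx => ?_
  rw [← h.Ioi hy]
  exact measure_mono (Ici_subset_Ioi.2 hyx)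

theorem IsHomogeneous.Iic (h : IsHomogeneous α μ) (hfin : FiniteAwayFrom {0} μ) {x : ℝ}
    (hx : 0 < x) : μ (Iic (-x)) = ENNReal.ofReal (x ^ (-α)) * μ (Set.Iio (-1)) := by
  refine le_antisymm ?_ (h.Iio hx ▸ measure_mono Iio_subset_Iic_self)
  refine le_ofReal_rpow_mul_of_forall_lt hx (measure_Iio_ne_top hfin one_pos) fun y hy hyx => ?_
  rw [← h.Iio hy]
  exact measure_mono (Iic_subset_Iio.2 (by linarith))

theorem measure_away {δ : ℝ} (hδ : 0 < δ) : μ (away δ) = μ (Iio (-δ)) + μ (Ioi δ) := by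
  rw [away_eq_union _, measure_union _ measurableSet_Ioi]
  exact Set.disjoint_left.2 fun t h1 h2 => by
    have h1' : t < -δ := h1
    have h2' : δ < t := h2
    linarith

theorem IsHomogeneous.away (h : IsHomogeneous α μ) {δ : ℝ} (hδ : 0 < δ) :
    μ (away δ) = ENNReal.ofReal (δ ^ (-α)) * μ (HiddenLD.away 1) := by
  rw [measure_away hδ, measure_away one_pos, h.Iio hδ, h.Ioi hδ, mul_add]

theorem measure_away_ne_top (hfin : FiniteAwayFrom {0} μ) {δ : ℝ} (hδ : 0 < δ) :
    μ (away δ) ≠ ∞ :=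
  (hfin _ (measurableSet_away δ) (areSeparated_zero hδ fun _ hz => le_of_lt hz)).ne

theorem IsHomogeneous.away_one_ne_zero (h : IsHomogeneous α μ) (h0 : μ {0} = 0) (hμ : μ ≠ 0) :
    μ (HiddenLD.away 1) ≠ 0 := by
  intro h1
  apply hμ
  rw [← Measure.measure_univ_eq_zero]
  have hcov : (univ : Set ℝ) ⊆ {0} ∪ ⋃ n : ℕ, HiddenLD.away (1 / (n + 1 : ℝ)) := by
    intro z _
    by_cases hz : z = 0
    · exact Or.inl hz
    · obtain ⟨n, hn⟩ := exists_nat_one_div_lt (abs_pos.2 hz)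
      exact Or.inr (mem_iUnion.2 ⟨n, hn⟩)
  refine measure_mono_null hcov (measure_union_null h0 (measure_iUnion_null fun n => ?_))
  rw [h.away (by positivity), h1, mul_zero]

end Homogeneous

/-! ### The measure `ν_α` -/

section NuAlpha

variable {α p : ℝ}

instance : SigmaFinite (nuAlpha α p) := by
  unfold nuAlpha
  exact SigmaFinite.withDensity_of_ne_top (ae_of_all _ fun _ => ENNReal.ofReal_ne_top)

theorem nuAlpha_away (hα : 0 < α) (hp₀ : 0 ≤ p) (hp₁ : p ≤ 1) {δ : ℝ} (hδ : 0 < δ) :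
    nuAlpha α p (away δ) = ENNReal.ofReal (δ ^ (-α)) := by
  rw [away_eq_union _, nuAlpha_tails hα hp₀ hp₁ hδ hδ]
  congr 1
  ring

theorem tendsto_nuAlpha_away (hα : 0 < α) (hp₀ : 0 ≤ p) (hp₁ : p ≤ 1) :
    Tendsto (fun y => nuAlpha α p (away y)) atTop (𝓝 0) := by
  have : Tendsto (fun y : ℝ => ENNReal.ofReal (y ^ (-α))) atTop (𝓝 0) := by
    simpa using ENNReal.tendsto_ofReal (tendsto_rpow_neg_atTop hα)
  refine this.congr' ?_
  filter_upwards [eventually_gt_atTop 0] with y hy using (nuAlpha_away hα hp₀ hp₁ hy).symm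

theorem nuAlpha_Ioi (hα : 0 < α) (hp₀ : 0 ≤ p) (hp₁ : p ≤ 1) {x : ℝ} (hx : 0 < x) :
    nuAlpha α p (Ioi x) = ENNReal.ofReal (p * x ^ (-α)) := by
  have ht : Tendsto (fun y : ℝ => nuAlpha α p (Iio (-y) ∪ Ioi x)) atTop
      (𝓝 (ENNReal.ofReal (p * x ^ (-α)))) := by
    have h1 : Tendsto (fun y : ℝ => ENNReal.ofReal ((1 - p) * y ^ (-α) + p * x ^ (-α))) atTop
        (𝓝 (ENNReal.ofReal (p * x ^ (-α)))) := by
      refine ENNReal.tendsto_ofReal ?_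
      simpa using ((tendsto_rpow_neg_atTop hα).const_mul (1 - p)).add_const (p * x ^ (-α))
    refine h1.congr' ?_
    filter_upwards [eventually_gt_atTop 0] with y hy using (nuAlpha_tails hα hp₀ hp₁ hx hy).symm
  have ht' : Tendsto (fun y : ℝ => nuAlpha α p (Iio (-y) ∪ Ioi x)) atTop
      (𝓝 (nuAlpha α p (Ioi x))) := by
    have h2 := (tendsto_nuAlpha_away hα hp₀ hp₁).add_const (nuAlpha α p (Ioi x))
    rw [zero_add] at h2
    refine tendsto_of_tendsto_of_tendsto_of_le_of_le' tendsto_const_nhds h2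
      (Eventually.of_forall fun y => measure_mono subset_union_right) ?_
    filter_upwards [eventually_gt_atTop 0] with y hy
    refine (measure_union_le _ _).trans (add_le_add (measure_mono ?_) le_rfl)
    rw [away_eq_union _]
    exact subset_union_left
  exact tendsto_nhds_unique ht' ht

theorem nuAlpha_Iio (hα : 0 < α) (hp₀ : 0 ≤ p) (hp₁ : p ≤ 1) {x : ℝ} (hx : 0 < x) :
    nuAlpha α p (Iio (-x)) = ENNReal.ofReal ((1 - p) * x ^ (-α)) := by
  have h1 := nuAlpha_tails hα hp₀ hp₁ hx hx
  rw [← away_eq_union _, measure_away hx, nuAlpha_Ioi hα hp₀ hp₁ hx,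
    ENNReal.ofReal_add (mul_nonneg (by linarith) (by positivity)) (by positivity)] at h1
  exact (ENNReal.add_left_inj ENNReal.ofReal_ne_top).1 h1

theorem nuAlpha_singleton (x : ℝ) : nuAlpha α p {x} = 0 :=
  withDensity_absolutelyContinuous _ _ Real.volume_singleton

theorem nuAlpha_Ici (hα : 0 < α) (hp₀ : 0 ≤ p) (hp₁ : p ≤ 1) {x : ℝ} (hx : 0 < x) :
    nuAlpha α p (Ici x) = ENNReal.ofReal (p * x ^ (-α)) := by
  have : NullSingletonClass (nuAlpha α p) := ⟨nuAlpha_singleton⟩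
  rw [← nuAlpha_Ioi hα hp₀ hp₁ hx]
  exact (measure_congr Ioi_ae_eq_Ici).symm

theorem nuAlpha_Iic (hα : 0 < α) (hp₀ : 0 ≤ p) (hp₁ : p ≤ 1) {x : ℝ} (hx : 0 < x) :
    nuAlpha α p (Iic (-x)) = ENNReal.ofReal ((1 - p) * x ^ (-α)) := by
  have : NullSingletonClass (nuAlpha α p) := ⟨nuAlpha_singleton⟩
  rw [← nuAlpha_Iio hα hp₀ hp₁ hx]
  exact (measure_congr Iio_ae_eq_Iic).symm

/-- A homogeneous measure is determined by the masses of `(1, ∞)` and `(-∞, -1)`. -/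
theorem IsHomogeneous.restrict_away_eq {μ : Measure ℝ} (hα : 0 < α) (hp₀ : 0 ≤ p) (hp₁ : p ≤ 1)
    (h : IsHomogeneous α μ) (hfin : FiniteAwayFrom {0} μ) {c : ℝ≥0∞}
    (hpos : μ (Set.Ioi 1) = c * ENNReal.ofReal p)
    (hneg : μ (Set.Iio (-1)) = c * ENNReal.ofReal (1 - p)) {δ : ℝ} (hδ : 0 < δ) :
    μ.restrict (HiddenLD.away δ) = c • (nuAlpha α p).restrict (HiddenLD.away δ) := by
  have hdisj : Disjoint (Set.Iio (-δ)) (Set.Ioi δ) := Set.disjoint_left.2 fun t h1 h2 => by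
    have h1' : t < -δ := h1
    have h2' : δ < t := h2
    linarith
  have e1 : μ.restrict (Set.Ioi δ) = c • (nuAlpha α p).restrict (Set.Ioi δ) := by
    have : IsFiniteMeasure (μ.restrict (Set.Ioi δ)) :=
      ⟨by rw [Measure.restrict_apply_univ]; exact (measure_Ioi_ne_top hfin hδ).lt_top⟩
    refine Measure.ext_of_Ici _ _ fun x => ?_
    rw [Measure.smul_apply, Measure.restrict_apply measurableSet_Ici,
      Measure.restrict_apply measurableSet_Ici, smul_eq_mul]
    rcases le_or_gt x δ with hx | hx
    · rw [inter_eq_right.2 ((Ioi_subset_Ici_self).trans (Ici_subset_Ici.2 hx)), h.Ioi hδ,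
        nuAlpha_Ioi hα hp₀ hp₁ hδ, ENNReal.ofReal_mul hp₀, hpos]
      ring
    · rw [inter_eq_left.2 (Ici_subset_Ioi.2 hx), h.Ici hfin (hδ.trans hx),
        nuAlpha_Ici hα hp₀ hp₁ (hδ.trans hx), ENNReal.ofReal_mul hp₀, hpos]
      ring
  have e2 : μ.restrict (Set.Iio (-δ)) = c • (nuAlpha α p).restrict (Set.Iio (-δ)) := by
    have : IsFiniteMeasure (μ.restrict (Set.Iio (-δ))) :=
      ⟨by rw [Measure.restrict_apply_univ]; exact (measure_Iio_ne_top hfin hδ).lt_top⟩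
    refine Measure.ext_of_Iic _ _ fun x => ?_
    rw [Measure.smul_apply, Measure.restrict_apply measurableSet_Iic,
      Measure.restrict_apply measurableSet_Iic, smul_eq_mul]
    rcases le_or_gt (-δ) x with hx | hx
    · rw [inter_eq_right.2 ((Iio_subset_Iic_self).trans (Iic_subset_Iic.2 hx)), h.Iio hδ,
        nuAlpha_Iio hα hp₀ hp₁ hδ, ENNReal.ofReal_mul (by linarith), hneg]
      ring
    · have hx0 : 0 < -x := by linarith
      obtain ⟨y, rfl⟩ : ∃ y, x = -y := ⟨-x, by ring⟩
      rw [neg_neg] at hx0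
      rw [inter_eq_left.2 (Iic_subset_Iio.2 hx), h.Iic hfin hx0,
        nuAlpha_Iic hα hp₀ hp₁ hx0, ENNReal.ofReal_mul (by linarith), hneg]
      ring
  rw [away_eq_union _, Measure.restrict_union hdisj measurableSet_Ioi,
    Measure.restrict_union hdisj measurableSet_Ioi, e1, e2, smul_add]

end NuAlpha

/-! ### Consequences of regular variation -/

section RegVar

variable {Ω : Type*} [MeasurableSpace Ω] {P : Measure Ω} {X : Ω → ℝ} {α p : ℝ}

/-- Portmanteau for continuity sets: `F` plays the closure of `G`, and `hle` says that the
difference carries no limit mass. -/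
theorem tendsto_of_tendstoMO {S : Type*} [PseudoEMetricSpace S] [MeasurableSpace S] {C : Set S}
    {μ : ℕ → Measure S} {μ₀ : Measure S} (h : TendstoMO C μ μ₀) {G F : Set S} (hG : IsOpen G)
    (hF : IsClosed F) (hGF : G ⊆ F) (hFC : Metric.AreSeparated F C) (hle : μ₀ F ≤ μ₀ G) :
    Tendsto (fun n => μ n G) atTop (𝓝 (μ₀ G)) := by
  refine tendsto_of_le_liminf_of_limsup_le (h.le_liminf G hG (hFC.mono hGF Subset.rfl)) ?_
  exact (limsup_le_limsup (Eventually.of_forall fun n => measure_mono hGF)).trans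
    ((h.limsup_le F hF hFC).trans hle)

theorem map_div_apply_away (hX : Measurable X) {n : ℕ} (hn : 1 ≤ n) (δ : ℝ) :
    P.map (fun ω => X ω / n) (away δ) = P {ω | (n : ℝ) * δ < |X ω|} := by
  have hn' : (0 : ℝ) < n := by exact_mod_cast hn
  rw [Measure.map_apply (hX.div_const _) (measurableSet_away δ)]
  congr 1
  ext ω
  simp only [away, mem_preimage, mem_ofPred_eq, abs_div, Nat.abs_cast]
  rw [lt_div_iff₀ hn', mul_comm]

/-- What the proof uses of regular variation with tail balance. -/
structure TailData (P : Measure Ω) (X : Ω → ℝ) (α p : ℝ) : Prop where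
  tail_pos : ∀ x : ℝ, 0 < P.real {ω | x < |X ω|}
  tail_ratio : ∀ δ : ℝ, 0 < δ → Tendsto
    (fun n : ℕ => P.real {ω | (n : ℝ) * δ < |X ω|} / P.real {ω | (n : ℝ) < |X ω|}) atTop
    (𝓝 (δ ^ (-α)))
  weak : ∀ δ : ℝ, 0 < δ → ∃ (L : ℕ → ProbabilityMeasure ℝ) (L₀ : ProbabilityMeasure ℝ),
    (∀ n, 1 ≤ n → (L n : Measure ℝ) = (P.map (fun ω => X ω / n))[|away δ]) ∧
    (L₀ : Measure ℝ) = (nuAlpha α p)[|away δ] ∧ Tendsto L atTop (𝓝 L₀)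

/-- Homogeneity determines the limit measure from the masses of `(1, ∞)` and `(-∞, -1)`, and tail
balance splits its total mass `c` outside `[-1, 1]` in the proportions `p` and `1 - p`. The unknown
sequence `γ` then disappears by taking quotients. -/
theorem IsRegVar.tailData [IsProbabilityMeasure P] (hX : Measurable X) (hα : 0 < α)
    (hRV : IsRegVar P X α p) : TailData P X α p := by
  obtain ⟨γ, ρ, μ, hγ, hμ0, hμne, hconv, hhom⟩ := hRV.exists_limit
  replace hhom : IsHomogeneous α μ := hhom
  have hfin := hconv.finite_lim
  set c : ℝ≥0∞ := μ (away 1) with hc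
  have hc0 : c ≠ 0 := hhom.away_one_ne_zero hμ0 hμne
  have hct : c ≠ ∞ := measure_away_ne_top hfin one_pos
  have hγpos : ∀ n, 1 ≤ n → 0 < γ n := hγ.1
  -- convergence of the two sided tails
  have haway : ∀ δ : ℝ, 0 < δ → Tendsto (fun n : ℕ => ENNReal.ofReal (γ n) *
      P {ω | (n : ℝ) * δ < |X ω|}) atTop (𝓝 (ENNReal.ofReal (δ ^ (-α)) * c)) := by
    intro δ hδ
    have h1 := tendsto_of_tendstoMO hconv (G := away δ) (F := {z | δ ≤ |z|}) (isOpen_away δ)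
      (isClosed_le continuous_const continuous_abs) (fun z (hz : δ < |z|) => show δ ≤ |z| from hz.le)
      (areSeparated_zero hδ fun z hz => hz) (by
        rw [hhom.away hδ]
        refine le_ofReal_rpow_mul_of_forall_lt hδ hct fun y hy hyδ => ?_
        rw [← hhom.away hy]
        exact measure_mono fun z hz => lt_of_lt_of_le hyδ hz)
    rw [hhom.away hδ] at h1
    refine h1.congr' ?_
    filter_upwards [eventually_ge_atTop 1] with n hn
    rw [Measure.smul_apply, smul_eq_mul, map_div_apply_away hX hn]
  have hIoi : Tendsto (fun n : ℕ => ENNReal.ofReal (γ n) * P {ω | (n : ℝ) < X ω}) atTop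
      (𝓝 (μ (Ioi 1))) := by
    have h1 := tendsto_of_tendstoMO hconv (G := Ioi 1) (F := Ici 1) isOpen_Ioi isClosed_Ici
      Ioi_subset_Ici_self
      (areSeparated_zero one_pos fun z hz => le_trans hz (le_abs_self z)) (by
        rw [hhom.Ici hfin one_pos]
        simp)
    refine h1.congr' ?_
    filter_upwards [eventually_ge_atTop 1] with n hn
    have hn' : (0 : ℝ) < n := by exact_mod_cast hn
    rw [Measure.smul_apply, smul_eq_mul, Measure.map_apply (hX.div_const _) measurableSet_Ioi]
    congr 2
    ext ω
    simp only [mem_preimage, mem_Ioi, mem_ofPred_eq, lt_div_iff₀ hn', one_mul]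
  -- the same in terms of real numbers
  have hawayR : ∀ δ : ℝ, 0 < δ → Tendsto (fun n : ℕ => γ n *
      P.real {ω | (n : ℝ) * δ < |X ω|}) atTop (𝓝 (δ ^ (-α) * c.toReal)) := by
    intro δ hδ
    have h1 := (ENNReal.tendsto_toReal (ENNReal.mul_ne_top ENNReal.ofReal_ne_top hct)).comp
      (haway δ hδ)
    rw [ENNReal.toReal_mul, ENNReal.toReal_ofReal (by positivity)] at h1
    refine h1.congr' ?_
    filter_upwards [eventually_ge_atTop 1] with n hn
    simp [ENNReal.toReal_mul, (hγpos n hn).le, Measure.real]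
  have hone : Tendsto (fun n : ℕ => γ n * P.real {ω | (n : ℝ) < |X ω|}) atTop (𝓝 c.toReal) := by
    simpa using hawayR 1 one_pos
  have hcpos : 0 < c.toReal := ENNReal.toReal_pos hc0 hct
  have hIoiR : Tendsto (fun n : ℕ => γ n * P.real {ω | (n : ℝ) < X ω}) atTop
      (𝓝 (μ (Ioi 1)).toReal) := by
    refine ((ENNReal.tendsto_toReal (measure_Ioi_ne_top hfin one_pos)).comp hIoi).congr' ?_
    filter_upwards [eventually_ge_atTop 1] with n hn
    simp [ENNReal.toReal_mul, (hγpos n hn).le, Measure.real]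
  have hp : (μ (Ioi 1)).toReal / c.toReal = p := by
    refine tendsto_nhds_unique ((hIoiR.div hone hcpos.ne').congr' ?_) hRV.tail_pos
    filter_upwards [eventually_ge_atTop 1] with n hn
    rw [Pi.div_apply, mul_div_mul_left _ _ (hγpos n hn).ne']
  have hμpos : μ (Ioi 1) = c * ENNReal.ofReal p := by
    rw [← hp, ENNReal.ofReal_div_of_pos hcpos, ENNReal.ofReal_toReal hct,
      ENNReal.ofReal_toReal (measure_Ioi_ne_top hfin one_pos), ENNReal.mul_div_cancel hc0 hct]
  have hμneg : μ (Iio (-1)) = c * ENNReal.ofReal (1 - p) := by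
    have h1 : c = μ (Iio (-1)) + c * ENNReal.ofReal p := by
      rw [← hμpos, hc, measure_away one_pos]
    have h2 : c = c * ENNReal.ofReal (1 - p) + c * ENNReal.ofReal p := by
      rw [← mul_add, ← ENNReal.ofReal_add (by linarith [hRV.p_le_one]) hRV.p_nonneg]
      simp
    exact (ENNReal.add_left_inj (ENNReal.mul_ne_top hct ENNReal.ofReal_ne_top)).1
      (h1.symm.trans h2)
  -- The limit `c` being positive, the tail is positive at arbitrarily large `n`, hence everywhere
  -- by monotonicity.
  have hpos : ∀ x : ℝ, 0 < P.real {ω | x < |X ω|} := by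
    intro x
    obtain ⟨n, hn1, hnx⟩ := ((hone.eventually_const_lt hcpos).and
      (tendsto_natCast_atTop_atTop.eventually_ge_atTop x)).exists
    refine (lt_of_le_of_ne measureReal_nonneg fun h => ?_).trans_le
      (measureReal_mono (μ := P) (s₁ := {ω | (n : ℝ) < |X ω|}) fun ω hω => hnx.trans_lt hω)
    rw [← h, mul_zero] at hn1
    exact lt_irrefl _ hn1
  refine ⟨hpos, fun δ hδ => ?_, fun δ hδ => ?_⟩
  · have h1 := (hawayR δ hδ).div hone hcpos.ne'
    rw [mul_div_cancel_right₀ _ hcpos.ne'] at h1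
    refine h1.congr' ?_
    filter_upwards [eventually_ge_atTop 1] with n hn
    rw [Pi.div_apply, mul_div_mul_left _ _ (hγpos n hn).ne']
  · have hlaw0 : ∀ n : ℕ, 1 ≤ n → P.map (fun ω => X ω / n) (away δ) ≠ 0 := by
      intro n hn h
      rw [map_div_apply_away hX hn] at h
      have := hpos (n * δ)
      rw [Measure.real, h] at this
      simp at this
    have hν : nuAlpha α p (away δ) = ENNReal.ofReal (δ ^ (-α)) :=
      nuAlpha_away hα hRV.p_nonneg hRV.p_le_one hδ
    have hν0 : nuAlpha α p (away δ) ≠ 0 := by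
      rw [hν]
      exact (ENNReal.ofReal_pos.2 (by positivity)).ne'
    have hνt : nuAlpha α p (away δ) ≠ ∞ := by
      rw [hν]
      exact ENNReal.ofReal_ne_top
    -- At `n = 0` the quotient `X ω / n` is `0`, so there is nothing to condition on and any
    -- probability measure serves.
    have hprob : ∀ n : ℕ, ∃ L : ProbabilityMeasure ℝ, 1 ≤ n →
        (L : Measure ℝ) = (P.map (fun ω => X ω / n))[|away δ] := by
      intro n
      by_cases hn : 1 ≤ n
      · have : IsProbabilityMeasure (P.map (fun ω => X ω / n)) :=
          Measure.isProbabilityMeasure_map (hX.div_const _).aemeasurable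
        exact ⟨⟨_, cond_isProbabilityMeasure (hlaw0 n hn)⟩, fun _ => rfl⟩
      · exact ⟨⟨Measure.dirac 0, inferInstance⟩, fun h => absurd h hn⟩
    choose L hL using hprob
    refine ⟨L, ⟨_, cond_isProbabilityMeasure_of_finite hν0 hνt⟩, hL, rfl, ?_⟩
    refine tendsto_of_forall_isOpen_le_liminf' fun G hG => ?_
    change (nuAlpha α p)[|away δ] G ≤ _
    have hrestr := hhom.restrict_away_eq hα hRV.p_nonneg hRV.p_le_one hfin hμpos hμneg hδ
    have hμG : μ (away δ ∩ G) = c * nuAlpha α p (away δ ∩ G) := by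
      rw [inter_comm, ← Measure.restrict_apply hG.measurableSet, hrestr, Measure.smul_apply,
        smul_eq_mul, Measure.restrict_apply hG.measurableSet]
    have hμA : μ (away δ) = c * nuAlpha α p (away δ) := by
      rw [hhom.away hδ, hν, mul_comm]
    have hlim := hconv.le_liminf (away δ ∩ G) ((isOpen_away δ).inter hG)
      (areSeparated_zero hδ fun z hz => le_of_lt hz.1)
    -- Conditioning divides by the mass of `away δ`, which converges; `γ n` cancels in the quotient,
    -- so the lower bound for open sets passes to the conditioned laws.
    have hinv : Tendsto (fun n : ℕ => (ENNReal.ofReal (γ n) *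
        P {ω | (n : ℝ) * δ < |X ω|})⁻¹) atTop (𝓝 (μ (away δ))⁻¹) := by
      rw [tendsto_inv_iff, hhom.away hδ]
      exact haway δ hδ
    have hle := (mul_le_mul' hinv.liminf_eq.ge hlim).trans (ENNReal.le_liminf_mul)
    refine le_trans (le_of_eq ?_) (hle.trans (le_of_eq (liminf_congr ?_)))
    · rw [cond_apply (measurableSet_away δ), hμA, hμG,
        ENNReal.mul_inv (Or.inl hc0) (Or.inl hct), mul_mul_mul_comm,
        ENNReal.inv_mul_cancel hc0 hct, one_mul]
    · filter_upwards [eventually_ge_atTop 1] with n hn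
      have hg0 : ENNReal.ofReal (γ n) ≠ 0 := (ENNReal.ofReal_pos.2 (hγpos n hn)).ne'
      rw [hL n hn, cond_apply (measurableSet_away δ), Pi.mul_apply, Measure.smul_apply, smul_eq_mul,
        ENNReal.mul_inv (Or.inl hg0) (Or.inl ENNReal.ofReal_ne_top), mul_mul_mul_comm,
        ENNReal.inv_mul_cancel hg0 ENNReal.ofReal_ne_top, one_mul, map_div_apply_away hX hn]

end RegVar

/-! ### Polynomial bounds for the tail, and moments -/

/-- A Potter-type bound: the doubling inequality is iterated along powers of `2`, and monotonicity
fills the gaps between them. -/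
theorem exists_le_mul_rpow_neg {f : ℕ → ℝ} (hf : Antitone f) (h0 : ∀ n, 0 < f n) {β : ℝ}
    (hβ : 0 ≤ β) (h : ∀ᶠ n in atTop, f (n * 2) ≤ 2 ^ (-β) * f n) :
    ∃ C : ℝ, 0 < C ∧ ∀ n : ℕ, 1 ≤ n → f n ≤ C * (n : ℝ) ^ (-β) := by
  obtain ⟨n₀, hn₀⟩ := eventually_atTop.1 h
  have hdy : ∀ i, f (2 ^ (n₀ + i)) ≤ (2 ^ (-β) : ℝ) ^ i * f 0 := by
    intro i
    induction i with
    | zero => simpa using hf (Nat.zero_le _)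
    | succ i ih =>
      have hle : n₀ ≤ 2 ^ (n₀ + i) := (Nat.le_add_right _ _).trans Nat.lt_two_pow_self.le
      rw [← add_assoc, pow_succ 2]
      refine (hn₀ _ hle).trans ?_
      rw [pow_succ', mul_assoc]
      gcongr
  have h2 : (0 : ℝ) < 2 ^ (-β) := by positivity
  have h2' : (2 : ℝ) ^ (-β) ≤ 1 := Real.rpow_le_one_of_one_le_of_nonpos (by norm_num) (by linarith)
  -- The decay only starts at `2 ^ n₀`, which costs `n₀` factors; the last one pays for rounding `n`
  -- to a power of `2`.
  refine ⟨f 0 / ((2 : ℝ) ^ (-β)) ^ (n₀ + 1), div_pos (h0 0) (by positivity), fun n hn => ?_⟩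
  set i := Nat.log 2 n with hi
  have hle : 2 ^ i ≤ n := Nat.pow_log_le_self 2 (by lia)
  have hlt : n < 2 ^ (i + 1) := Nat.lt_pow_succ_log_self (by norm_num) n
  have h4 : ((2 : ℝ) ^ (-β)) ^ (i + 1) ≤ (n : ℝ) ^ (-β) := by
    rw [← Real.rpow_natCast, ← Real.rpow_mul (by norm_num), mul_comm, Real.rpow_mul (by norm_num)]
    refine Real.rpow_le_rpow_of_nonpos (by exact_mod_cast hn) ?_ (by linarith)
    rw [Real.rpow_natCast]
    exact_mod_cast hlt.le
  have h5 : f n * ((2 : ℝ) ^ (-β)) ^ n₀ ≤ f 0 * ((2 : ℝ) ^ (-β)) ^ i := by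
    rcases le_total n₀ i with h | h
    · obtain ⟨l, hl⟩ := Nat.exists_eq_add_of_le h
      rw [hl, pow_add, ← mul_assoc, mul_right_comm]
      refine mul_le_mul_of_nonneg_right ((hf hle).trans ?_) (by positivity)
      rw [hl, mul_comm]
      exact hdy l
    · exact mul_le_mul (hf (Nat.zero_le _)) (pow_le_pow_of_le_one h2.le h2' h) (by positivity)
        (h0 0).le
  rw [div_mul_eq_mul_div, le_div_iff₀ (by positivity), pow_succ, ← mul_assoc]
  calc f n * ((2 : ℝ) ^ (-β)) ^ n₀ * 2 ^ (-β) ≤ f 0 * ((2 : ℝ) ^ (-β)) ^ i * 2 ^ (-β) := by gcongr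
    _ = f 0 * ((2 : ℝ) ^ (-β)) ^ (i + 1) := by ring
    _ ≤ f 0 * (n : ℝ) ^ (-β) := mul_le_mul_of_nonneg_left h4 (h0 0).le

/-- The iteration now runs along `(n₀ + 1) * 2 ^ i`, which is in the range of the doubling
inequality and lies above `n` once `2 ^ i` does. -/
theorem exists_mul_rpow_neg_le {f : ℕ → ℝ} (hf : Antitone f) (h0 : ∀ n, 0 < f n) {β : ℝ}
    (hβ : 0 ≤ β) (h : ∀ᶠ n in atTop, 2 ^ (-β) * f n ≤ f (n * 2)) :
    ∃ c : ℝ, 0 < c ∧ ∀ n : ℕ, 1 ≤ n → c * (n : ℝ) ^ (-β) ≤ f n := by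
  obtain ⟨n₀, hn₀⟩ := eventually_atTop.1 h
  have hdy : ∀ i, (2 ^ (-β) : ℝ) ^ i * f (n₀ + 1) ≤ f ((n₀ + 1) * 2 ^ i) := by
    intro i
    induction i with
    | zero => simp
    | succ i ih =>
      have hle : n₀ ≤ (n₀ + 1) * 2 ^ i :=
        (Nat.le_succ _).trans (Nat.le_mul_of_pos_right _ (by positivity))
      rw [pow_succ 2, ← mul_assoc]
      refine le_trans ?_ (hn₀ _ hle)
      rw [pow_succ', mul_assoc]
      gcongr
  refine ⟨2 ^ (-β) * f (n₀ + 1), mul_pos (by positivity) (h0 _), fun n hn => ?_⟩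
  set i := Nat.log 2 n with hi
  have hle : 2 ^ i ≤ n := Nat.pow_log_le_self 2 (by lia)
  have hlt : n < 2 ^ (i + 1) := Nat.lt_pow_succ_log_self (by norm_num) n
  have h4 : (n : ℝ) ^ (-β) ≤ ((2 : ℝ) ^ (-β)) ^ i := by
    rw [← Real.rpow_natCast, ← Real.rpow_mul (by norm_num), mul_comm, Real.rpow_mul (by norm_num)]
    refine Real.rpow_le_rpow_of_nonpos (by positivity) ?_ (by linarith)
    rw [Real.rpow_natCast]
    exact_mod_cast hle
  calc 2 ^ (-β) * f (n₀ + 1) * (n : ℝ) ^ (-β)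
      ≤ 2 ^ (-β) * f (n₀ + 1) * ((2 : ℝ) ^ (-β)) ^ i :=
        mul_le_mul_of_nonneg_left h4 (mul_pos (by positivity) (h0 _)).le
    _ = ((2 : ℝ) ^ (-β)) ^ (i + 1) * f (n₀ + 1) := by ring
    _ ≤ f ((n₀ + 1) * 2 ^ (i + 1)) := hdy _
    _ ≤ f n := hf (hlt.le.trans (Nat.le_mul_of_pos_left _ (by lia)))

section Tail

variable {Ω : Type*} [MeasurableSpace Ω] {P : Measure Ω} [IsProbabilityMeasure P] {X : Ω → ℝ}
  {α p : ℝ}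

theorem antitone_tail (P : Measure Ω) [IsProbabilityMeasure P] (X : Ω → ℝ) :
    Antitone fun x : ℝ => P.real {ω | x < |X ω|} :=
  fun _ _ hxy => measureReal_mono fun _ hω => lt_of_le_of_lt hxy hω

theorem TailData.exists_tail_le (hT : TailData P X α p) {β : ℝ} (hβ : 0 ≤ β) (hβα : β < α) :
    ∃ C : ℝ, 0 < C ∧ ∀ n : ℕ, 1 ≤ n → P.real {ω | (n : ℝ) < |X ω|} ≤ C * (n : ℝ) ^ (-β) := by
  refine exists_le_mul_rpow_neg (f := fun n : ℕ => P.real {ω | (n : ℝ) < |X ω|})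
    (fun a b hab => antitone_tail P X (Nat.cast_le.2 hab)) (fun n => hT.tail_pos n) hβ ?_
  have h1 : (2 : ℝ) ^ (-α) < 2 ^ (-β) :=
    Real.rpow_lt_rpow_of_exponent_lt (by norm_num) (by linarith)
  filter_upwards [(hT.tail_ratio 2 two_pos).eventually_lt_const h1] with n hn
  rw [div_lt_iff₀ (hT.tail_pos n)] at hn
  simpa using hn.le

theorem TailData.exists_le_tail (hT : TailData P X α p) {β : ℝ} (hβ : 0 ≤ β) (hβα : α < β) :
    ∃ c : ℝ, 0 < c ∧ ∀ n : ℕ, 1 ≤ n → c * (n : ℝ) ^ (-β) ≤ P.real {ω | (n : ℝ) < |X ω|} := by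
  refine exists_mul_rpow_neg_le (f := fun n : ℕ => P.real {ω | (n : ℝ) < |X ω|})
    (fun a b hab => antitone_tail P X (Nat.cast_le.2 hab)) (fun n => hT.tail_pos n) hβ ?_
  have h1 : (2 : ℝ) ^ (-β) < 2 ^ (-α) :=
    Real.rpow_lt_rpow_of_exponent_lt (by norm_num) (by linarith)
  filter_upwards [(hT.tail_ratio 2 two_pos).eventually_const_lt h1] with n hn
  rw [lt_div_iff₀ (hT.tail_pos n)] at hn
  simpa using hn.le

theorem TailData.tendsto_mul_tail (hT : TailData P X α p) (hα : 1 < α) :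
    Tendsto (fun n : ℕ => n * P.real {ω | (n : ℝ) < |X ω|}) atTop (𝓝 0) := by
  obtain ⟨β, hβ1, hβα⟩ := exists_between hα
  obtain ⟨C, hC, h⟩ := hT.exists_tail_le (by linarith) hβα
  have h1 : Tendsto (fun n : ℕ => C * (n : ℝ) ^ (-(β - 1))) atTop (𝓝 0) := by
    simpa using ((tendsto_rpow_neg_atTop (sub_pos.2 hβ1)).comp
      tendsto_natCast_atTop_atTop).const_mul C
  refine tendsto_of_tendsto_of_tendsto_of_le_of_le' tendsto_const_nhds h1
    (Eventually.of_forall fun n => by positivity) ?_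
  filter_upwards [eventually_ge_atTop 1] with n hn
  have hn' : (0 : ℝ) < n := by exact_mod_cast hn
  have e : (n : ℝ) ^ (-(β - 1)) = n * (n : ℝ) ^ (-β) := by
    rw [show -(β - 1) = 1 + -β by ring, Real.rpow_add hn', Real.rpow_one]
  rw [e, mul_left_comm]
  gcongr
  exact h n hn

/-- Layer cake formula with a tail exponent strictly between `κ` and `α`. The tail bound is
available at integers, so `t` is replaced by `⌊t⌋₊ ≥ t / 2` at the price of `2 ^ β`. -/
theorem TailData.integrable_rpow (hT : TailData P X α p) (hX : Measurable X) {κ : ℝ}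
    (hκ : 0 < κ) (hκα : κ < α) : Integrable (fun ω => |X ω| ^ κ) P := by
  obtain ⟨β, hβ1, hβα⟩ := exists_between hκα
  obtain ⟨C, hC, h⟩ := hT.exists_tail_le (hκ.le.trans hβ1.le) hβα
  have hmeas : Measurable fun ω => |X ω| ^ κ := by
    have : Measurable fun ω => |X ω| := continuous_abs.measurable.comp hX
    exact this.pow_const κ
  refine ⟨hmeas.aestronglyMeasurable, ?_⟩
  rw [hasFiniteIntegral_iff_ofReal (ae_of_all _ fun ω => by positivity)]
  rw [lintegral_rpow_eq_lintegral_meas_lt_mul P (ae_of_all _ fun ω => abs_nonneg (X ω))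
    (continuous_abs.measurable.comp hX).aemeasurable hκ]
  refine ENNReal.mul_lt_top ENNReal.ofReal_lt_top ?_
  have hsplit : Ioi (0 : ℝ) = Ioc 0 1 ∪ Ioi 1 := (Ioc_union_Ioi_eq_Ioi zero_le_one).symm
  rw [hsplit]
  refine (lintegral_union_le _ _ _).trans_lt (ENNReal.add_lt_top.2 ⟨?_, ?_⟩)
  · have hi : IntegrableOn (fun t : ℝ => t ^ (κ - 1)) (Ioc 0 1) :=
      (intervalIntegrable_iff_integrableOn_Ioc_of_le zero_le_one).1
        (intervalIntegral.intervalIntegrable_rpow' (by linarith))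
    refine lt_of_le_of_lt (lintegral_mono fun t => ?_) hi.lintegral_lt_top
    exact mul_le_of_le_one_left' prob_le_one
  · have hi : IntegrableOn (fun t : ℝ => C * 2 ^ β * t ^ (κ - 1 - β)) (Ioi 1) :=
      (integrableOn_Ioi_rpow_of_lt (by linarith) one_pos).const_mul _
    refine lt_of_le_of_lt (setLIntegral_mono' measurableSet_Ioi fun t ht => ?_)
      hi.lintegral_lt_top
    have ht1 : (1 : ℝ) < t := ht
    have ht0 : 0 < t := zero_lt_one.trans ht1
    have hfl : 1 ≤ ⌊t⌋₊ := Nat.le_floor (by simpa using ht1.le)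
    have hhalf : t / 2 ≤ ⌊t⌋₊ := by
      have h1 := Nat.lt_floor_add_one t
      have h2 : (1 : ℝ) ≤ ⌊t⌋₊ := by exact_mod_cast hfl
      linarith
    have hb : P.real {ω | t < |X ω|} ≤ C * 2 ^ β * t ^ (-β) := by
      refine (antitone_tail P X (Nat.floor_le ht0.le)).trans ((h _ hfl).trans ?_)
      rw [mul_assoc]
      refine mul_le_mul_of_nonneg_left ?_ hC.le
      refine (Real.rpow_le_rpow_of_nonpos (by positivity) hhalf (by linarith)).trans (le_of_eq ?_)
      rw [Real.div_rpow ht0.le zero_le_two, Real.rpow_neg zero_le_two β, div_inv_eq_mul, mul_comm]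
    rw [← ofReal_measureReal, ← ENNReal.ofReal_mul measureReal_nonneg]
    refine ENNReal.ofReal_le_ofReal ?_
    rw [show κ - 1 - β = -β + (κ - 1) by ring, Real.rpow_add ht0, ← mul_assoc]
    gcongr

theorem TailData.integrable (hT : TailData P X α p) (hX : Measurable X) (hα : 1 < α) :
    Integrable X P := by
  have h := hT.integrable_rpow hX one_pos hα
  simp only [Real.rpow_one] at h
  exact (integrable_norm_iff hX.aestronglyMeasurable).1 h

end Tail

/-! ### Deviations of sums of truncated variables -/

/-- Truncation at level `b`. -/
noncomputable def trunc (b x : ℝ) : ℝ := if |x| ≤ b then x else 0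

theorem abs_trunc_le_abs (b x : ℝ) : |trunc b x| ≤ |x| := by
  unfold trunc
  split_ifs <;> simp

theorem abs_trunc_le {b : ℝ} (hb : 0 ≤ b) (x : ℝ) : |trunc b x| ≤ b := by
  unfold trunc
  split_ifs with h
  · exact h
  · simpa using hb

theorem measurable_trunc (b : ℝ) : Measurable (trunc b) :=
  Measurable.ite (measurableSet_le continuous_abs.measurable measurable_const) measurable_id
    measurable_const

/-- A substitute for the second order Taylor bound that only uses a moment of order `κ`; the
variance may be infinite when `α ≤ 2`. -/
theorem exp_le_one_add_add_rpow {κ : ℝ} (hκ1 : 1 ≤ κ) (hκ2 : κ ≤ 2) (x : ℝ) :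
    Real.exp x ≤ 1 + x + |x| ^ κ * Real.exp |x| := by
  have he : 1 ≤ Real.exp |x| := Real.one_le_exp (abs_nonneg x)
  have hp : 0 ≤ |x| ^ κ := by positivity
  rcases le_or_gt |x| 1 with hx | hx
  · have h1 := (abs_le.1 (Real.abs_exp_sub_one_sub_id_le hx)).2
    have h2 : x ^ 2 ≤ |x| ^ κ := by
      rcases eq_or_ne x 0 with rfl | hx0
      · simpa using hp
      rw [← sq_abs, ← Real.rpow_natCast]
      exact Real.rpow_le_rpow_of_exponent_ge (abs_pos.2 hx0) hx (by simpa using hκ2)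
    nlinarith
  · have h1 : |x| ≤ |x| ^ κ := by
      simpa using Real.rpow_le_rpow_of_exponent_le hx.le hκ1
    rcases le_or_gt 0 x with h0 | h0
    · rw [abs_of_nonneg h0] at *
      nlinarith [Real.exp_pos x]
    · have h2 : Real.exp x ≤ 1 := Real.exp_le_one_iff.2 h0.le
      have h3 : |x| = -x := abs_of_neg h0
      nlinarith

section Deviation

variable {Ω : Type*} [MeasurableSpace Ω] {P : Measure Ω} {Z : ℕ → Ω → ℝ}

theorem mgf_sum_trunc {b : ℝ} (s : ℝ) (k : ℕ) (hmeas : ∀ i, Measurable (Z i))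
    (hindep : iIndepFun Z P) (hident : ∀ i, IdentDistrib (Z i) (Z 0) P P) :
    mgf (∑ i ∈ Finset.range k, fun ω => trunc b (Z i ω)) P s =
      mgf (fun ω => trunc b (Z 0 ω)) P s ^ k := by
  have hi : iIndepFun (fun i ω => trunc b (Z i ω)) P :=
    hindep.comp (fun _ => trunc b) fun _ => measurable_trunc b
  rw [hi.mgf_sum (fun i => (measurable_trunc b).comp (hmeas i)),
    Finset.prod_congr rfl fun i _ => ?_, Finset.prod_const, Finset.card_range]
  exact congrFun (mgf_congr_identDistrib ((hident i).comp (measurable_trunc b))) s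

theorem tendsto_integral_trunc {X : Ω → ℝ} (hX : Measurable X) (hint : Integrable X P) {δ : ℝ}
    (hδ : 0 < δ) :
    Tendsto (fun n : ℕ => ∫ ω, trunc (n * δ) (X ω) ∂P) atTop (𝓝 (∫ ω, X ω ∂P)) := by
  refine tendsto_integral_of_dominated_convergence (fun ω => |X ω|)
    (fun n => ((measurable_trunc _).comp hX).aestronglyMeasurable) hint.abs
    (fun n => ae_of_all _ fun ω => abs_trunc_le_abs _ _) (ae_of_all _ fun ω => ?_)
  refine tendsto_const_nhds.congr' ?_
  have h1 : Tendsto (fun n : ℕ => (n : ℝ) * δ) atTop atTop :=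
    tendsto_natCast_atTop_atTop.atTop_mul_const hδ
  filter_upwards [h1.eventually_ge_atTop |X ω|] with n hn
  simp [trunc, hn]

variable [IsProbabilityMeasure P]

theorem integrable_exp_mul_trunc {X : Ω → ℝ} (hX : Measurable X) {b : ℝ} (hb : 0 ≤ b) (s : ℝ) :
    Integrable (fun ω => Real.exp (s * trunc b (X ω))) P :=
  integrable_exp_mul_of_mem_Icc ((measurable_trunc b).comp hX).aemeasurable
    (ae_of_all _ fun ω => abs_le.1 (abs_trunc_le hb (X ω)))

theorem mgf_trunc_le {X : Ω → ℝ} (hX : Measurable X) {κ : ℝ} (hκ1 : 1 ≤ κ) (hκ2 : κ ≤ 2)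
    (hint : Integrable X P) (hκ : Integrable (fun ω => |X ω| ^ κ) P) {b : ℝ} (hb : 0 ≤ b)
    (s : ℝ) :
    mgf (fun ω => trunc b (X ω)) P s ≤ Real.exp (s * ∫ ω, trunc b (X ω) ∂P +
      |s| ^ κ * (∫ ω, |X ω| ^ κ ∂P) * Real.exp (|s| * b)) := by
  have htr : Integrable (fun ω => trunc b (X ω)) P :=
    hint.mono ((measurable_trunc b).comp hX).aestronglyMeasurable
      (ae_of_all _ fun ω => abs_trunc_le_abs b (X ω))
  have h1 : ∀ ω, Real.exp (s * trunc b (X ω)) ≤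
      1 + s * trunc b (X ω) + |s| ^ κ * Real.exp (|s| * b) * |X ω| ^ κ := by
    intro ω
    refine (exp_le_one_add_add_rpow hκ1 hκ2 _).trans ?_
    rw [abs_mul, Real.mul_rpow (abs_nonneg _) (abs_nonneg _), mul_right_comm]
    have hκ0 : 0 ≤ κ := by linarith
    have ha : |trunc b (X ω)| ^ κ ≤ |X ω| ^ κ :=
      Real.rpow_le_rpow (abs_nonneg _) (abs_trunc_le_abs _ _) hκ0
    have hb' := abs_trunc_le hb (X ω)
    gcongr
  have h2 : mgf (fun ω => trunc b (X ω)) P s ≤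
      1 + s * ∫ ω, trunc b (X ω) ∂P + |s| ^ κ * Real.exp (|s| * b) * ∫ ω, |X ω| ^ κ ∂P := by
    have hi1 : Integrable (fun ω => 1 + s * trunc b (X ω)) P :=
      (integrable_const 1).add (htr.const_mul s)
    have hi2 : Integrable (fun ω => |s| ^ κ * Real.exp (|s| * b) * |X ω| ^ κ) P := hκ.const_mul _
    refine (integral_mono (integrable_exp_mul_trunc hX hb s) (hi1.add hi2) h1).trans (le_of_eq ?_)
    simp only [Pi.add_apply]
    rw [integral_add hi1 hi2, integral_add (integrable_const 1) (htr.const_mul s),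
      integral_const_mul, integral_const_mul]
    simp
  refine h2.trans (le_trans (le_of_eq ?_) (Real.add_one_le_exp _))
  ring

/-- Chernoff bound for both tails. The centring `m` need not be the truncated mean, whence the bias
term in the exponent. -/
theorem measure_abs_sum_trunc_ge_le {κ : ℝ} (hκ1 : 1 ≤ κ) (hκ2 : κ ≤ 2)
    (hmeas : ∀ i, Measurable (Z i))
    (hindep : iIndepFun Z P) (hident : ∀ i, IdentDistrib (Z i) (Z 0) P P)
    (hint : Integrable (Z 0) P) (hκ : Integrable (fun ω => |Z 0 ω| ^ κ) P) {b : ℝ} (hb : 0 ≤ b)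
    {σ : ℝ} (hσ : 0 ≤ σ) (a m : ℝ) (k : ℕ) :
    P.real {ω | a ≤ |∑ i ∈ Finset.range k, trunc b (Z i ω) - k * m|} ≤
      2 * Real.exp (-σ * a + k * (σ * |∫ ω, trunc b (Z 0 ω) ∂P - m| +
        σ ^ κ * (∫ ω, |Z 0 ω| ^ κ ∂P) * Real.exp (σ * b))) := by
  set S : Ω → ℝ := ∑ i ∈ Finset.range k, fun ω => trunc b (Z i ω) with hS
  have hSω : ∀ ω, ∑ i ∈ Finset.range k, trunc b (Z i ω) = S ω := fun ω => by simp [hS]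
  set e := ∫ ω, trunc b (Z 0 ω) ∂P with he
  set K := ∫ ω, |Z 0 ω| ^ κ ∂P with hK
  have hSint : ∀ s, Integrable (fun ω => Real.exp (s * S ω)) P := fun s => by
    refine iIndepFun.integrable_exp_mul_sum
      (hindep.comp (fun _ => trunc b) fun _ => measurable_trunc b)
      (fun i => (measurable_trunc b).comp (hmeas i)) fun i _ => ?_
    exact integrable_exp_mul_trunc (hmeas i) hb s
  have hmgf : ∀ s, mgf S P s ≤ Real.exp (k * (s * e + |s| ^ κ * K * Real.exp (|s| * b))) := by
    intro s
    rw [hS, mgf_sum_trunc s k hmeas hindep hident, Real.exp_nat_mul]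
    exact pow_le_pow_left₀ mgf_nonneg (mgf_trunc_le (hmeas 0) hκ1 hκ2 hint hκ hb s) k
  have hcover : {ω | a ≤ |∑ i ∈ Finset.range k, trunc b (Z i ω) - k * m|} ⊆
      {ω | a + k * m ≤ S ω} ∪ {ω | S ω ≤ -a + k * m} := by
    intro ω hω
    have hω' : a ≤ |∑ i ∈ Finset.range k, trunc b (Z i ω) - k * m| := hω
    rw [hSω] at hω'
    rcases le_abs.1 hω' with h | h
    · left
      change a + k * m ≤ S ω
      linarith
    · right
      change S ω ≤ -a + k * m
      linarith
  have hdiff : ∀ s : ℝ, |s| = σ → s * (e - m) ≤ σ * |e - m| := fun s hs => by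
    rw [← hs, ← abs_mul]
    exact le_abs_self _
  have hup : P.real {ω | a + k * m ≤ S ω} ≤ Real.exp (-σ * a + k * (σ * |e - m| +
        σ ^ κ * K * Real.exp (σ * b))) := by
    refine (measure_ge_le_exp_mul_mgf _ hσ (hSint σ)).trans ?_
    refine (mul_le_mul_of_nonneg_left (hmgf σ) (Real.exp_pos _).le).trans ?_
    rw [← Real.exp_add, Real.exp_le_exp, abs_of_nonneg hσ]
    have := mul_le_mul_of_nonneg_left (hdiff σ (abs_of_nonneg hσ)) (Nat.cast_nonneg (α := ℝ) k)
    linarith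
  have hdown : P.real {ω | S ω ≤ -a + k * m} ≤ Real.exp (-σ * a + k * (σ * |e - m| +
        σ ^ κ * K * Real.exp (σ * b))) := by
    refine (measure_le_le_exp_mul_mgf _ (neg_nonpos.2 hσ) (hSint (-σ))).trans ?_
    refine (mul_le_mul_of_nonneg_left (hmgf (-σ)) (Real.exp_pos _).le).trans ?_
    rw [← Real.exp_add, Real.exp_le_exp, abs_neg, abs_of_nonneg hσ]
    have := mul_le_mul_of_nonneg_left (hdiff (-σ) (by rw [abs_neg, abs_of_nonneg hσ]))
      (Nat.cast_nonneg (α := ℝ) k)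
    linarith
  refine (measureReal_mono hcover).trans ((measureReal_union_le _ _).trans ?_)
  linarith

/-- The event that the truncated walk deviates from its drift by at least `n ε`. -/
def truncDeviation (Z : ℕ → Ω → ℝ) (M m δ ε : ℝ) (n : ℕ) : Set Ω :=
  {ω | ∃ k ≤ ⌊(n : ℝ) * M⌋₊,
    n * ε ≤ |∑ i ∈ Finset.range k, trunc (n * δ) (Z i ω) - k * m|}

theorem tendsto_rpow_mul_truncDeviation {κ : ℝ} (hκ1 : 1 < κ) (hκ2 : κ ≤ 2)
    (hmeas : ∀ i, Measurable (Z i))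
    (hindep : iIndepFun Z P) (hident : ∀ i, IdentDistrib (Z i) (Z 0) P P)
    (hint : Integrable (Z 0) P) (hκ : Integrable (fun ω => |Z 0 ω| ^ κ) P)
    {m : ℝ} (hm : m = ∫ ω, Z 0 ω ∂P) {M : ℝ} (hM : 0 < M) {ε : ℝ} (hε : 0 < ε) {r : ℝ}
    (hr : 0 ≤ r) :
    ∃ δ₀ > 0, ∀ δ, 0 < δ → δ < δ₀ →
      Tendsto (fun n : ℕ => (n : ℝ) ^ r * P.real (truncDeviation Z M m δ ε n)) atTop (𝓝 0) := by
  -- With `σ = A * log n / n` the Chernoff factor is `n ^ (-2 * (r + 2))`. Half of this exponent is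
  -- given up to the bias of the truncated mean. The remaining `n ^ (-(r + 2))` absorbs the weight
  -- `n ^ r` and the union over about `n * M` indices, with a factor `1 / n` to spare.
  set A : ℝ := 2 * (r + 2) / ε with hA
  have hA0 : 0 < A := by positivity
  set K := ∫ ω, |Z 0 ω| ^ κ ∂P with hK
  have hK0 : 0 ≤ K := integral_nonneg fun ω => by positivity
  -- The moment term is of order `(log n) ^ κ * n ^ (1 - κ + A * δ)`, so `A * δ ≤ (κ - 1) / 2` makes
  -- it vanish.
  refine ⟨(κ - 1) / (2 * A), div_pos (by linarith) (by positivity), fun δ hδ hδ' => ?_⟩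
  have hAδ : A * δ ≤ (κ - 1) / 2 := by
    rw [lt_div_iff₀ (by positivity)] at hδ'
    linarith
  set e : ℕ → ℝ := fun n => |∫ ω, trunc (n * δ) (Z 0 ω) ∂P - m| with he
  have he0 : Tendsto e atTop (𝓝 0) := by
    have := ((tendsto_integral_trunc (hmeas 0) hint hδ).sub_const m).abs
    rwa [← hm, sub_self, abs_zero] at this
  have hlog : Tendsto (fun n : ℕ => M * K * A ^ κ *
      (Real.log n ^ κ / (n : ℝ) ^ ((κ - 1) / 2))) atTop (𝓝 0) := by
    have := (isLittleO_log_rpow_rpow_atTop κ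
      (show (0 : ℝ) < (κ - 1) / 2 by linarith)).tendsto_div_nhds_zero
    simpa using (this.comp tendsto_natCast_atTop_atTop).const_mul (M * K * A ^ κ)
  -- the main estimate
  have hbound : ∀ᶠ n : ℕ in atTop, P.real (truncDeviation Z M m δ ε n) ≤
      (n * M + 1) * (2 * Real.exp 1 * (n : ℝ) ^ (-(r + 2))) := by
    filter_upwards [eventually_ge_atTop 2, hlog.eventually_lt_const one_pos,
      he0.eventually_lt_const (show 0 < ε / (2 * M) by positivity)] with n hn hlogn hen
    have hn0 : (0 : ℝ) < n := by positivity
    have hn1 : (1 : ℝ) < n := by exact_mod_cast hn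
    have hlog0 : 0 < Real.log n := Real.log_pos hn1
    set N := ⌊(n : ℝ) * M⌋₊ with hN
    have hNle : (N : ℝ) ≤ n * M := Nat.floor_le (by positivity)
    set σ : ℝ := A * Real.log n / n with hσ
    have hσ0 : 0 ≤ σ := by positivity
    have hexpσ : Real.exp (σ * (n * δ)) = (n : ℝ) ^ (A * δ) := by
      rw [Real.rpow_def_of_pos hn0]
      congr 1
      rw [hσ]
      field_simp
    have hmain : σ ^ κ * K * Real.exp (σ * (n * δ)) * (n * M) ≤ 1 := by
      rw [hexpσ, hσ, Real.div_rpow (by positivity) hn0.le, Real.mul_rpow hA0.le hlog0.le]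
      refine le_trans ?_ hlogn.le
      have h1 : (n : ℝ) ^ (A * δ) ≤ (n : ℝ) ^ ((κ - 1) / 2) :=
        Real.rpow_le_rpow_of_exponent_le hn1.le hAδ
      have h2 : (n : ℝ) ^ κ = (n : ℝ) ^ ((κ - 1) / 2) * (n : ℝ) ^ ((κ - 1) / 2) * n := by
        rw [← Real.rpow_add hn0]
        conv_rhs => rw [← Real.rpow_add_one hn0.ne']
        congr 1
        ring
      rw [h2]
      calc A ^ κ * Real.log n ^ κ / ((n : ℝ) ^ ((κ - 1) / 2) * (n : ℝ) ^ ((κ - 1) / 2) * n) * K *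
            (n : ℝ) ^ (A * δ) * (n * M)
          ≤ A ^ κ * Real.log n ^ κ / ((n : ℝ) ^ ((κ - 1) / 2) * (n : ℝ) ^ ((κ - 1) / 2) * n) * K *
            (n : ℝ) ^ ((κ - 1) / 2) * (n * M) := by gcongr
        _ = M * K * A ^ κ * (Real.log n ^ κ / (n : ℝ) ^ ((κ - 1) / 2)) := by
          field_simp
    have hone : ∀ k ≤ N, P.real {ω | n * ε ≤
        |∑ i ∈ Finset.range k, trunc (n * δ) (Z i ω) - k * m|} ≤
        2 * Real.exp 1 * (n : ℝ) ^ (-(r + 2)) := by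
      intro k hk
      refine (measure_abs_sum_trunc_ge_le hκ1.le hκ2 hmeas hindep hident hint hκ
        (by positivity) hσ0 _ m k).trans ?_
      rw [mul_assoc 2 (Real.exp 1), Real.rpow_def_of_pos hn0, ← Real.exp_add]
      refine mul_le_mul_of_nonneg_left (Real.exp_le_exp.2 ?_) zero_le_two
      have hkN : (k : ℝ) ≤ n * M := le_trans (by exact_mod_cast hk) hNle
      have h1 : (k : ℝ) * (σ * e n + σ ^ κ * K * Real.exp (σ * (n * δ))) ≤
          (n * M) * (σ * (ε / (2 * M)) + σ ^ κ * K * Real.exp (σ * (n * δ))) := by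
        gcongr
      have h2 : n * M * (σ * (ε / (2 * M))) = (r + 2) * Real.log n := by
        rw [hσ, hA]
        field_simp
      have h3 : σ * (n * ε) = 2 * (r + 2) * Real.log n := by
        rw [hσ, hA]
        field_simp
      simp only [he] at h1
      linarith
    have hsub : truncDeviation Z M m δ ε n ⊆ ⋃ k ∈ Finset.range (N + 1), {ω | n * ε ≤
        |∑ i ∈ Finset.range k, trunc (n * δ) (Z i ω) - k * m|} := by
      rintro ω ⟨k, hk, h⟩
      exact mem_biUnion (Finset.mem_range.2 (Nat.lt_succ_of_le hk)) h
    refine (measureReal_mono hsub (measure_ne_top _ _)).trans ((measureReal_biUnion_finset_le _ _).trans ?_)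
    refine (Finset.sum_le_sum fun k hk => hone k
      (Nat.lt_succ_iff.1 (Finset.mem_range.1 hk))).trans ?_
    rw [Finset.sum_const, Finset.card_range, nsmul_eq_mul]
    gcongr
    push_cast
    linarith
  have hfinal : Tendsto (fun n : ℕ => 2 * Real.exp 1 *
      (M * (n : ℝ) ^ (-(1 : ℝ)) + (n : ℝ) ^ (-(2 : ℝ)))) atTop (𝓝 0) := by
    have h1 := (tendsto_rpow_neg_atTop one_pos).comp (tendsto_natCast_atTop_atTop (R := ℝ))
    have h2 := (tendsto_rpow_neg_atTop two_pos).comp (tendsto_natCast_atTop_atTop (R := ℝ))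
    simpa using ((h1.const_mul M).add h2).const_mul (2 * Real.exp 1)
  refine tendsto_of_tendsto_of_tendsto_of_le_of_le' tendsto_const_nhds hfinal
    (Eventually.of_forall fun n => by positivity) ?_
  filter_upwards [hbound, eventually_ge_atTop 1] with n hn hn1
  have hn0 : (0 : ℝ) < n := by exact_mod_cast hn1
  refine (mul_le_mul_of_nonneg_left hn (by positivity)).trans (le_of_eq ?_)
  have e1 : (n : ℝ) ^ (-(r + 2)) = (n : ℝ) ^ (-r) * (n : ℝ) ^ (-(2 : ℝ)) := by
    rw [← Real.rpow_add hn0]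
    congr 1
    ring
  have e2 : (n : ℝ) ^ (-(1 : ℝ)) = n * (n : ℝ) ^ (-(2 : ℝ)) := by
    nth_rw 2 [← Real.rpow_one (n : ℝ)]
    rw [← Real.rpow_add hn0]
    congr 1
    ring
  have e3 : (n : ℝ) ^ r * (n : ℝ) ^ (-r) = 1 := by
    rw [← Real.rpow_add hn0, add_neg_cancel, Real.rpow_zero]
  rw [e1, e2]
  linear_combination (n * M + 1) * (2 * Real.exp 1) * (n : ℝ) ^ (-(2 : ℝ)) * e3

end Deviation

/-! ### Weak convergence of the rescaled grid and of product measures -/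

theorem tendsto_probabilityMeasure_of_tendsto_Iic {μs : ℕ → ProbabilityMeasure ℝ}
    {μ : ProbabilityMeasure ℝ}
    (h : ∀ x, Tendsto (fun n => (μs n : Measure ℝ).real (Iic x)) atTop
      (𝓝 ((μ : Measure ℝ).real (Iic x)))) : Tendsto μs atTop (𝓝 μ) := by
  refine (isPiSystem_Ioc (id : ℝ → ℝ) id).tendsto_probabilityMeasure_of_tendsto_of_mem ?_ ?_ ?_
  · rintro _ ⟨a, b, -, rfl⟩
    exact measurableSet_Ioc
  · intro u hu x hx
    obtain ⟨ε, hε, hsub⟩ := Metric.isOpen_iff.1 hu x hx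
    refine ⟨Ioc (x - ε / 2) (x + ε / 2), ⟨_, _, ?_, rfl⟩,
      Ioc_mem_nhds (by linarith) (by linarith), fun y hy => hsub ?_⟩
    · simp only [id]
      linarith
    · rw [Metric.mem_ball, Real.dist_eq, abs_lt]
      exact ⟨by linarith [hy.1], by linarith [hy.2]⟩
  · rintro _ ⟨a, b, hab, rfl⟩
    have e : ∀ ρ : ProbabilityMeasure ℝ, ((ρ (Ioc a b) : NNReal) : ℝ) =
        (ρ : Measure ℝ).real (Iic b) - (ρ : Measure ℝ).real (Iic a) := fun ρ => by
      have : Ioc a b = Iic b \ Iic a := by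
        ext y
        simp [and_comm]
      rw [← measureReal_sdiff (Iic_subset_Iic.2 (show a ≤ b from le_of_lt hab)) measurableSet_Iic, ← this]
      rfl
    rw [← NNReal.tendsto_coe]
    simp only [id, e]
    exact (h b).sub (h a)

/-- The points `1 / n, …, N / n`. -/
noncomputable def gridPoint (n : ℕ) {N : ℕ} (k : Fin N) : ℝ := ((k : ℕ) + 1 : ℝ) / n

theorem gridPoint_strictMono {n N : ℕ} (hn : 1 ≤ n) :
    StrictMono (gridPoint n : Fin N → ℝ) := fun a b hab => by
  have hn' : (0 : ℝ) < n := by exact_mod_cast hn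
  have : ((a : ℕ) : ℝ) < (b : ℕ) := by exact_mod_cast hab
  unfold gridPoint
  gcongr

theorem gridPoint_mem {n : ℕ} (hn : 1 ≤ n) {M : ℝ} (hM : 0 ≤ M) (k : Fin ⌊(n : ℝ) * M⌋₊) :
    gridPoint n k ∈ Icc 0 M := by
  have hn' : (0 : ℝ) < n := by exact_mod_cast hn
  refine ⟨by unfold gridPoint; positivity, ?_⟩
  rw [gridPoint, div_le_iff₀ hn', mul_comm M]
  have h1 : ((k : ℕ) + 1 : ℝ) ≤ ⌊(n : ℝ) * M⌋₊ := by exact_mod_cast k.2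
  exact h1.trans (Nat.floor_le (by positivity))

theorem tendsto_natFloor_mul_div {M : ℝ} (hM : 0 ≤ M) :
    Tendsto (fun n : ℕ => (⌊(n : ℝ) * M⌋₊ : ℝ) / n) atTop (𝓝 M) := by
  have := (tendsto_nat_floor_mul_div_atTop hM).comp (tendsto_natCast_atTop_atTop (R := ℝ))
  refine this.congr fun n => ?_
  simp [mul_comm]

/-- Increments are numbered from `0`, so the increment with index `k` enters the path at time `(k +
1) / n`. -/
theorem gridPoint_le_iff {n N : ℕ} (hn : 1 ≤ n) (k : Fin N) (x : ℝ) :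
    gridPoint n k ≤ x ↔ (k : ℕ) < ⌊(n : ℝ) * x⌋₊ := by
  have hn' : (0 : ℝ) < n := by exact_mod_cast hn
  rw [gridPoint, div_le_iff₀ hn', ← Nat.succ_le_iff, Nat.le_floor_iff' (Nat.succ_ne_zero _),
    mul_comm]
  push_cast
  rfl

theorem card_filter_gridPoint_le {n N : ℕ} (hn : 1 ≤ n) (x : ℝ) :
    (Finset.univ.filter fun k : Fin N => gridPoint n k ≤ x).card = min N ⌊(n : ℝ) * x⌋₊ := by
  simp_rw [gridPoint_le_iff hn]
  have h2 : (Finset.univ.filter fun k : Fin N => (k : ℕ) < ⌊(n : ℝ) * x⌋₊).card =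
      ((Finset.range N).filter fun k => k < ⌊(n : ℝ) * x⌋₊).card := by
    rw [Finset.card_filter, Finset.card_filter, Finset.sum_range]
  rw [h2, ← Finset.card_range (min N ⌊(n : ℝ) * x⌋₊)]
  congr 1
  ext k
  simp

theorem exists_tendsto_grid {M : ℝ} (hM : 0 < M) :
    ∃ (U : ℕ → ProbabilityMeasure ℝ) (U₀ : ProbabilityMeasure ℝ),
      (∀ n : ℕ, 1 ≤ ⌊(n : ℝ) * M⌋₊ → (U n : Measure ℝ) = (⌊(n : ℝ) * M⌋₊ : ℝ≥0∞)⁻¹ •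
        ∑ k : Fin ⌊(n : ℝ) * M⌋₊, Measure.dirac (gridPoint n k)) ∧
      (U₀ : Measure ℝ) = volume[|Icc 0 M] ∧ Tendsto U atTop (𝓝 U₀) := by
  have hex : ∀ n : ℕ, ∃ U : ProbabilityMeasure ℝ, 1 ≤ ⌊(n : ℝ) * M⌋₊ →
      (U : Measure ℝ) = (⌊(n : ℝ) * M⌋₊ : ℝ≥0∞)⁻¹ •
        ∑ k : Fin ⌊(n : ℝ) * M⌋₊, Measure.dirac (gridPoint n k) := by
    intro n
    by_cases hN : 1 ≤ ⌊(n : ℝ) * M⌋₊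
    · refine ⟨⟨_, ⟨?_⟩⟩, fun _ => rfl⟩
      simp only [Measure.smul_apply, Measure.finsetSum_apply, measure_univ, smul_eq_mul,
        Finset.sum_const, Finset.card_univ, Fintype.card_fin, nsmul_eq_mul, mul_one]
      exact ENNReal.inv_mul_cancel (by exact_mod_cast (by lia)) (ENNReal.natCast_ne_top _)
    · exact ⟨⟨Measure.dirac 0, inferInstance⟩, fun h => absurd h hN⟩
  choose U hU using hex
  have hv : volume (Icc 0 M) = ENNReal.ofReal M := by rw [Real.volume_Icc, sub_zero]
  have hv0 : volume (Icc 0 M) ≠ 0 := by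
    rw [hv]
    exact (ENNReal.ofReal_pos.2 hM).ne'
  have hvt : volume (Icc 0 M) ≠ ∞ := by
    rw [hv]
    exact ENNReal.ofReal_ne_top
  refine ⟨U, ⟨_, cond_isProbabilityMeasure_of_finite hv0 hvt⟩, hU, rfl, ?_⟩
  refine tendsto_probabilityMeasure_of_tendsto_Iic fun x => ?_
  change Tendsto _ _ (𝓝 ((volume[|Icc 0 M]).real (Iic x)))
  have hlim : (volume[|Icc 0 M]).real (Iic x) = min M (max x 0) / M := by
    rw [Measure.real, cond_apply measurableSet_Icc, hv, ENNReal.toReal_mul, ENNReal.toReal_inv,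
      ENNReal.toReal_ofReal hM.le,
      show Icc 0 M ∩ Iic x = Icc 0 (min M x) by ext y; simp [and_assoc], Real.volume_Icc, sub_zero,
      ENNReal.toReal_ofReal', div_eq_inv_mul]
    congr 1
    rcases le_total x 0 with h | h
    · rw [max_eq_right h, min_eq_right (h.trans hM.le), max_eq_right h, min_eq_right hM.le]
    · rw [max_eq_left h, max_eq_left (le_min hM.le h)]
  rw [hlim]
  -- The floor limit needs a nonnegative argument; passing from `x` to `max x 0` does not change the
  -- natural number floor.
  have h1 := (tendsto_natFloor_mul_div hM.le).min
    (tendsto_natFloor_mul_div (le_max_right x 0))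
  refine ((h1.div (tendsto_natFloor_mul_div hM.le) hM.ne')).congr' ?_
  have h2 := (tendsto_natFloor_mul_div hM.le).eventually_const_lt hM
  filter_upwards [h2, eventually_ge_atTop 1] with n hn hn1
  have hn' : (0 : ℝ) < n := by exact_mod_cast hn1
  have hN : 1 ≤ ⌊(n : ℝ) * M⌋₊ := by
    by_contra h
    rw [not_le, Nat.lt_one_iff] at h
    simp [h] at hn
  have hfl : ⌊(n : ℝ) * max x 0⌋₊ = ⌊(n : ℝ) * x⌋₊ := by
    rcases le_total x 0 with h | h
    · rw [max_eq_right h, mul_zero, Nat.floor_zero,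
        Nat.floor_of_nonpos (mul_nonpos_of_nonneg_of_nonpos hn'.le h)]
    · rw [max_eq_left h]
  rw [hU n hN, Measure.real, Measure.smul_apply, Measure.finsetSum_apply]
  simp only [Measure.dirac_apply' _ measurableSet_Iic, indicator_apply, mem_Iic, Pi.one_apply]
  rw [Finset.sum_boole, card_filter_gridPoint_le hn1, smul_eq_mul, ENNReal.toReal_mul,
    ENNReal.toReal_inv, ENNReal.toReal_natCast, ENNReal.toReal_natCast, Pi.div_apply, hfl,
    min_div_div_right hn'.le, div_div_div_cancel_right₀ hn'.ne', div_eq_inv_mul, Nat.cast_min]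

theorem pi_smul_const {j : ℕ} (μ : Measure ℝ) [IsFiniteMeasure μ] {c : ℝ≥0∞} (hc : c ≠ ∞) :
    Measure.pi (fun _ : Fin j => c • μ) = c ^ j • Measure.pi fun _ : Fin j => μ := by
  have : IsFiniteMeasure (c • μ) := Measure.smul_finite μ hc
  refine Measure.pi_eq fun s hs => ?_
  rw [Measure.smul_apply, Measure.pi_pi, smul_eq_mul]
  simp [Finset.prod_mul_distrib]

theorem pi_sum_dirac {j N : ℕ} (x : Fin N → ℝ) :
    Measure.pi (fun _ : Fin j => ∑ k, Measure.dirac (x k)) =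
      ∑ k : Fin j → Fin N, Measure.dirac fun i => x (k i) := by
  refine Measure.pi_eq fun s hs => ?_
  simp only [Measure.finsetSum_apply]
  rw [Finset.prod_univ_sum, Fintype.piFinset_univ]
  refine Finset.sum_congr rfl fun k _ => ?_
  rw [Measure.dirac_apply' _ (MeasurableSet.univ_pi hs)]
  rw [Finset.prod_congr rfl fun i _ => Measure.dirac_apply' _ (hs i)]
  classical
  simp only [indicator_apply, Pi.one_apply, mem_univ_pi]
  rw [Fintype.prod_boole]
  split_ifs <;> rfl

section Grid

variable {j : ℕ}

/-- The sum over all tuples of grid points of the masses of the sections of `B`, under the product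
of the restriction of `μ` to `{z | δ < |z|}`. -/
noncomputable def gridSum (μ : Measure ℝ) (δ : ℝ) (n N : ℕ) (B : Set ((Fin j → ℝ) × (Fin j → ℝ))) :
    ℝ≥0∞ :=
  ∑ k : Fin j → Fin N,
    Measure.pi (fun _ : Fin j => μ.restrict (away δ)) {z | (z, fun i => gridPoint n (k i)) ∈ B}

/-- Total masses are factored out, so that weak convergence of probability measures applies to the
rest. All index tuples occur, also those with repetitions; this is what gives the product structure.
-/
theorem gridSum_eq {μ : Measure ℝ} [IsFiniteMeasure μ] {δ : ℝ} (hμ : μ (away δ) ≠ 0) (n : ℕ)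
    {N : ℕ} (hN : 1 ≤ N) {B : Set ((Fin j → ℝ) × (Fin j → ℝ))} (hB : MeasurableSet B) :
    gridSum μ δ n N B = (N * μ (away δ)) ^ j *
      (Measure.pi fun _ : Fin j => μ[|away δ]).prod (Measure.pi fun _ : Fin j =>
        (N : ℝ≥0∞)⁻¹ • ∑ k : Fin N, Measure.dirac (gridPoint n k)) B := by
  have hN0 : (N : ℝ≥0∞) ≠ 0 := by exact_mod_cast (by lia)
  have hNt : (N : ℝ≥0∞) ≠ ∞ := ENNReal.natCast_ne_top N
  have hμt : μ (away δ) ≠ ∞ := measure_ne_top _ _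
  have hd : IsFiniteMeasure (∑ k : Fin N, Measure.dirac (gridPoint n k)) := inferInstance
  rw [ProbabilityTheory.cond, pi_smul_const _ (ENNReal.inv_ne_top.2 hμ),
    pi_smul_const _ (ENNReal.inv_ne_top.2 hN0), pi_sum_dirac, Measure.prod_smul_left,
    Measure.prod_smul_right, Measure.smul_apply, Measure.smul_apply, smul_eq_mul, smul_eq_mul,
    Measure.prod_apply_symm hB, lintegral_finsetSum_measure]
  simp only [lintegral_dirac]
  have key : (N * μ (away δ)) ^ j * (μ (away δ))⁻¹ ^ j * ((N : ℝ≥0∞)⁻¹) ^ j = 1 := by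
    rw [← mul_pow, ← mul_pow, mul_assoc, mul_assoc, ← mul_assoc (μ (away δ)),
      ENNReal.mul_inv_cancel hμ hμt, one_mul, ENNReal.mul_inv_cancel hN0 hNt, one_pow]
  rw [← mul_assoc, ← mul_assoc, key, one_mul]
  rfl

theorem pi_restrict_away_apply {Ω : Type*} [MeasurableSpace Ω] {P : Measure Ω}
    [IsProbabilityMeasure P] {Z : ℕ → Ω → ℝ} (hmeas : ∀ i, Measurable (Z i))
    (hindep : iIndepFun Z P) (hident : ∀ i, IdentDistrib (Z i) (Z 0) P P) {n : ℕ} (hn : 1 ≤ n)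
    (δ : ℝ) {k : Fin j → ℕ} (hk : Function.Injective k) {B : Set (Fin j → ℝ)}
    (hB : MeasurableSet B) :
    Measure.pi (fun _ : Fin j => (P.map fun ω => Z 0 ω / n).restrict (away δ)) B =
      P {ω | (∀ i, (n : ℝ) * δ < |Z (k i) ω|) ∧ (fun i => Z (k i) ω / n) ∈ B} := by
  have hn' : (0 : ℝ) < n := by exact_mod_cast hn
  have hm : ∀ i, Measurable fun ω => Z i ω / n := fun i => (hmeas i).div_const _
  have hprob : IsProbabilityMeasure (P.map fun ω => Z 0 ω / n) :=
    Measure.isProbabilityMeasure_map (hm 0).aemeasurable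
  have hi : iIndepFun (fun (i : Fin j) ω => Z (k i) ω / n) P :=
    (hindep.precomp hk).comp (fun _ x => x / n) fun _ => measurable_id.div_const _
  have hlaw : P.map (fun ω (i : Fin j) => Z (k i) ω / n) =
      Measure.pi fun _ : Fin j => P.map fun ω => Z 0 ω / n := by
    rw [(iIndepFun_iff_map_fun_eq_pi_map fun i => (hm (k i)).aemeasurable).1 hi]
    congr 1
    funext i
    exact ((hident (k i)).comp (measurable_id.div_const (n : ℝ))).map_eq
  rw [← Measure.restrict_pi_pi, Measure.restrict_apply hB, ← hlaw, Measure.map_apply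
    (measurable_pi_lambda _ fun i => hm (k i))
    (hB.inter (MeasurableSet.univ_pi fun _ => measurableSet_away δ))]
  congr 1
  ext ω
  simp only [mem_preimage, mem_inter_iff, mem_univ_pi, away, mem_ofPred_eq, abs_div, Nat.abs_cast,
    lt_div_iff₀ hn']
  rw [and_comm]
  simp only [mul_comm δ]

theorem prod_cond_eq {α p : ℝ} (hα : 0 < α) (hp₀ : 0 ≤ p) (hp₁ : p ≤ 1) {δ M : ℝ} (hδ : 0 < δ)
    (hM : 0 < M) {B : Set ((Fin j → ℝ) × (Fin j → ℝ))} (hB : MeasurableSet B) :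
    ENNReal.ofReal ((M * δ ^ (-α)) ^ j) * (Measure.pi fun _ : Fin j => (nuAlpha α p)[|away δ]).prod
      (Measure.pi fun _ : Fin j => (volume : Measure ℝ)[|Icc 0 M]) B =
    (Measure.pi fun _ : Fin j => nuAlpha α p).prod volume
      (B ∩ (univ.pi fun _ => away δ) ×ˢ univ.pi fun _ => Icc 0 M) := by
  have hν := nuAlpha_away hα hp₀ hp₁ hδ
  have hv : volume (Icc 0 M) = ENNReal.ofReal M := by rw [Real.volume_Icc, sub_zero]
  have hd0 : 0 < δ ^ (-α) := by positivity
  have hν0 : ENNReal.ofReal (δ ^ (-α)) ≠ 0 := (ENNReal.ofReal_pos.2 hd0).ne'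
  have hM0 : ENNReal.ofReal M ≠ 0 := (ENNReal.ofReal_pos.2 hM).ne'
  have h1 : IsFiniteMeasure ((nuAlpha α p).restrict (away δ)) :=
    ⟨by rw [Measure.restrict_apply_univ, hν]; exact ENNReal.ofReal_lt_top⟩
  have h2 : IsFiniteMeasure ((volume : Measure ℝ).restrict (Icc 0 M)) :=
    ⟨by rw [Measure.restrict_apply_univ, hv]; exact ENNReal.ofReal_lt_top⟩
  rw [ProbabilityTheory.cond, ProbabilityTheory.cond, hν, hv,
    pi_smul_const _ (ENNReal.inv_ne_top.2 hν0), pi_smul_const _ (ENNReal.inv_ne_top.2 hM0),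
    Measure.prod_smul_left, Measure.prod_smul_right, Measure.smul_apply, Measure.smul_apply,
    smul_eq_mul, smul_eq_mul, ← Measure.restrict_pi_pi, ← Measure.restrict_pi_pi, ← volume_pi,
    Measure.prod_restrict, Measure.restrict_apply hB, ENNReal.ofReal_pow (by positivity),
    ENNReal.ofReal_mul hM.le]
  have key : (ENNReal.ofReal M * ENNReal.ofReal (δ ^ (-α))) ^ j *
      ((ENNReal.ofReal (δ ^ (-α)))⁻¹) ^ j * ((ENNReal.ofReal M)⁻¹) ^ j = 1 := by
    rw [← mul_pow, ← mul_pow, mul_assoc, mul_assoc, ← mul_assoc (ENNReal.ofReal (δ ^ (-α))),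
      ENNReal.mul_inv_cancel hν0 ENNReal.ofReal_ne_top, one_mul,
      ENNReal.mul_inv_cancel hM0 ENNReal.ofReal_ne_top, one_pow]
  rw [← mul_assoc, ← mul_assoc, key, one_mul]

end Grid

section GridLimit

variable {Ω : Type*} [MeasurableSpace Ω] {P : Measure Ω} [IsProbabilityMeasure P] {X : Ω → ℝ}
  {α p δ M : ℝ} {j : ℕ}

theorem TailData.tendsto_rate_mul (hT : TailData P X α p) (hX : Measurable X) (hδ : 0 < δ)
    (hM : 0 < M) :
    Tendsto (fun n : ℕ => ENNReal.ofReal (rate P X j n) *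
      (⌊(n : ℝ) * M⌋₊ * P.map (fun ω => X ω / n) (away δ)) ^ j) atTop
      (𝓝 (ENNReal.ofReal ((M * δ ^ (-α)) ^ j))) := by
  have h1 := (((tendsto_natFloor_mul_div hM.le).mul (hT.tail_ratio δ hδ)).pow j)
  refine (ENNReal.tendsto_ofReal h1).congr' ?_
  filter_upwards [eventually_ge_atTop 1] with n hn
  have hn' : (0 : ℝ) < n := by exact_mod_cast hn
  have hTn := hT.tail_pos n
  rw [map_div_apply_away hX hn, ← ofReal_measureReal, ← ENNReal.ofReal_natCast,
    ← ENNReal.ofReal_mul (by positivity), ← ENNReal.ofReal_pow (by positivity),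
    ← ENNReal.ofReal_mul (by unfold rate; positivity)]
  congr 1
  rw [rate, ← inv_pow, ← mul_pow]
  congr 1
  field_simp

/-- The limit law of the rescaled large jumps and their times. -/
theorem TailData.gridSum_limits (hT : TailData P X α p) (hX : Measurable X) (hα : 0 < α)
    (hp₀ : 0 ≤ p) (hp₁ : p ≤ 1) (hδ : 0 < δ) (hM : 0 < M) :
    (∀ C : Set ((Fin j → ℝ) × (Fin j → ℝ)), IsClosed C →
      limsup (fun n : ℕ => ENNReal.ofReal (rate P X j n) *
        gridSum (P.map fun ω => X ω / n) δ n ⌊(n : ℝ) * M⌋₊ C) atTop ≤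
      (Measure.pi fun _ : Fin j => nuAlpha α p).prod volume
        (C ∩ (univ.pi fun _ => away δ) ×ˢ univ.pi fun _ => Icc 0 M)) ∧
    (∀ O : Set ((Fin j → ℝ) × (Fin j → ℝ)), IsOpen O →
      (Measure.pi fun _ : Fin j => nuAlpha α p).prod volume
        (O ∩ (univ.pi fun _ => away δ) ×ˢ univ.pi fun _ => Icc 0 M) ≤
      liminf (fun n : ℕ => ENNReal.ofReal (rate P X j n) *
        gridSum (P.map fun ω => X ω / n) δ n ⌊(n : ℝ) * M⌋₊ O) atTop) := by
  obtain ⟨L, L₀, hL, hL₀, hLlim⟩ := hT.weak δ hδ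
  obtain ⟨U, U₀, hU, hU₀, hUlim⟩ := exists_tendsto_grid hM
  let R : ℕ → ProbabilityMeasure ((Fin j → ℝ) × (Fin j → ℝ)) := fun n =>
    (ProbabilityMeasure.pi fun _ => L n).prod (ProbabilityMeasure.pi fun _ => U n)
  let R₀ : ProbabilityMeasure ((Fin j → ℝ) × (Fin j → ℝ)) :=
    (ProbabilityMeasure.pi fun _ => L₀).prod (ProbabilityMeasure.pi fun _ => U₀)
  have hpi : ∀ {V : ℕ → ProbabilityMeasure ℝ} {V₀ : ProbabilityMeasure ℝ},
      Tendsto V atTop (𝓝 V₀) → Tendsto (fun n => ProbabilityMeasure.pi fun _ : Fin j => V n) atTop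
        (𝓝 (ProbabilityMeasure.pi fun _ : Fin j => V₀)) := fun h =>
    (ProbabilityMeasure.continuous_pi.tendsto _).comp (tendsto_pi_nhds.2 fun _ => h)
  have hR : Tendsto R atTop (𝓝 R₀) :=
    (ProbabilityMeasure.continuous_prod.tendsto _).comp ((hpi hLlim).prodMk_nhds (hpi hUlim))
  have hR₀ : ∀ B : Set ((Fin j → ℝ) × (Fin j → ℝ)), MeasurableSet B →
      ENNReal.ofReal ((M * δ ^ (-α)) ^ j) * (R₀ : Measure _) B =
      (Measure.pi fun _ : Fin j => nuAlpha α p).prod volume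
        (B ∩ (univ.pi fun _ => away δ) ×ˢ univ.pi fun _ => Icc 0 M) := by
    intro B hB
    rw [← prod_cond_eq hα hp₀ hp₁ hδ hM hB, ← hL₀, ← hU₀]
    rfl
  have hRn : ∀ B : Set ((Fin j → ℝ) × (Fin j → ℝ)), MeasurableSet B → ∀ᶠ n : ℕ in atTop,
      ENNReal.ofReal (rate P X j n) *
        gridSum (P.map fun ω => X ω / n) δ n ⌊(n : ℝ) * M⌋₊ B =
      ((fun n : ℕ => ENNReal.ofReal (rate P X j n) *
        (⌊(n : ℝ) * M⌋₊ * P.map (fun ω => X ω / n) (away δ)) ^ j) *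
        fun n => (R n : Measure _) B) n := by
    intro B hB
    filter_upwards [eventually_ge_atTop 1,
      (tendsto_natFloor_mul_div hM.le).eventually_const_lt hM] with n hn hnM
    have hN : 1 ≤ ⌊(n : ℝ) * M⌋₊ := by
      by_contra h
      rw [not_le, Nat.lt_one_iff] at h
      simp [h] at hnM
    have hprob : IsProbabilityMeasure (P.map fun ω => X ω / n) :=
      Measure.isProbabilityMeasure_map (hX.div_const _).aemeasurable
    have h0 : P.map (fun ω => X ω / n) (away δ) ≠ 0 := by
      rw [map_div_apply_away hX hn]
      intro h
      have := hT.tail_pos (n * δ)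
      rw [Measure.real, h] at this
      simp at this
    rw [gridSum_eq h0 n hN hB, ← hL n hn, ← hU n hN, ← mul_assoc]
    rfl
  have hrate := hT.tendsto_rate_mul (j := j) hX hδ hM
  have hc0 : ENNReal.ofReal ((M * δ ^ (-α)) ^ j) ≠ 0 :=
    (ENNReal.ofReal_pos.2 (by positivity)).ne'
  refine ⟨fun C hC => ?_, fun O hO => ?_⟩
  · rw [limsup_congr (hRn C hC.measurableSet), ← hR₀ C hC.measurableSet]
    refine (ENNReal.limsup_mul_le' ?_ ?_).trans ?_
    · rw [hrate.limsup_eq]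
      exact Or.inl hc0
    · rw [hrate.limsup_eq]
      exact Or.inl ENNReal.ofReal_ne_top
    · rw [hrate.limsup_eq]
      gcongr
      exact ProbabilityMeasure.limsup_measure_closed_le_of_tendsto hR hC
  · rw [liminf_congr (hRn O hO.measurableSet), ← hR₀ O hO.measurableSet]
    refine le_trans ?_ ENNReal.le_liminf_mul
    rw [hrate.liminf_eq]
    gcongr
    exact ProbabilityMeasure.le_liminf_measure_open_of_tendsto hR hO

end GridLimit

/-! ### Null sets of jump times and the limit measure -/

section Limit

variable {M m α p : ℝ} {j : ℕ}

/-- These tuples lie in finitely many hyperplanes. Weak monotonicity is kept because the upper bound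
works with a closed set of times. -/
theorem volume_not_interiorTimes :
    volume {u : Fin j → ℝ | Monotone u ∧ (∀ i, u i ∈ Icc 0 M) ∧ u ∉ interiorTimes M j} = 0 := by
  have hsub : {u : Fin j → ℝ | Monotone u ∧ (∀ i, u i ∈ Icc 0 M) ∧ u ∉ interiorTimes M j} ⊆
      (⋃ i, ⋃ l, ⋃ _ : i ≠ l, {u : Fin j → ℝ | u i = u l}) ∪
        ((⋃ i, {u | u i = 0}) ∪ ⋃ i, {u | u i = M}) := by
    rintro u ⟨hmono, hmem, hnot⟩
    by_contra hcon
    simp only [mem_union, mem_iUnion, mem_ofPred_eq, not_or, not_exists] at hcon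
    obtain ⟨h1, h2, h3⟩ := hcon
    refine hnot ⟨hmono.strictMono_of_injective fun i l h => ?_, fun i => ?_⟩
    · by_contra hne
      exact h1 i l hne h
    · exact ⟨lt_of_le_of_ne (hmem i).1 (Ne.symm (h2 i)), lt_of_le_of_ne (hmem i).2 (h3 i)⟩
  refine measure_mono_null hsub (measure_union_null (measure_iUnion_null fun i =>
    measure_iUnion_null fun l => measure_iUnion_null fun hil => ?_)
    (measure_union_null (measure_iUnion_null fun i => ?_) (measure_iUnion_null fun i => ?_)))
  · set φ : (Fin j → ℝ) →ₗ[ℝ] ℝ :=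
      LinearMap.proj (R := ℝ) (φ := fun _ => ℝ) i - LinearMap.proj (R := ℝ) (φ := fun _ => ℝ) l
    with hφ
    have hker : {u : Fin j → ℝ | u i = u l} = (LinearMap.ker φ : Set (Fin j → ℝ)) := by
      ext u
      simp [hφ, sub_eq_zero]
    rw [hker]
    refine Measure.addHaar_submodule volume _ fun htop => ?_
    have h1 : Pi.single i (1 : ℝ) ∈ LinearMap.ker φ := by rw [htop]; trivial
    simp [hφ, hil] at h1
  · exact Measure.pi_hyperplane (fun _ => (volume : Measure ℝ)) i 0
  · exact Measure.pi_hyperplane (fun _ => (volume : Measure ℝ)) i M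

theorem prod_volume_null (μ : Measure (Fin j → ℝ)) :
    μ.prod volume {q : (Fin j → ℝ) × (Fin j → ℝ) |
      Monotone q.2 ∧ (∀ i, q.2 i ∈ Icc 0 M) ∧ q.2 ∉ interiorTimes M j} = 0 := by
  have : {q : (Fin j → ℝ) × (Fin j → ℝ) |
      Monotone q.2 ∧ (∀ i, q.2 i ∈ Icc 0 M) ∧ q.2 ∉ interiorTimes M j} ⊆
      univ ×ˢ {u | Monotone u ∧ (∀ i, u i ∈ Icc 0 M) ∧ u ∉ interiorTimes M j} :=
    fun q hq => ⟨trivial, hq⟩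
  refine measure_mono_null this ?_
  rw [Measure.prod_prod, volume_not_interiorTimes, mul_zero]

/-- Needed because `Measure.map` along a map that is not a.e. measurable is `0` by convention.
Continuity on the open set of interior times suffices, as the rest of the domain is null. -/
theorem aemeasurable_stepDrift (hM : 0 < M) (μ : Measure (Fin j → ℝ)) :
    AEMeasurable (stepDrift M m j) ((μ.prod volume).restrict (jumpDomain M j)) := by
  have hopen : IsOpen {q : (Fin j → ℝ) × (Fin j → ℝ) | q.2 ∈ interiorTimes M j} :=
    isOpen_interiorTimes.preimage continuous_snd
  have hc : ContinuousOn (stepDrift M m j) {q | q.2 ∈ interiorTimes M j} := fun q hq =>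
    (continuousAt_stepDrift hM hq).continuousWithinAt
  refine (hc.aemeasurable hopen.measurableSet (μ := μ.prod volume)).mono_measure
    (Measure.restrict_mono_ae ?_)
  rw [ae_le_set]
  refine measure_mono_null ?_ (prod_volume_null (M := M) μ)
  rintro q ⟨hq, hq'⟩
  exact ⟨hq.2.1.monotone, hq.2.2, hq'⟩

theorem limitMeasure_apply (hM : 0 < M) {A : Set (SkorohodSpace M)} (hA : MeasurableSet A) :
    limitMeasure M m α p j A = (Measure.pi fun _ : Fin j => nuAlpha α p).prod volume
      (stepDrift M m j ⁻¹' A ∩ jumpDomain M j) := by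
  rw [limitMeasure, Measure.map_apply_of_aemeasurable (aemeasurable_stepDrift hM _) hA,
    Measure.restrict_apply' measurableSet_jumpDomain]

theorem exists_ofReal_le_edist {S : Type*} [PseudoEMetricSpace S] {A C : Set S}
    (h : Metric.AreSeparated A C) :
    ∃ r : ℝ, 0 < r ∧ ∀ x ∈ A, ∀ y ∈ C, ENNReal.ofReal r ≤ edist x y := by
  obtain ⟨r, hr0, hr⟩ := h
  have ht : min r 1 ≠ ∞ := ne_top_of_le_ne_top ENNReal.one_ne_top (min_le_right _ _)
  refine ⟨(min r 1).toReal, ENNReal.toReal_pos (by simp [hr0]) ht, fun x hx y hy => ?_⟩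
  rw [ENNReal.ofReal_toReal ht]
  exact (min_le_left _ _).trans (hr x hx y hy)

theorem finiteAwayFrom_limitMeasure (hM : 0 < M) (hα : 0 < α) (hp₀ : 0 ≤ p) (hp₁ : p ≤ 1) :
    FiniteAwayFrom (stepLE M m j) (limitMeasure M m α p (j + 1)) := by
  intro A hA hsep
  obtain ⟨r, hr, hrA⟩ := exists_ofReal_le_edist hsep
  have hsub : stepDrift M m (j + 1) ⁻¹' A ∩ jumpDomain M (j + 1) ⊆
      (univ.pi fun _ => away (r / 2)) ×ˢ univ.pi fun _ => Icc 0 M := by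
    rintro q ⟨hq, hqd⟩
    refine ⟨fun i _ => ?_, fun i _ => hqd.2.2 i⟩
    have := le_abs_of_separated hrA hqd hq i
    change r / 2 < |q.1 i|
    linarith
  rw [limitMeasure_apply hM hA]
  refine (measure_mono hsub).trans_lt ?_
  rw [Measure.prod_prod, Measure.pi_pi, volume_pi, Measure.pi_pi]
  refine ENNReal.mul_lt_top (ENNReal.prod_lt_top fun i _ => ?_)
    (ENNReal.prod_lt_top fun i _ => ?_)
  · rw [nuAlpha_away hα hp₀ hp₁ (by positivity)]
    exact ENNReal.ofReal_lt_top
  · rw [Real.volume_Icc]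
    exact ENNReal.ofReal_lt_top

theorem isOpen_interior_stepDrift (hM : 0 < M) {V : Set (SkorohodSpace M)} (hV : IsOpen V) :
    IsOpen {q : (Fin j → ℝ) × (Fin j → ℝ) | q.2 ∈ interiorTimes M j ∧ stepDrift M m j q ∈ V} := by
  refine isOpen_iff_mem_nhds.2 fun q hq => ?_
  have h1 : ∀ᶠ q' : (Fin j → ℝ) × (Fin j → ℝ) in 𝓝 q, q'.2 ∈ interiorTimes M j :=
    (isOpen_interiorTimes.preimage continuous_snd).mem_nhds hq.1
  have h2 : ∀ᶠ q' in 𝓝 q, stepDrift M m j q' ∈ V :=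
    (continuousAt_stepDrift hM hq.1).eventually_mem (hV.mem_nhds hq.2)
  exact h1.and h2

end Limit

/-! ### Approximation of the walk by its large jumps -/

section Path

variable {M m δ ε : ℝ} {n i : ℕ} {z : ℕ → ℝ}

/-- The rescaled jumps of `z` at the indices `k`, and the times at which they occur. -/
noncomputable def jumpData (n : ℕ) {N i : ℕ} (z : ℕ → ℝ) (k : Fin i → Fin N) :
    (Fin i → ℝ) × (Fin i → ℝ) :=
  (fun a => z (k a) / n, fun a => gridPoint n (k a))

theorem jumpData_mem_jumpDomain (hn : 1 ≤ n) (hM : 0 ≤ M) (hδ : 0 ≤ δ)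
    {k : Fin i → Fin ⌊(n : ℝ) * M⌋₊} (hk : StrictMono k) (hbig : ∀ a, n * δ < |z (k a)|) :
    jumpData n z k ∈ jumpDomain M i := by
  have hn' : (0 : ℝ) < n := by exact_mod_cast hn
  refine ⟨fun a => ?_, (gridPoint_strictMono hn).comp hk, fun a => gridPoint_mem hn hM _⟩
  have : 0 < |z (k a)| := lt_of_le_of_lt (by positivity) (hbig a)
  exact div_ne_zero (abs_pos.1 this) hn'.ne'

/-- No time change is needed, since large increments and jumps occur at the same times. One `ε`
bounds the truncated walk minus its drift at `⌊n * t⌋₊`; the other covers the drift between `⌊n *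
t⌋₊` and `n * t`, at most `|m| / n`. -/
theorem edist_walkPath_le (hn : 1 ≤ n) (hε : 0 ≤ ε)
    {k : Fin i → Fin ⌊(n : ℝ) * M⌋₊} (hk : StrictMono k)
    (hbig : ∀ l : Fin ⌊(n : ℝ) * M⌋₊, n * δ < |z l| ↔ ∃ a, k a = l)
    (hdev : ∀ l ≤ ⌊(n : ℝ) * M⌋₊,
      |∑ i ∈ Finset.range l, trunc (n * δ) (z i) - l * m| < n * ε) (hm : |m| ≤ n * ε) :
    edist (walkPath M n z) (stepDrift M m i (jumpData n z k)) ≤ ENNReal.ofReal (2 * ε) := by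
  have hn' : (0 : ℝ) < n := by exact_mod_cast hn
  refine edist_skorohod_le (by positivity) fun t => ?_
  set K := ⌊(n : ℝ) * t⌋₊ with hK
  have ht0 : (0 : ℝ) ≤ t := t.2.1
  have hKN : K ≤ ⌊(n : ℝ) * M⌋₊ := Nat.floor_mono (by gcongr; exact t.2.2)
  have hsum : ∑ l ∈ Finset.range K, z l - ∑ l ∈ Finset.range K, trunc (n * δ) (z l) =
      ∑ a, if gridPoint n (k a) ≤ (t : ℝ) then z (k a) else 0 := by
    simp only [gridPoint_le_iff hn]
    rw [← Finset.sum_sub_distrib, ← Finset.sum_filter]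
    have h1 : ∀ l ∈ Finset.range K, z l - trunc (n * δ) (z l) =
        if n * δ < |z l| then z l else 0 := fun l _ => by
      by_cases h : n * δ < |z l|
      · simp [trunc, h]
      · simp [trunc, h, not_lt.1 h]
    rw [Finset.sum_congr rfl h1, ← Finset.sum_filter]
    symm
    refine Finset.sum_bij (fun a _ => (k a : ℕ)) ?_ ?_ ?_ (fun _ _ => rfl)
    · intro a ha
      simp only [Finset.mem_filter, Finset.mem_univ, true_and, Finset.mem_range] at ha ⊢
      exact ⟨ha, (hbig (k a)).2 ⟨a, rfl⟩⟩
    · intro a _ b _ hab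
      exact hk.injective (Fin.ext hab)
    · intro l hl
      simp only [Finset.mem_filter, Finset.mem_range] at hl
      obtain ⟨a, ha⟩ := (hbig ⟨l, hl.1.trans_le hKN⟩).1 hl.2
      have ha' : (k a : ℕ) = l := by rw [ha]
      refine ⟨a, ?_, ha'⟩
      simp only [Finset.mem_filter, Finset.mem_univ, true_and, ha']
      exact hl.1
  have hstep : (stepDrift M m i (jumpData n z k)).toFun t =
      (∑ l ∈ Finset.range K, z l - ∑ l ∈ Finset.range K, trunc (n * δ) (z l)) / n + m * t := by
    have h1 : (stepDrift M m i (jumpData n z k)).toFun t =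
        (∑ a, if gridPoint n (k a) ≤ (t : ℝ) then z (k a) / n else 0) + m * t := rfl
    rw [h1, hsum, Finset.sum_div]
    congr 1
    refine Finset.sum_congr rfl fun a _ => ?_
    split_ifs <;> simp
  have hwalk : (walkPath M n z).toFun t = (∑ l ∈ Finset.range K, z l) / n := rfl
  have e : (walkPath M n z).toFun t - (stepDrift M m i (jumpData n z k)).toFun t =
      ((∑ l ∈ Finset.range K, trunc (n * δ) (z l) - K * m) + m * (K - n * t)) / n := by
    rw [hwalk, hstep]
    field_simp
    ring
  rw [e, abs_div, Nat.abs_cast, div_le_iff₀ hn']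
  refine (abs_add_le _ _).trans ?_
  have h1 := (hdev K hKN).le
  have h2 : |m * (K - n * t)| ≤ |m| := by
    rw [abs_mul]
    refine mul_le_of_le_one_right (abs_nonneg _) (abs_le.2 ⟨?_, ?_⟩)
    · linarith [Nat.lt_floor_add_one ((n : ℝ) * t)]
    · linarith [Nat.floor_le (mul_nonneg hn'.le ht0)]
  linarith

theorem not_mem_truncDeviation {Ω : Type*} {Z : ℕ → Ω → ℝ} {ω : Ω}
    (h : ω ∉ truncDeviation Z M m δ ε n) :
    ∀ l ≤ ⌊(n : ℝ) * M⌋₊,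
      |∑ i ∈ Finset.range l, trunc (n * δ) (Z i ω) - l * m| < n * ε := fun l hl => by
  by_contra hcon
  exact h ⟨l, hl, not_lt.1 hcon⟩

end Path

/-! ### Probability estimates -/

section Estimates

variable {Ω : Type*} [MeasurableSpace Ω] {P : Measure Ω} [IsProbabilityMeasure P]
  {Z : ℕ → Ω → ℝ} {M m δ ε : ℝ} {n j : ℕ}

theorem measure_forall_large (hmeas : ∀ i, Measurable (Z i))
    (hindep : iIndepFun Z P) (hident : ∀ i, IdentDistrib (Z i) (Z 0) P P) (hn : 1 ≤ n)
    (δ : ℝ) {k : Fin j → ℕ} (hk : Function.Injective k) :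
    P {ω | ∀ i, (n : ℝ) * δ < |Z (k i) ω|} = (P.map fun ω => Z 0 ω / n) (away δ) ^ j := by
  have hprob : IsProbabilityMeasure (P.map fun ω => Z 0 ω / n) :=
    Measure.isProbabilityMeasure_map ((hmeas 0).div_const _).aemeasurable
  have h := pi_restrict_away_apply hmeas hindep hident hn δ hk MeasurableSet.univ
  simp only [mem_univ, and_true] at h
  rw [← h, Measure.pi_univ]
  simp

/-- The event that the jumps with indices `k` are large, and lie in `B` with their times. -/
def largeJumps (Z : ℕ → Ω → ℝ) (δ : ℝ) (n : ℕ) {N : ℕ} (k : Fin j → Fin N)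
    (B : Set ((Fin j → ℝ) × (Fin j → ℝ))) : Set Ω :=
  {ω | (∀ i, (n : ℝ) * δ < |Z (k i) ω|) ∧ jumpData n (fun l => Z l ω) k ∈ B}

theorem measure_largeJumps (hmeas : ∀ i, Measurable (Z i))
    (hindep : iIndepFun Z P) (hident : ∀ i, IdentDistrib (Z i) (Z 0) P P) (hn : 1 ≤ n)
    (δ : ℝ) {N : ℕ} {k : Fin j → Fin N} (hk : Function.Injective k)
    {B : Set ((Fin j → ℝ) × (Fin j → ℝ))} (hB : MeasurableSet B) :
    P (largeJumps Z δ n k B) =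
      Measure.pi (fun _ : Fin j => (P.map fun ω => Z 0 ω / n).restrict (away δ))
        {z | (z, fun i => gridPoint n (k i)) ∈ B} := by
  have hB' : MeasurableSet {z : Fin j → ℝ | (z, fun i => gridPoint n (k i)) ∈ B} :=
    hB.preimage (measurable_id.prodMk measurable_const)
  exact (pi_restrict_away_apply hmeas hindep hident hn δ (k := fun i => (k i : ℕ))
    (fun _ _ h => hk (Fin.ext h)) hB').symm

theorem measurableSet_largeJumps (hmeas : ∀ i, Measurable (Z i)) {N : ℕ} (k : Fin j → Fin N)
    {B : Set ((Fin j → ℝ) × (Fin j → ℝ))} (hB : MeasurableSet B) :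
    MeasurableSet (largeJumps Z δ n k B) := by
  have h1 : Measurable fun ω => jumpData n (fun l => Z l ω) k :=
    (measurable_pi_lambda _ fun i => (hmeas (k i)).div_const _).prodMk measurable_const
  have h2 : MeasurableSet (⋂ i, {ω | (n : ℝ) * δ < |Z (k i) ω|}) :=
    MeasurableSet.iInter fun i =>
      measurableSet_lt measurable_const (continuous_abs.measurable.comp (hmeas (k i)))
  have h3 : largeJumps Z δ n k B = (⋂ i, {ω | (n : ℝ) * δ < |Z (k i) ω|}) ∩
      (fun ω => jumpData n (fun l => Z l ω) k) ⁻¹' B := by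
    ext ω
    simp [largeJumps]
  rw [h3]
  exact h2.inter (hB.preimage h1)

theorem measure_walkPath_le (hmeas : ∀ i, Measurable (Z i))
    (hindep : iIndepFun Z P) (hident : ∀ i, IdentDistrib (Z i) (Z 0) P P) (hn : 1 ≤ n)
    (hM : 0 ≤ M) (hδ : 0 ≤ δ) (hε : 0 ≤ ε) (hm : |m| ≤ n * ε) {r : ℝ} (hεr : 2 * ε < r)
    {F : Set (SkorohodSpace M)}
    (hF : ∀ x ∈ F, ∀ y ∈ stepLE M m j, ENNReal.ofReal r ≤ edist x y)
    {C : Set ((Fin (j + 1) → ℝ) × (Fin (j + 1) → ℝ))} (hC : MeasurableSet C)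
    (hFC : ∀ q ∈ jumpDomain M (j + 1),
      stepDrift M m (j + 1) q ∈ Metric.cthickening (2 * ε) F → q ∈ C) :
    P {ω | walkPath M n (fun l => Z l ω) ∈ F} ≤
      gridSum (P.map fun ω => Z 0 ω / n) δ n ⌊(n : ℝ) * M⌋₊ C +
        (P (truncDeviation Z M m δ ε n) +
          (⌊(n : ℝ) * M⌋₊ * (P.map fun ω => Z 0 ω / n) (away δ)) ^ (j + 2)) := by
  classical
  set N := ⌊(n : ℝ) * M⌋₊ with hN
  let I₁ : Finset (Fin (j + 1) → Fin N) := Finset.univ.filter fun k => StrictMono k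
  let I₂ : Finset (Fin (j + 2) → Fin N) := Finset.univ.filter fun k => StrictMono k
  have hsub : {ω | walkPath M n (fun l => Z l ω) ∈ F} ⊆
      (⋃ k ∈ I₁, largeJumps Z δ n k C) ∪ (truncDeviation Z M m δ ε n ∪
        ⋃ k ∈ I₂, {ω | ∀ i, (n : ℝ) * δ < |Z (k i) ω|}) := by
    intro ω hω
    by_cases hdev : ω ∈ truncDeviation Z M m δ ε n
    · exact Or.inr (Or.inl hdev)
    let S : Finset (Fin N) := Finset.univ.filter fun l => (n : ℝ) * δ < |Z l ω|
    have hS : ∀ l : Fin N, l ∈ S ↔ (n : ℝ) * δ < |Z l ω| := fun l => by simp [S]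
    obtain ⟨i, hi⟩ : ∃ i, S.card = i := ⟨_, rfl⟩
    -- Three cases for the number `i` of large increments: more than `j + 1` yields a large `(j +
    -- 2)`-tuple; fewer puts the path within `2 * ε < r` of `stepLE M m j`, a contradiction; exactly
    -- `j + 1` gives data in `C`.
    rcases lt_or_ge (j + 1) i with hlt | hle
    · right
      right
      have hle : j + 2 ≤ S.card := by lia
      let k := S.orderEmbOfCardLe hle
      refine mem_biUnion (x := (k : Fin (j + 2) → Fin N)) ?_ fun a => ?_
      · simp only [I₂, Finset.coe_filter, Finset.mem_univ, true_and]
        exact k.strictMono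
      · exact (hS _).1 (S.orderEmbOfCardLe_mem hle a)
    · let k := S.orderEmbOfFin hi
      have hk : StrictMono k := k.strictMono
      have hkbig : ∀ a, (n : ℝ) * δ < |Z (k a) ω| := fun a =>
        (hS _).1 (S.orderEmbOfFin_mem hi a)
      have hbig : ∀ l : Fin N, (n : ℝ) * δ < |Z l ω| ↔ ∃ a, k a = l := fun l => by
        rw [← hS, ← Finset.mem_coe, ← S.range_orderEmbOfFin hi]
        rfl
      have hclose := edist_walkPath_le (z := fun l => Z l ω) hn hε hk hbig
        (not_mem_truncDeviation hdev) hm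
      have hdom := jumpData_mem_jumpDomain (z := fun l => Z l ω) hn hM hδ hk hkbig
      rcases lt_or_eq_of_le hle with hlt | heq
      · exfalso
        have h1 := hF _ hω _ (stepEq_subset_stepLE (Nat.lt_succ_iff.1 hlt) ⟨_, hdom, rfl⟩)
        have h2 := (ENNReal.ofReal_le_ofReal_iff (by positivity)).1 (h1.trans hclose)
        linarith
      · subst heq
        left
        refine mem_biUnion (x := (k : Fin (j + 1) → Fin N)) ?_ ⟨hkbig, hFC _ hdom ?_⟩
        · simp only [I₁, Finset.coe_filter, Finset.mem_univ, true_and]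
          exact hk
        · rw [edist_comm] at hclose
          exact Metric.mem_cthickening_of_edist_le _ _ _ _ hω hclose
  refine (measure_mono hsub).trans ((measure_union_le _ _).trans (add_le_add ?_
    ((measure_union_le _ _).trans (add_le_add le_rfl ?_))))
  · refine (measure_biUnion_finset_le _ _).trans ?_
    refine le_trans (le_of_eq (Finset.sum_congr rfl fun k hk => ?_))
      (Finset.sum_le_sum_of_subset (Finset.subset_univ I₁))
    exact measure_largeJumps hmeas hindep hident hn δ
      (Finset.mem_filter.1 hk).2.injective hC
  · refine (measure_biUnion_finset_le _ _).trans ?_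
    rw [Finset.sum_congr rfl fun k hk => measure_forall_large hmeas hindep hident hn δ
      (k := fun i => (k i : ℕ))
      (fun _ _ h => (Finset.mem_filter.1 hk).2.injective (Fin.ext h)), Finset.sum_const,
      nsmul_eq_mul, mul_pow]
    gcongr
    have := Finset.card_le_univ I₂
    rw [Fintype.card_fun, Fintype.card_fin, Fintype.card_fin] at this
    exact_mod_cast this

theorem gridSum_le_measure_walkPath (hmeas : ∀ i, Measurable (Z i))
    (hindep : iIndepFun Z P) (hident : ∀ i, IdentDistrib (Z i) (Z 0) P P) (hn : 1 ≤ n)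
    (hε : 0 ≤ ε) (hm : |m| ≤ n * ε) {G : Set (SkorohodSpace M)}
    {O : Set ((Fin j → ℝ) × (Fin j → ℝ))} (hO : MeasurableSet O)
    (hO₁ : ∀ q ∈ O, StrictMono q.2)
    (hO₂ : ∀ q ∈ O, stepDrift M m j q ∉ Metric.cthickening (2 * ε) Gᶜ) :
    gridSum (P.map fun ω => Z 0 ω / n) δ n ⌊(n : ℝ) * M⌋₊ O ≤
      P {ω | walkPath M n (fun l => Z l ω) ∈ G} +
        (P (truncDeviation Z M m δ ε n) +
          (⌊(n : ℝ) * M⌋₊ * (P.map fun ω => Z 0 ω / n) (away δ)) ^ (j + 1)) := by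
  classical
  set N := ⌊(n : ℝ) * M⌋₊ with hN
  set t : ℝ≥0∞ := (P.map fun ω => Z 0 ω / n) (away δ) with ht
  let I : Finset (Fin j → Fin N) := Finset.univ.filter fun k => StrictMono k
  -- Requiring that no other increment be large makes the events disjoint for increasing tuples, as
  -- `k` then enumerates the large indices. The loss is a `(j + 1)`-tuple of large increments.
  let A : (Fin j → Fin N) → Set Ω := fun k =>
    largeJumps Z δ n k O ∩ ⋂ l : Fin N, {ω | (n : ℝ) * δ < |Z l ω| → ∃ a, k a = l}
  have hA : ∀ k, MeasurableSet (A k) := fun k => by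
    refine (measurableSet_largeJumps hmeas k hO).inter (MeasurableSet.iInter fun l => ?_)
    by_cases hl : ∃ a, k a = l
    · simp [hl]
    · simp only [hl, imp_false, not_lt]
      exact measurableSet_le (continuous_abs.measurable.comp (hmeas l)) measurable_const
  have hgrid : gridSum (P.map fun ω => Z 0 ω / n) δ n N O =
      ∑ k ∈ I, P (largeJumps Z δ n k O) := by
    rw [gridSum, Finset.sum_congr rfl fun k hk => measure_largeJumps hmeas hindep hident hn δ
      (Finset.mem_filter.1 hk).2.injective hO]
    symm
    refine Finset.sum_subset (Finset.subset_univ I) fun k _ hk => ?_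
    -- Only strictly increasing tuples contribute, because `O` forces strictly increasing times.
    have hempty : {z : Fin j → ℝ | (z, fun i => gridPoint n (k i)) ∈ O} = ∅ := by
      refine eq_empty_of_forall_notMem fun z hz => hk ?_
      refine Finset.mem_filter.2 ⟨Finset.mem_univ _, fun a b hab => ?_⟩
      exact (gridPoint_strictMono hn).lt_iff_lt.1 (hO₁ _ hz hab)
    rw [hempty, measure_empty]
  have hone : ∀ k ∈ I, P (largeJumps Z δ n k O) ≤ P (A k) + N * t ^ (j + 1) := by
    intro k hk
    have hinj : Function.Injective k := (Finset.mem_filter.1 hk).2.injective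
    let J : Finset (Fin N) := Finset.univ.filter fun l => l ∉ range k
    have hsub : largeJumps Z δ n k O ⊆ A k ∪ ⋃ l ∈ J,
        {ω | ∀ i, (n : ℝ) * δ < |Z ((Fin.cons l k : Fin (j + 1) → Fin N) i) ω|} := by
      intro ω hω
      by_cases h : ∀ l : Fin N, (n : ℝ) * δ < |Z l ω| → ∃ a, k a = l
      · exact Or.inl ⟨hω, mem_iInter.2 h⟩
      · push Not at h
        obtain ⟨l, hl, hne⟩ := h
        refine Or.inr (mem_biUnion (x := l) ?_ ?_)
        · simp only [J, Finset.coe_filter, Finset.mem_univ, true_and]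
          rintro ⟨a, ha⟩
          exact hne a ha
        · exact Fin.cases hl hω.1
    refine (measure_mono hsub).trans ((measure_union_le _ _).trans (add_le_add le_rfl ?_))
    refine (measure_biUnion_finset_le _ _).trans ?_
    rw [Finset.sum_congr rfl fun l hl => measure_forall_large hmeas hindep hident hn δ
      (k := fun i => ((Fin.cons l k : Fin (j + 1) → Fin N) i : ℕ)) (fun _ _ h =>
        Fin.cons_injective_iff.2 ⟨(Finset.mem_filter.1 hl).2, hinj⟩ (Fin.ext h)),
      Finset.sum_const, nsmul_eq_mul]
    have hcard : J.card ≤ N := by simpa using Finset.card_le_univ J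
    gcongr
  have hdisj : (I : Set (Fin j → Fin N)).PairwiseDisjoint A := by
    intro k hk k' hk' hne
    refine Set.disjoint_left.2 fun ω hω hω' => hne ?_
    have hkm : StrictMono k := (Finset.mem_filter.1 hk).2
    have hkm' : StrictMono k' := (Finset.mem_filter.1 hk').2
    refine (hkm.range_inj hkm').1 (Subset.antisymm ?_ ?_)
    · rintro _ ⟨a, rfl⟩
      exact mem_iInter.1 hω'.2 (k a) (hω.1.1 a)
    · rintro _ ⟨a, rfl⟩
      exact mem_iInter.1 hω.2 (k' a) (hω'.1.1 a)
  have hunion : (⋃ k ∈ I, A k) ⊆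
      {ω | walkPath M n (fun l => Z l ω) ∈ G} ∪ truncDeviation Z M m δ ε n := by
    intro ω hω
    by_cases hdev : ω ∈ truncDeviation Z M m δ ε n
    · exact Or.inr hdev
    simp only [mem_iUnion] at hω
    obtain ⟨k, hk, hkA⟩ := hω
    have hbig : ∀ l : Fin N, (n : ℝ) * δ < |Z l ω| ↔ ∃ a, k a = l := fun l =>
      ⟨mem_iInter.1 hkA.2 l, by rintro ⟨a, rfl⟩; exact hkA.1.1 a⟩
    have hclose := edist_walkPath_le (z := fun l => Z l ω) hn hε (Finset.mem_filter.1 hk).2 hbig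
      (not_mem_truncDeviation hdev) hm
    left
    by_contra hG
    rw [edist_comm] at hclose
    exact hO₂ _ hkA.1.2 (Metric.mem_cthickening_of_edist_le _ _ _ _ hG hclose)
  have hsum : ∑ k ∈ I, P (A k) ≤ P {ω | walkPath M n (fun l => Z l ω) ∈ G} +
      P (truncDeviation Z M m δ ε n) := by
    rw [← measure_biUnion_finset hdisj fun k _ => hA k]
    exact (measure_mono hunion).trans (measure_union_le _ _)
  rw [hgrid, ← add_assoc]
  refine (Finset.sum_le_sum hone).trans ?_
  rw [Finset.sum_add_distrib, Finset.sum_const, nsmul_eq_mul]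
  refine add_le_add hsum ?_
  rw [mul_pow, pow_succ (N : ℝ≥0∞), mul_assoc]
  gcongr
  have := Finset.card_le_univ I
  rw [Fintype.card_fun, Fintype.card_fin, Fintype.card_fin] at this
  exact_mod_cast this

end Estimates

/-! ### Negligible terms -/

section Negligible

variable {Ω : Type*} [MeasurableSpace Ω] {P : Measure Ω} [IsProbabilityMeasure P]
  {Z : ℕ → Ω → ℝ} {α p M m δ ε : ℝ} {j : ℕ}

theorem TailData.tendsto_rate_mul_pow_succ {X : Ω → ℝ} (hT : TailData P X α p) (hX : Measurable X)
    (hα : 1 < α) (hδ : 0 < δ) (hM : 0 < M) :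
    Tendsto (fun n : ℕ => ENNReal.ofReal (rate P X j n) *
      (⌊(n : ℝ) * M⌋₊ * P.map (fun ω => X ω / n) (away δ)) ^ (j + 1)) atTop (𝓝 0) := by
  have h1 : Tendsto (fun n : ℕ => ⌊(n : ℝ) * M⌋₊ * P.map (fun ω => X ω / n) (away δ)) atTop
      (𝓝 0) := by
    have h2 := ((tendsto_natFloor_mul_div hM.le).mul (hT.tail_ratio δ hδ)).mul
      (hT.tendsto_mul_tail hα)
    rw [mul_zero] at h2
    have h3 := ENNReal.tendsto_ofReal h2
    rw [ENNReal.ofReal_zero] at h3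
    refine h3.congr' ?_
    filter_upwards [eventually_ge_atTop 1] with n hn
    have hn' : (0 : ℝ) < n := by exact_mod_cast hn
    have hTn := hT.tail_pos n
    rw [map_div_apply_away hX hn, ← ofReal_measureReal, ← ENNReal.ofReal_natCast,
      ← ENNReal.ofReal_mul (by positivity)]
    congr 1
    field_simp
  have h4 := ENNReal.Tendsto.mul (hT.tendsto_rate_mul (j := j) hX hδ hM)
    (Or.inr ENNReal.zero_ne_top) h1 (Or.inr ENNReal.ofReal_ne_top)
  rw [mul_zero] at h4
  refine h4.congr fun n => ?_
  rw [pow_succ, mul_assoc]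

/-- The tail is at least of order `n ^ (-(α + 1))`, so the rate is at most of order `n ^ (α * j)`,
and the deviation bound is applied with that power and a moment order `κ` between `1` and `min α 2`.
-/
theorem TailData.exists_tendsto_rate_mul_truncDeviation (hT : TailData P (Z 0) α p)
    (hmeas : ∀ i, Measurable (Z i)) (hindep : iIndepFun Z P)
    (hident : ∀ i, IdentDistrib (Z i) (Z 0) P P) (hα : 1 < α) (hm : m = ∫ ω, Z 0 ω ∂P)
    (hM : 0 < M) (hε : 0 < ε) :
    ∃ δ₀ > 0, ∀ δ, 0 < δ → δ < δ₀ →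
      Tendsto (fun n : ℕ => ENNReal.ofReal (rate P (Z 0) j n) *
        P (truncDeviation Z M m δ ε n)) atTop (𝓝 0) := by
  obtain ⟨κ, hκ1, hκ2⟩ := exists_between (lt_min hα one_lt_two)
  obtain ⟨δ₀, hδ₀, h⟩ := tendsto_rpow_mul_truncDeviation hκ1 (hκ2.le.trans (min_le_right _ _))
    hmeas hindep hident (hT.integrable (hmeas 0) hα)
    (hT.integrable_rpow (hmeas 0) (by linarith) (hκ2.trans_le (min_le_left _ _))) hm hM hε
    (r := α * j) (by positivity)
  refine ⟨δ₀, hδ₀, fun δ hδ hδ' => ?_⟩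
  obtain ⟨c, hc, hcT⟩ := hT.exists_le_tail (β := α + 1) (by linarith) (by linarith)
  have h1 := ENNReal.tendsto_ofReal ((h δ hδ hδ').const_mul (c⁻¹ ^ j))
  rw [mul_zero, ENNReal.ofReal_zero] at h1
  refine tendsto_of_tendsto_of_tendsto_of_le_of_le' tendsto_const_nhds h1
    (Eventually.of_forall fun _ => zero_le) ?_
  filter_upwards [eventually_ge_atTop 1] with n hn
  have hn' : (0 : ℝ) < n := by exact_mod_cast hn
  have hTn := hT.tail_pos n
  rw [← ofReal_measureReal, ← ENNReal.ofReal_mul (by unfold rate; positivity), ← mul_assoc]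
  refine ENNReal.ofReal_le_ofReal (mul_le_mul_of_nonneg_right ?_ measureReal_nonneg)
  have h2 : c * (n : ℝ) ^ (-α) ≤ n * P.real {ω | (n : ℝ) < |Z 0 ω|} := by
    have e : (n : ℝ) ^ (-α) = n * (n : ℝ) ^ (-(α + 1)) := by
      rw [show -α = 1 + -(α + 1) by ring, Real.rpow_add hn', Real.rpow_one]
    rw [e, mul_left_comm]
    gcongr
    exact hcT n hn
  have h3 : (n : ℝ) ^ (α * j) = ((n : ℝ) ^ α) ^ j := by
    rw [Real.rpow_mul hn'.le, Real.rpow_natCast]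
  rw [rate, h3, ← inv_pow, ← mul_pow]
  refine pow_le_pow_left₀ (by positivity) ?_ j
  refine (inv_anti₀ (by positivity) h2).trans (le_of_eq ?_)
  rw [mul_inv, Real.rpow_neg hn'.le, inv_inv]

end Negligible

/-! ### The convergence theorem -/

theorem ofReal_sub_le_edist_of_mem_cthickening {S : Type*} [PseudoEMetricSpace S] {F C : Set S}
    {r s : ℝ} (hs : 0 ≤ s) (hF : ∀ x ∈ F, ∀ y ∈ C, ENNReal.ofReal r ≤ edist x y) {x y : S}
    (hx : x ∈ Metric.cthickening s F) (hy : y ∈ C) : ENNReal.ofReal (r - s) ≤ edist x y := by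
  rw [ENNReal.ofReal_sub _ hs, tsub_le_iff_left]
  have h1 : ENNReal.ofReal r ≤ Metric.infEDist y F := by
    refine Metric.le_infEDist.2 fun z hz => ?_
    rw [edist_comm]
    exact hF z hz y hy
  refine h1.trans (Metric.infEDist_le_infEDist_add_edist.trans (add_le_add hx ?_))
  rw [edist_comm]

section Main

variable {Ω : Type*} [MeasurableSpace Ω] {P : Measure Ω} [IsProbabilityMeasure P]
  {Z : ℕ → Ω → ℝ} {α p M m : ℝ} {j : ℕ}

theorem TailData.exists_tendsto_negligible (hT : TailData P (Z 0) α p)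
    (hmeas : ∀ i, Measurable (Z i)) (hindep : iIndepFun Z P)
    (hident : ∀ i, IdentDistrib (Z i) (Z 0) P P) (hα : 1 < α) (hm : m = ∫ ω, Z 0 ω ∂P)
    (hM : 0 < M) {ε r : ℝ} (hε : 0 < ε) (hr : 0 < r) :
    ∃ δ, 0 < δ ∧ δ < r ∧ Tendsto (fun n : ℕ => ENNReal.ofReal (rate P (Z 0) j n) *
      (P (truncDeviation Z M m δ ε n) +
        (⌊(n : ℝ) * M⌋₊ * P.map (fun ω => Z 0 ω / n) (away δ)) ^ (j + 1))) atTop (𝓝 0) := by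
  obtain ⟨δ₀, hδ₀, h⟩ :=
    hT.exists_tendsto_rate_mul_truncDeviation (j := j) hmeas hindep hident hα hm hM hε
  obtain ⟨δ, hδ, hδ'⟩ := exists_between (lt_min hδ₀ hr)
  refine ⟨δ, hδ, hδ'.trans_le (min_le_right _ _), ?_⟩
  have h1 := (h δ hδ (hδ'.trans_le (min_le_left _ _))).add
    (hT.tendsto_rate_mul_pow_succ (j := j) (hmeas 0) hα hδ hM)
  rw [add_zero] at h1
  refine h1.congr fun n => ?_
  rw [mul_add]

theorem eventually_abs_le_natCast_mul (m : ℝ) {ε : ℝ} (hε : 0 < ε) :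
    ∀ᶠ n : ℕ in atTop, |m| ≤ n * ε :=
  (tendsto_natCast_atTop_atTop.atTop_mul_const hε).eventually_ge_atTop |m|

theorem TailData.limsup_le_cthickening (hT : TailData P (Z 0) α p)
    (hmeas : ∀ i, Measurable (Z i)) (hindep : iIndepFun Z P)
    (hident : ∀ i, IdentDistrib (Z i) (Z 0) P P) (hα : 1 < α) (hp₀ : 0 ≤ p) (hp₁ : p ≤ 1)
    (hm : m = ∫ ω, Z 0 ω ∂P) (hM : 0 < M) {F : Set (SkorohodSpace M)} {r s : ℝ}
    (hF : ∀ x ∈ F, ∀ y ∈ stepLE M m j, ENNReal.ofReal r ≤ edist x y) (hs : 0 < s) (hsr : s < r) :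
    limsup (fun n : ℕ => ENNReal.ofReal (rate P (Z 0) (j + 1) n) *
      P {ω | walkPath M n (fun k => Z k ω) ∈ F}) atTop ≤
      limitMeasure M m α p (j + 1) (Metric.cthickening s F) := by
  have hε : 0 < s / 2 := by positivity
  obtain ⟨δ, hδ, -, hneg⟩ := hT.exists_tendsto_negligible (j := j + 1) hmeas hindep hident hα hm hM
    hε one_pos
  set F' := Metric.cthickening s F with hF'
  have hF'c : IsClosed F' := Metric.isClosed_cthickening
  -- The preimage of `F'` need not be closed, since `stepDrift` can be discontinuous at non-interior
  -- times. All monotone tuples of this kind are therefore added, which gives a closed set and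
  -- changes the limit by a null set.
  set C : Set ((Fin (j + 1) → ℝ) × (Fin (j + 1) → ℝ)) := {q | Monotone q.2} ∩
    {q | q.2 ∈ interiorTimes M (j + 1) ∧ stepDrift M m (j + 1) q ∈ F'ᶜ}ᶜ with hC
  have hCc : IsClosed C := by
    refine IsClosed.inter ?_ (isOpen_interior_stepDrift hM hF'c.isOpen_compl).isClosed_compl
    have : {q : (Fin (j + 1) → ℝ) × (Fin (j + 1) → ℝ) | Monotone q.2} =
        ⋂ i, ⋂ l, ⋂ _ : i ≤ l, {q | q.2 i ≤ q.2 l} := by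
      ext q
      simp [Monotone]
    rw [this]
    exact isClosed_iInter fun i => isClosed_iInter fun l => isClosed_iInter fun _ =>
      isClosed_le (by fun_prop) (by fun_prop)
  have hbound : ∀ᶠ n : ℕ in atTop, ENNReal.ofReal (rate P (Z 0) (j + 1) n) *
      P {ω | walkPath M n (fun k => Z k ω) ∈ F} ≤
      ((fun n : ℕ => ENNReal.ofReal (rate P (Z 0) (j + 1) n) *
        gridSum (P.map fun ω => Z 0 ω / n) δ n ⌊(n : ℝ) * M⌋₊ C) + fun n : ℕ =>
      ENNReal.ofReal (rate P (Z 0) (j + 1) n) * (P (truncDeviation Z M m δ (s / 2) n) +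
        (⌊(n : ℝ) * M⌋₊ * P.map (fun ω => Z 0 ω / n) (away δ)) ^ (j + 2))) n := by
    filter_upwards [eventually_ge_atTop 1, eventually_abs_le_natCast_mul m hε] with n hn hmn
    rw [Pi.add_apply, ← mul_add]
    gcongr
    refine measure_walkPath_le hmeas hindep hident hn hM.le hδ.le hε.le hmn
      (r := r) (by linarith) hF hCc.measurableSet fun q hq hqF => ⟨hq.2.1.monotone, ?_⟩
    rintro ⟨-, h⟩
    rw [show 2 * (s / 2) = s by ring] at hqF
    exact h hqF
  refine (limsup_le_limsup hbound).trans ?_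
  rw [ENNReal.limsup_add_of_right_tendsto_zero hneg]
  refine ((hT.gridSum_limits (hmeas 0) (by linarith) hp₀ hp₁ hδ hM).1 C hCc).trans ?_
  rw [limitMeasure_apply hM hF'c.measurableSet]
  have hsub : C ∩ (univ.pi fun _ => away δ) ×ˢ univ.pi (fun _ => Icc 0 M) ⊆
      (stepDrift M m (j + 1) ⁻¹' F' ∩ jumpDomain M (j + 1)) ∪
        {q | Monotone q.2 ∧ (∀ i, q.2 i ∈ Icc 0 M) ∧ q.2 ∉ interiorTimes M (j + 1)} := by
    rintro q ⟨⟨hq1, hq2⟩, hq3, hq4⟩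
    by_cases hint : q.2 ∈ interiorTimes M (j + 1)
    · refine Or.inl ⟨?_, fun i => ?_, interiorTimes_subset_jumpTimes hint⟩
      · by_contra h
        exact hq2 ⟨hint, h⟩
      · have : δ < |q.1 i| := hq3 i (mem_univ i)
        exact abs_pos.1 (hδ.trans this)
    · exact Or.inr ⟨hq1, fun i => hq4 i (mem_univ i), hint⟩
  refine (measure_mono hsub).trans ((measure_union_le _ _).trans ?_)
  rw [prod_volume_null, add_zero]

theorem TailData.le_liminf_compl_cthickening (hT : TailData P (Z 0) α p)
    (hmeas : ∀ i, Measurable (Z i)) (hindep : iIndepFun Z P)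
    (hident : ∀ i, IdentDistrib (Z i) (Z 0) P P) (hα : 1 < α) (hp₀ : 0 ≤ p) (hp₁ : p ≤ 1)
    (hm : m = ∫ ω, Z 0 ω ∂P) (hM : 0 < M) {G : Set (SkorohodSpace M)} {r s : ℝ} (hr : 0 < r)
    (hG : ∀ x ∈ G, ∀ y ∈ stepLE M m j, ENNReal.ofReal r ≤ edist x y) (hs : 0 < s) :
    limitMeasure M m α p (j + 1) (Metric.cthickening s Gᶜ)ᶜ ≤
      liminf (fun n : ℕ => ENNReal.ofReal (rate P (Z 0) (j + 1) n) *
        P {ω | walkPath M n (fun k => Z k ω) ∈ G}) atTop := by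
  have hε : 0 < s / 2 := by positivity
  -- Here `δ < r` matters: all jumps of step functions in `G` have size at least `r`, so the
  -- restriction to `away δ` loses no mass.
  obtain ⟨δ, hδ, hδr, hneg⟩ := hT.exists_tendsto_negligible (j := j + 1) hmeas hindep hident hα hm
    hM hε hr
  set G' := (Metric.cthickening s Gᶜ)ᶜ with hG'
  have hG'o : IsOpen G' := Metric.isClosed_cthickening.isOpen_compl
  have hG'G : G' ⊆ G := fun x hx => by
    by_contra h
    exact hx (Metric.self_subset_cthickening _ h)
  set O : Set ((Fin (j + 1) → ℝ) × (Fin (j + 1) → ℝ)) :=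
    {q | q.2 ∈ interiorTimes M (j + 1) ∧ stepDrift M m (j + 1) q ∈ G'} with hO
  have hOo : IsOpen O := isOpen_interior_stepDrift hM hG'o
  have hbound : ∀ᶠ n : ℕ in atTop, ENNReal.ofReal (rate P (Z 0) (j + 1) n) *
      gridSum (P.map fun ω => Z 0 ω / n) δ n ⌊(n : ℝ) * M⌋₊ O ≤
      ((fun n : ℕ => ENNReal.ofReal (rate P (Z 0) (j + 1) n) *
        P {ω | walkPath M n (fun k => Z k ω) ∈ G}) + fun n : ℕ =>
      ENNReal.ofReal (rate P (Z 0) (j + 1) n) * (P (truncDeviation Z M m δ (s / 2) n) +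
        (⌊(n : ℝ) * M⌋₊ * P.map (fun ω => Z 0 ω / n) (away δ)) ^ (j + 2))) n := by
    filter_upwards [eventually_ge_atTop 1, eventually_abs_le_natCast_mul m hε] with n hn hmn
    rw [Pi.add_apply, ← mul_add]
    gcongr
    refine gridSum_le_measure_walkPath hmeas hindep hident hn hε.le hmn hOo.measurableSet
      (fun q hq => hq.1.1) fun q hq => ?_
    rw [show 2 * (s / 2) = s by ring]
    exact hq.2
  rw [← ENNReal.liminf_add_of_right_tendsto_zero hneg]
  refine le_trans ?_ (liminf_le_liminf hbound)
  refine le_trans ?_ ((hT.gridSum_limits (hmeas 0) (by linarith) hp₀ hp₁ hδ hM).2 O hOo)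
  rw [limitMeasure_apply hM hG'o.measurableSet]
  have hsub : stepDrift M m (j + 1) ⁻¹' G' ∩ jumpDomain M (j + 1) ⊆
      (O ∩ (univ.pi fun _ => away δ) ×ˢ univ.pi fun _ => Icc 0 M) ∪
        {q | Monotone q.2 ∧ (∀ i, q.2 i ∈ Icc 0 M) ∧ q.2 ∉ interiorTimes M (j + 1)} := by
    rintro q ⟨hq1, hq2⟩
    by_cases hint : q.2 ∈ interiorTimes M (j + 1)
    · refine Or.inl ⟨⟨hint, hq1⟩, fun i _ => ?_, fun i _ => hq2.2.2 i⟩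
      exact hδr.trans_le (le_abs_of_separated hG hq2 (hG'G hq1) i)
    · exact Or.inr ⟨hq2.2.1.monotone, hq2.2.2, hint⟩
  refine (measure_mono hsub).trans ((measure_union_le _ _).trans ?_)
  rw [prod_volume_null, add_zero]

theorem TailData.tendstoMO (hT : TailData P (Z 0) α p)
    (hmeas : ∀ i, Measurable (Z i)) (hindep : iIndepFun Z P)
    (hident : ∀ i, IdentDistrib (Z i) (Z 0) P P) (hα : 1 < α) (hp₀ : 0 ≤ p) (hp₁ : p ≤ 1)
    (hm : m = ∫ ω, Z 0 ω ∂P) (hM : 0 < M) :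
    TendstoMO (stepLE M m j)
      (fun n => ENNReal.ofReal (rate P (Z 0) (j + 1) n) •
        P.map (fun ω => walkPath M n (fun k => Z k ω)))
      (limitMeasure M m α p (j + 1)) := by
  have hα0 : 0 < α := by linarith
  have happly : ∀ (n : ℕ) (A : Set (SkorohodSpace M)), MeasurableSet A →
      (ENNReal.ofReal (rate P (Z 0) (j + 1) n) •
        P.map (fun ω => walkPath M n (fun k => Z k ω))) A =
      ENNReal.ofReal (rate P (Z 0) (j + 1) n) *
        P {ω | walkPath M n (fun k => Z k ω) ∈ A} := fun n A hA => by
    rw [Measure.smul_apply, smul_eq_mul, Measure.map_apply (measurable_walkPath hmeas n) hA]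
    rfl
  have hfin := finiteAwayFrom_limitMeasure (m := m) (j := j) hM hα0 hp₀ hp₁
  refine ⟨isClosed_stepLE hM, fun n A hA _ => ?_, hfin, fun F hFc hsep => ?_,
    fun G hGo hsep => ?_⟩
  · rw [happly n A hA]
    exact ENNReal.mul_lt_top ENNReal.ofReal_lt_top (measure_lt_top _ _)
  · obtain ⟨r, hr, hF⟩ := exists_ofReal_le_edist hsep
    simp only [happly _ F hFc.measurableSet]
    have hlim : Tendsto (fun s => limitMeasure M m α p (j + 1) (Metric.cthickening s F)) (𝓝[>] 0)
        (𝓝 (limitMeasure M m α p (j + 1) F)) := by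
      -- Continuity from above requires one thickening of finite mass; that of radius `r / 2` is
      -- still separated from `stepLE M m j`.
      refine (tendsto_measure_cthickening_of_isClosed ⟨r / 2, by positivity, ?_⟩ hFc).mono_left
        nhdsWithin_le_nhds
      refine (hfin _ Metric.isClosed_cthickening.measurableSet ⟨ENNReal.ofReal (r - r / 2),
        (ENNReal.ofReal_pos.2 (by linarith)).ne', fun x hx y hy => ?_⟩).ne
      exact ofReal_sub_le_edist_of_mem_cthickening (by positivity) hF hx hy
    refine ge_of_tendsto hlim ?_
    filter_upwards [self_mem_nhdsWithin, nhdsWithin_le_nhds (Iio_mem_nhds hr)] with s hs hsr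
    exact hT.limsup_le_cthickening hmeas hindep hident hα hp₀ hp₁ hm hM hF hs hsr
  · obtain ⟨r, hr, hG⟩ := exists_ofReal_le_edist hsep
    simp only [happly _ G hGo.measurableSet]
    set Λ := limitMeasure M m α p (j + 1) with hΛ
    have hΛG : Λ G ≠ ∞ := (hfin G hGo.measurableSet hsep).ne
    -- Thickenings of `Gᶜ` may have infinite `Λ`-mass near `stepLE M m j`. After restriction to `G`
    -- the mass is finite, and the part of `G` near its complement vanishes in the limit.
    have hfinG : IsFiniteMeasure (Λ.restrict G) :=
      ⟨by rw [Measure.restrict_apply_univ]; exact hΛG.lt_top⟩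
    have hlim : Tendsto (fun s => liminf (fun n : ℕ => ENNReal.ofReal (rate P (Z 0) (j + 1) n) *
        P {ω | walkPath M n (fun k => Z k ω) ∈ G}) atTop +
        Λ.restrict G (Metric.cthickening s Gᶜ)) (𝓝[>] 0)
        (𝓝 (liminf (fun n : ℕ => ENNReal.ofReal (rate P (Z 0) (j + 1) n) *
        P {ω | walkPath M n (fun k => Z k ω) ∈ G}) atTop + Λ.restrict G Gᶜ)) :=
      tendsto_const_nhds.add ((tendsto_measure_cthickening_of_isClosed
        ⟨1, one_pos, measure_ne_top _ _⟩ hGo.isClosed_compl).mono_left nhdsWithin_le_nhds)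
    rw [Measure.restrict_apply hGo.measurableSet.compl, compl_inter_self, measure_empty,
      add_zero] at hlim
    refine ge_of_tendsto hlim ?_
    filter_upwards [self_mem_nhdsWithin] with s hs
    refine le_trans ?_ (add_le_add_left
      (hT.le_liminf_compl_cthickening hmeas hindep hident hα hp₀ hp₁ hm hM hr hG hs) _)
    rw [Measure.restrict_apply Metric.isClosed_cthickening.measurableSet]
    refine (measure_mono fun x hx => ?_).trans (measure_union_le _ _)
    by_cases h : x ∈ Metric.cthickening s Gᶜ
    · exact Or.inr ⟨h, hx⟩
    · exact Or.inl h

end Main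

end HiddenLD

theorem corollary3p9 {Ω : Type*} [MeasurableSpace Ω] (P : Measure Ω) [IsProbabilityMeasure P]
    (Z : ℕ → Ω → ℝ) (hmeas : ∀ i, Measurable (Z i)) (hindep : iIndepFun Z P)
    (hident : ∀ i, IdentDistrib (Z i) (Z 0) P P)
    (α p : ℝ) (hα : 1 < α) (hRV : HiddenLD.IsRegVar P (Z 0) α p)
    (m : ℝ) (hm : m = ∫ ω, Z 0 ω ∂P)
    (M : ℝ) (hM : 0 < M) (j : ℕ) (hj : 1 ≤ j) :
    Integrable (Z 0) P ∧
    HiddenLD.TendstoMO (HiddenLD.stepLE M m (j - 1))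
      (fun n => ENNReal.ofReal (HiddenLD.rate P (Z 0) j n) •
        P.map (fun ω => HiddenLD.walkPath M n (fun k => Z k ω)))
      (HiddenLD.limitMeasure M m α p j) := by
  have hT := hRV.tailData (hmeas 0) (by linarith)
  obtain ⟨j, rfl⟩ := Nat.exists_eq_add_of_le' hj
  exact ⟨hT.integrable (hmeas 0) hα,
    hT.tendstoMO hmeas hindep hident hα hRV.p_nonneg hRV.p_le_one hm hM⟩
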